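/- **Setting.** Let $N,n\ge 1$ and $0\le m\le N$ be integers. Consider fields $u_0,\dots,u_{N-1}$ (functions of $x$), put $u_N=-1$, and work with differential polynomials in the jet variables $\partial_x^k u_i$ over $\mathbb R$. Put $$J_i=\tfrac14\delta_{i0}\partial_x^3+\tfrac12(u_i\partial_x+\partial_xu_i),\qquad \mathcal J_i(f,g)=-\tfrac1{16}\delta_{i0}(f_{xx}g+fg_{xx}-f_xg_x)-\tfrac14u_ifg .$$ Let $P_0=2,P_1,P_2,\dots$ be the differential polynomials such that $\mathcal P=\sum_{k\ge0}P_k\lambda^{-k}$ satisfies $\sum_{i=0}^N\lambda^i\mathcal J_i(\mathcal P,\mathcal P)=\lambda^N$, and put $P_k=0$ for $k<0$. The $r$-th flow of the $N$-field coupled KdV hierarchy is $\boldsymbol u_{t_r}=\boldsymbol K_r$, i.e. $(u_{i-1})_{t_r}=(\boldsymbol K_r)_i=\sum_{j=0}^{i-1}J_jP_{j-i+r}$ for $i=1,\dots,N$, prolonged to all jet variables by $(\partial_x^ku_{i-1})_{t_r}=\partial_x^k(\boldsymbol K_r)_i$. The stationary manifold $\mathcal M_n$ is the set of jets that satisfy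 $\boldsymbol K_{n+1}=0$ and all its $x$-derivatives; the $n$-th stationary cKdV system consists of the first $n$ flows on $\mathcal M_n$. Finally let $$h_k=\sum_{i=0}^N\sum_{j=i}^k\mathcal J_i(P_{n-k+j},P_{n+i-j}).$$ **Stäckel system.** On the extended phase space with coordinates $(\boldsymbol q,\boldsymbol p,\boldsymbol c)\in\mathbb R^n\times\mathbb R^n\times\mathbb R^N$ put $q_0=1$ and $q_i=0$ for $i<0$ or $i>n$. Let $R$ be the $n\times n$ matrix with first column $(-q_1,\dots,-q_n)^T$, ones directly above the diagonal and zeros elsewhere (the diagonal entry $-q_1$ being part of the first column). Put $(G_0)^{ij}=2q_{i+j-n-1}$, $G_m=R^mG_0$, $\mathcal V^{(e)}=R^e(0,\dots,0,-1)^T$ for $e\in\mathbb Z$, and let $(A_k)^i_j$ be $q_{i-j+k-1}$ if $i\le j$ and $k\le j$, $-q_{i-j+k-1}$ if $i>j$ and $k>j$, and $0$ otherwise. The Hamiltonians are $$H_k=\tfrac12\boldsymbol p^TA_kG_m\boldsymbol p+\mathcal V_k^{(2n+N-m)}+\sum_{i=1}^{N-m}c_{m+i}\mathcal V_k^{(n+i-1)}+\sum_{i=1}^mc_i\mathcal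 V_k^{(i-m-1)},\qquad k=1,\dots,n,$$ on the open set $\Omega_m$ where $G_m(\boldsymbol q)$ is invertible (everything if $m=0$; $q_n\ne0$ if $m\ge1$). The $r$-th flow of the Stäckel system is $\boldsymbol q_{t_r}=\partial H_r/\partial\boldsymbol p$, $\boldsymbol p_{t_r}=-\partial H_r/\partial\boldsymbol q$, $\boldsymbol c_{t_r}=0$. **Theorem.** Let $\Phi_m$ be the map from jets to $(\boldsymbol q,\boldsymbol p,\boldsymbol c)$ given by $$q_i=\tfrac12P_i,\qquad p_i=\tfrac12\sum_{j=1}^n(G_m^{-1})_{ij}(P_j)_x\quad(1\le i\le n),$$ $$c_i=h_{i-1}\ (1\le i\le m),\qquad c_i=h_{n+i-1}\ (m<i\le N),$$ where $G_m$ is evaluated at $q_i=\tfrac12P_i$, and let $\mathcal M_n^{(m)}\subseteq\mathcal M_n$ be the set where this $G_m$ is invertible. Then: 1. The $H_k$ are smooth on $\Omega_m$ and are the Stäckel Hamiltonians of the separation curve $$\lambda^{2n+N-m}+\sum_{k=1}^{N-m}c_{m+k}\lambda^{n+k-1}+\sum_{k=1}^nH_k\lambda^{n-k}+\sum_{k=1}^mc_k\lambda^{k-m-1}=\lambda^m\mu^2$$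 written in Viète coordinates: whenever $\lambda_1,\dots,\lambda_n\in\mathbb C$ are distinct, $\mu_1,\dots,\mu_n\in\mathbb C$, $(\boldsymbol q,\boldsymbol p,\boldsymbol c)\in\Omega_m$, $q_i=(-1)^is_i(\lambda_1,\dots,\lambda_n)$ with $s_i$ the elementary symmetric polynomials, and $p_i=-\sum_k\lambda_k^{n-i}\mu_k/\prod_{j\ne k}(\lambda_k-\lambda_j)$, all the points $(\lambda_i,\mu_i)$ lie on the curve. 2. The first flow of the hierarchy is the translation in $x$ (so that $t_1\equiv x$). 3. $\Phi_m$ is a bijection of $\mathcal M_n^{(m)}$ onto $\Omega_m$; every jet variable is a smooth function on $\Omega_m$ under its inverse. For each $r=1,\dots,n$, $\Phi_m$ maps the $r$-th flow of the stationary cKdV system on $\mathcal M_n^{(m)}$ onto the $r$-th flow of the Stäckel system on $\Omega_m$: the derivative of $\Phi_m$ along the $r$-th cKdV flow at a jet in $\mathcal M_n^{(m)}$ is the $r$-th Stäckel vector field at the image, and the derivative of each jet variable of $\Phi_m^{-1}$ along the $r$-th Stäckel vector field is the corresponding component of the $r$-th cKdV flow. As $m$ ranges over $\{0,\dots,N\}$,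 this gives $N+1$ Stäckel representations of the stationary cKdV system. -/

import Mathlib

open scoped ContDiff

noncomputable section

namespace CKdV

/-! ## Differential polynomials and the coupled KdV hierarchy

Fields are numbered `0, …, N-1`. The jet variable `∂ₓᵏ uᵢ` is the variable `(i, k)`. -/

/-- Differential polynomials in the fields `u_0, …, u_{N-1}` with real coefficients. -/
abbrev DiffPoly (N : ℕ) : Type := MvPolynomial (Fin N × ℕ) ℝ

/-- The total derivative `∂ₓ`, the derivation with `∂ₓ (∂ₓᵏ uᵢ) = ∂ₓᵏ⁺¹ uᵢ`. -/
def dx {N : ℕ} : Derivation ℝ (DiffPoly N) (DiffPoly N) :=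
  MvPolynomial.mkDerivation ℝ fun a => MvPolynomial.X (a.1, a.2 + 1)

/-- The coefficients of `ℚ(λ) = ∑_{i ≤ N} u_i λ^i`: the fields for `i < N`, and `u_N = -1`. -/
def field (N i : ℕ) : DiffPoly N :=
  if h : i < N then MvPolynomial.X (⟨i, h⟩, 0) else if i = N then -1 else 0

/-- The operator `J_i = ¼ δ_{i0} ∂ₓ³ + ½ (u_i ∂ₓ + ∂ₓ u_i)`. -/
def opJ (N i : ℕ) (f : DiffPoly N) : DiffPoly N :=
  (if i = 0 then (1 / 4 : ℝ) • dx (dx (dx f)) else 0)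
    + (1 / 2 : ℝ) • (field N i * dx f + dx (field N i * f))

/-- The bilinear operator
`𝒥_i(f, g) = -(1/16) δ_{i0} (f_xx g + f g_xx - f_x g_x) - ¼ u_i f g`. -/
def bilJ (N i : ℕ) (f g : DiffPoly N) : DiffPoly N :=
  (if i = 0 then -((1 / 16 : ℝ) • (dx (dx f) * g + f * dx (dx g) - dx f * dx g)) else 0)
    - (1 / 4 : ℝ) • (field N i * f * g)

/-- The coefficients `P_k` of the series `𝒫 = ∑_{k ≥ 0} P_k λ^{-k}` with `P_0 = 2` and
`𝒥(𝒫, 𝒫) = λ^N`, where `𝒥 = ∑_i 𝒥_i λ^i`. The coefficient of `λ^{N-k}` in this equation is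
`P_k` plus the terms `𝒥_i(P_a, P_b)` with `a, b < k` and `a + b = i + k - N`. -/
def coeffP (N : ℕ) : ℕ → DiffPoly N
  | 0 => 2
  | k + 1 => -∑ i ∈ Finset.range (N + 1), ∑ a : Fin (k + 1), ∑ b : Fin (k + 1),
      if (a : ℕ) + b + N = i + (k + 1) then bilJ N i (coeffP N a) (coeffP N b) else 0
  decreasing_by
    · exact a.isLt
    · exact b.isLt

/-- The `coeffP N k` are indeed the coefficients of the series with `P_0 = 2` and
`𝒥(𝒫, 𝒫) = λ^N`: the coefficient of `λ^{N-k}` is `1` for `k = 0` and `0` for `k ≥ 1`. -/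
theorem coeffP_quadratic (N k : ℕ) (hN : 1 ≤ N) :
    (∑ i ∈ Finset.range (N + 1), ∑ a ∈ Finset.range (k + 1), ∑ b ∈ Finset.range (k + 1),
      if a + b + N = i + k then bilJ N i (coeffP N a) (coeffP N b) else 0)
      = if k = 0 then 1 else 0 := by
  have hN0 : N ≠ 0 := by omega
  have hsm : ∀ (r : ℝ) (f : DiffPoly N), r • f = MvPolynomial.C r * f :=
    fun r f => MvPolynomial.smul_eq_C_mul f r
  have hC4 : MvPolynomial.C (1 / 4 : ℝ) * (4 : DiffPoly N) = 1 := by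
    rw [show (4 : DiffPoly N) = MvPolynomial.C (4 : ℝ) from (map_ofNat _ 4).symm, ← map_mul]
    norm_num
  have h1 : ∀ f : DiffPoly N,
      bilJ N N (coeffP N 0) f = MvPolynomial.C (1 / 4 : ℝ) * (2 * f) := by
    intro f
    simp [bilJ, field, coeffP, hN0, hsm]
  have h2 : ∀ f : DiffPoly N,
      bilJ N N f (coeffP N 0) = MvPolynomial.C (1 / 4 : ℝ) * (2 * f) := by
    intro f
    simp [bilJ, field, coeffP, hN0, hsm, mul_comm]
  rcases k with _ | l
  · rw [Finset.sum_eq_single N]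
    · simp only [zero_add, Finset.sum_range_one, add_zero, if_true]
      rw [h1, coeffP]
      linear_combination hC4
    · intro i _ hi
      have : ¬ N = i := fun h => hi h.symm
      simp [this]
    · simp
  · have key : ∀ i ∈ Finset.range (N + 1),
        (∑ a ∈ Finset.range (l + 1 + 1), ∑ b ∈ Finset.range (l + 1 + 1),
          if a + b + N = i + (l + 1) then bilJ N i (coeffP N a) (coeffP N b) else 0)
        = (∑ a : Fin (l + 1), ∑ b : Fin (l + 1),
          if (a : ℕ) + b + N = i + (l + 1) then bilJ N i (coeffP N a) (coeffP N b) else 0)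
          + if i = N then coeffP N (l + 1) else 0 := by
      intro i hi
      have hi' : i ≤ N := by simpa [Nat.lt_succ_iff] using hi
      rw [Finset.sum_range_succ]
      simp_rw [Finset.sum_range_succ _ (l + 1)]
      rw [Finset.sum_add_distrib, ← Fin.sum_univ_eq_sum_range
        (fun a => ∑ b ∈ Finset.range (l + 1),
          if a + b + N = i + (l + 1) then bilJ N i (coeffP N a) (coeffP N b) else 0) (l + 1)]
      simp_rw [← Fin.sum_univ_eq_sum_range
        (fun b => if _ + b + N = i + (l + 1) then bilJ N i (coeffP N _) (coeffP N b) else 0)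
        (l + 1)]
      rw [if_neg (show ¬ (l + 1 + (l + 1) + N = i + (l + 1)) by omega), add_assoc, add_zero]
      congr 1
      by_cases h : i = N
      · subst h
        rw [Finset.sum_eq_single 0, Fin.sum_univ_eq_sum_range
          (fun b => if l + 1 + b + i = i + (l + 1) then
            bilJ i i (coeffP i (l + 1)) (coeffP i b) else 0) (l + 1),
          Finset.sum_eq_single 0, if_pos (by omega), if_pos (by omega), if_pos rfl, h1, h2]
        · linear_combination (coeffP i (l + 1)) * hC4
        · intro b _ hb
          rw [if_neg (by omega)]
        · simp
        · intro b _ hb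
          rw [if_neg (by omega)]
        · simp
      · rw [if_neg h, Finset.sum_eq_zero, Finset.sum_eq_zero, add_zero]
        · intro b _
          rw [if_neg (by omega)]
        · intro b _
          rw [if_neg (by omega)]
    rw [Finset.sum_congr rfl key, Finset.sum_add_distrib, Finset.sum_ite_eq']
    simp only [Finset.mem_range, Nat.lt_succ_self, if_true, Nat.succ_ne_zero, if_false]
    rw [coeffP.eq_2]
    exact add_neg_cancel _

/-- The `P_k` indexed by integers, with `P_k = 0` for `k < 0`. -/
def coeffPZ (N : ℕ) (k : ℤ) : DiffPoly N := if 0 ≤ k then coeffP N k.toNat else 0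

/-- The vector fields of the hierarchy `u_{t_r} = K_r`; the component of the field `u_i` is
`∑_{j ≤ i} J_j P_{j - (i+1) + r}`. -/
def fieldK (N r : ℕ) (i : Fin N) : DiffPoly N :=
  ∑ j ∈ Finset.range ((i : ℕ) + 1), opJ N j (coeffPZ N ((j : ℤ) - ((i : ℤ) + 1) + r))

/-- The functions `h_k = ∑_{i ≤ N} ∑_{j=i}^k 𝒥_i(P_{n-k+j}, P_{n+i-j})`, that is, the
coefficients of `λ^k` in `𝒥(ℙ_{n+1}, ℙ_{n+1})` with `ℙ_{n+1} = ∑_{i ≤ n} P_{n-i} λ^i`. -/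
def coeffH (N n k : ℕ) : DiffPoly N :=
  ∑ i ∈ Finset.range (N + 1), ∑ j ∈ Finset.Icc i k,
    bilJ N i (coeffPZ N ((n : ℤ) - k + j)) (coeffPZ N ((n : ℤ) + i - j))

/-- Points of the jet space: real values for all the jet variables `∂ₓᵏ uᵢ`. -/
abbrev Jet (N : ℕ) : Type := Fin N × ℕ → ℝ

/-- The value of a differential polynomial at a jet. -/
def val {N : ℕ} (ξ : Jet N) (f : DiffPoly N) : ℝ := MvPolynomial.eval ξ f

/-- The stationary manifold `M_n`: the jets that satisfy `K_{n+1} = 0` together with all its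
differential consequences `∂ₓᵏ K_{n+1} = 0`. -/
def stationaryManifold (N n : ℕ) : Set (Jet N) :=
  {ξ | ∀ (i : Fin N) (k : ℕ), val ξ (dx^[k] (fieldK N (n + 1) i)) = 0}

/-- The `r`-th flow as a vector field on the jet space: `u_{t_r} = K_r` prolonged to all
the jet variables, `(∂ₓᵏ uᵢ)_{t_r} = ∂ₓᵏ (K_r)ᵢ`. -/
def jetFlow (N r : ℕ) (ξ : Jet N) : Jet N := fun a => val ξ (dx^[a.2] (fieldK N r a.1))

/-! ## Stäckel systems of Benenti type in extended Viète coordinates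

The coordinates `q_1, …, q_n`, `p_1, …, p_n`, `c_1, …, c_N` are stored with indices from `0`,
so `q i` with `i : Fin n` is `q_{i+1}`; matrices are shifted in the same way. -/

/-- The extended phase space with coordinates `(q, p, c)`. -/
abbrev Phase (N n : ℕ) : Type := (Fin n → ℝ) × (Fin n → ℝ) × (Fin N → ℝ)

/-- `q_i` for all integers `i` (numbered from 1), with `q_0 = 1` and `q_i = 0` for `i < 0` or
`i > n`. -/
def qExt {n : ℕ} (q : Fin n → ℝ) (i : ℤ) : ℝ :=
  if i = 0 then 1 else ∑ j : Fin n, if (j : ℤ) + 1 = i then q j else 0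

/-- The matrix `R` (and special conformal Killing tensor `L`): first column `-q`, ones above
the diagonal. -/
def matR {n : ℕ} (q : Fin n → ℝ) : Matrix (Fin n) (Fin n) ℝ :=
  Matrix.of fun i j =>
    (if (j : ℕ) = 0 then -q i else 0) + (if (j : ℕ) = (i : ℕ) + 1 then 1 else 0)

/-- The contravariant metric `G_0`, `(G_0)^{ij} = 2 q_{i+j-n-1}`. -/
def metricZero {n : ℕ} (q : Fin n → ℝ) : Matrix (Fin n) (Fin n) ℝ :=
  Matrix.of fun i j => 2 * qExt q (((i : ℤ) + 1) + ((j : ℤ) + 1) - n - 1)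

/-- The contravariant metric `G_m = L^m G_0`. -/
def metric {n : ℕ} (m : ℕ) (q : Fin n → ℝ) : Matrix (Fin n) (Fin n) ℝ :=
  matR q ^ m * metricZero q

/-- The Killing tensors `A_k`: `(A_k)^i_j = q_{i-j+k-1}` if `i ≤ j` and `k ≤ j`,
`-q_{i-j+k-1}` if `i > j` and `k > j`, and `0` otherwise. -/
def killing {n : ℕ} (q : Fin n → ℝ) (k : Fin n) : Matrix (Fin n) (Fin n) ℝ :=
  Matrix.of fun i j =>
    if i ≤ j ∧ k ≤ j then
      qExt q (((i : ℤ) + 1) - ((j : ℤ) + 1) + ((k : ℤ) + 1) - 1)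
    else if j < i ∧ j < k then
      -qExt q (((i : ℤ) + 1) - ((j : ℤ) + 1) + ((k : ℤ) + 1) - 1)
    else 0

/-- The elementary separable potentials `𝒱^{(e)} = R^e (0, …, 0, -1)ᵀ`, `e ∈ ℤ`. -/
def elemPotential {n : ℕ} (q : Fin n → ℝ) (e : ℤ) : Fin n → ℝ :=
  Matrix.mulVec (matR q ^ e) fun i => if (i : ℕ) + 1 = n then -1 else 0

/-- The exponent of `λ` that accompanies `c_i` (here `i` is counted from `0`) in the separation
curve: `c_k λ^{k-m-1}` for `1 ≤ k ≤ m` and `c_{m+k} λ^{n+k-1}` for `1 ≤ k ≤ N-m`. -/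
def cExponent {N : ℕ} (n m : ℕ) (i : Fin N) : ℤ :=
  if (i : ℕ) < m then (i : ℤ) - m else (n : ℤ) + i - m

/-- The function
`σ(λ) = λ^{2n+N-m} + ∑_{k=1}^{N-m} c_{m+k} λ^{n+k-1} + ∑_{k=1}^m c_k λ^{k-m-1}`. -/
def sigma {N : ℕ} (n m : ℕ) (c : Fin N → ℝ) (lam : ℂ) : ℂ :=
  lam ^ (2 * (n : ℤ) + N - m) + ∑ i : Fin N, (c i : ℂ) * lam ^ cExponent n m i

/-- The potentials `V_k`, obtained from `σ` by replacing each `λ^e` by `𝒱_k^{(e)}`. -/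
def potential {N n : ℕ} (m : ℕ) (k : Fin n) (q : Fin n → ℝ) (c : Fin N → ℝ) : ℝ :=
  elemPotential q (2 * (n : ℤ) + N - m) k
    + ∑ i : Fin N, c i * elemPotential q (cExponent n m i) k

/-- The Stäckel Hamiltonians `H_k = ½ pᵀ A_k G_m p + V_k`. -/
def hamiltonian {N n : ℕ} (m : ℕ) (k : Fin n) (z : Phase N n) : ℝ :=
  (1 / 2) * (z.2.1 ⬝ᵥ Matrix.mulVec (killing z.1 k * metric m z.1) z.2.1)
    + potential m k z.1 z.2.2

/-- The open set of the phase space on which the metric `G_m` is non-degenerate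
(everything if `m = 0`, the set `q_n ≠ 0` if `m ≥ 1`). -/
def phaseDomain (N n m : ℕ) : Set (Phase N n) := {z | (metric m z.1).det ≠ 0}

/-- The `r`-th flow of the Stäckel system:
`q_{t_r} = ∂H_r/∂p`, `p_{t_r} = -∂H_r/∂q`, `c_{t_r} = 0`. -/
def stackelFlow {N n : ℕ} (m : ℕ) (r : Fin n) (z : Phase N n) : Phase N n :=
  (fun i => fderiv ℝ (fun p : Fin n → ℝ => hamiltonian m r (z.1, p, z.2.2)) z.2.1
      (Pi.single i 1),
   fun i => -fderiv ℝ (fun q : Fin n → ℝ => hamiltonian m r (q, z.2.1, z.2.2)) z.1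
      (Pi.single i 1),
   0)

/-- `(q, p)` are the Viète coordinates of the separation coordinates `(λ, μ)`:
`q_i = (-1)^i s_i(λ)` and `p_i = -∑_k λ_k^{n-i} μ_k / Δ_k` with `Δ_k = ∏_{j ≠ k} (λ_k - λ_j)`.
The roots `λ_i` of the real polynomial `λ^n + q_1 λ^{n-1} + … + q_n` may be complex. -/
def IsViete {n : ℕ} (lam mu : Fin n → ℂ) (q p : Fin n → ℝ) : Prop :=
  (∀ i : Fin n, (q i : ℂ) = (-1) ^ ((i : ℕ) + 1) *
    ∑ s ∈ Finset.powersetCard ((i : ℕ) + 1) Finset.univ, ∏ j ∈ s, lam j) ∧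
  (∀ i : Fin n, (p i : ℂ) =
    -∑ k : Fin n, lam k ^ (n - 1 - (i : ℕ)) * mu k /
      ∏ j ∈ Finset.univ.erase k, (lam k - lam j))

/-! ## The map from jets to extended Viète coordinates -/

/-- `q_i = ½ P_i`. -/
def mapQ (N n : ℕ) (ξ : Jet N) : Fin n → ℝ :=
  fun i => (1 / 2) * val ξ (coeffP N ((i : ℕ) + 1))

/-- `p_i = ½ ∑_j (G_m⁻¹)_{ij} (P_j)_x`, with `G_m` evaluated at `q = q[u]`. -/
def mapP (N n m : ℕ) (ξ : Jet N) : Fin n → ℝ :=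
  fun i => (1 / 2) * ∑ j : Fin n,
    (metric m (mapQ N n ξ))⁻¹ i j * val ξ (dx (coeffP N ((j : ℕ) + 1)))

/-- `c_i = h_{i-1}` for `1 ≤ i ≤ m` and `c_i = h_{n+i-1}` for `m < i ≤ N`. -/
def mapC (N n m : ℕ) (ξ : Jet N) : Fin N → ℝ :=
  fun i => val ξ (coeffH N n (if (i : ℕ) < m then (i : ℕ) else n + i))

/-- The map from jets to `(q, p, c)`. -/
def vieteMap (N n m : ℕ) (ξ : Jet N) : Phase N n :=
  (mapQ N n ξ, mapP N n m ξ, mapC N n m ξ)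

/-- The part of `M_n` on which the map is defined, i.e. where `G_m(q[u])` is invertible. -/
def jetDomain (N n m : ℕ) : Set (Jet N) :=
  {ξ | ξ ∈ stationaryManifold N n ∧ (metric m (mapQ N n ξ)).det ≠ 0}

end CKdV

end

open CKdV

/-! Both sides are the same polynomial system. With `Q = X ^ n + ½ ∑ P_i X ^ (n-i)`, `U = ∑ u_i X ^
i`, `V = Q_x` and `W = ½ V_x + Q U`, a jet becomes a Mumford triple `(Q, V, W)`. Its spectral
polynomial `S = V² / 4 - Q W` equals `𝒥(2Q, 2Q)`, so its coefficients are the `h_k`, and the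
recursion for the `P_k` says that `S` is `X ^ (2n+N)` up to degree `< n + N`. This fixes `W` up to
its `N` lowest coefficients, so triples have `2n + N` free coordinates. Conversely `U` and `½ V_x`
are quotient and remainder of `W` by `Q`, and stationarity `K_{n+1} = 0` reads `W_x = -U V`. Hence
all jet variables on `M_n` are polynomials in the triple. The `r`-th flow becomes `Q' = Q₊ V - Q
V₊`, `V' = 2 (Q₊ P - Q P₊)` with `P = W mod Q`, where `₊` is the quotient by `X ^ (n-r+1)`; `S` is
constant. The proof that these flows induce the cKdV flows is a degree argument (`zero_curvature`),
and the identification of `Q` with the `P_k` is a uniqueness statement for the quadratic equation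
(`bilPoly_unique`).

On the Stäckel side, `Q` is the Viète polynomial and `p` is a linear functional on polynomials
modulo `Q`, represented through the residue pairing by a polynomial `Π` (`momentPoly`) with `Π(λ_k)
= -μ_k`. Then `R` is multiplication by `X` modulo `Q`, `A_k` is `f ↦ Q₊ f - Q f₊`, `G_m p` is `2 X ^
m Π` and `𝒱^(e)` is `-X ^ e`. All Hamiltonians together are given by the congruence `X ^ (2m) Π² ≡ X
^ m σ + X ^ m H` modulo `Q` (`dvd_hamPoly`), whose values at the roots of `Q` give the separation
curve. Put `V = G_m p` and `S = X ^ m σ + X ^ m H`; then `Q` divides `V² / 4 - S`, which gives `W`.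
Differentiating these identities along Hamilton's equations yields the Mumford flow
(`hasPolyLineDeriv_flow_Q`, `hasPolyLineDeriv_flow_V`, `hasPolyLineDeriv_flow_W`).

Where `G_m` is invertible, `X ^ m` is invertible modulo `Q`. Therefore the coefficients `c` of `S`,
together with `Q` and `V`, determine the remaining coefficients `H` (`valHom_spectral`), which makes
the two descriptions of a triple equivalent for every `m`. -/

noncomputable section

namespace CKdV

open Polynomial

/-! ### Polynomials of bounded degree and truncated division by powers of `X`. -/

section Poly

variable {A : Type*} [CommRing A]

theorem mem_degreeLT_iff_coeff {n : ℕ} {f : A[X]} :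
    f ∈ degreeLT A n ↔ ∀ k, n ≤ k → f.coeff k = 0 := by
  rw [mem_degreeLT, degree_lt_iff_coeff_zero]

theorem mem_degreeLT_mono {m n : ℕ} {f : A[X]} (hf : f ∈ degreeLT A m) (h : m ≤ n) :
    f ∈ degreeLT A n := degreeLT_mono h hf

/-- The bound has slack one because degrees at most `a - 1` and `b - 1` add up to at most `a + b -
2`. -/
theorem mul_mem_degreeLT {a b c : ℕ} {f g : A[X]} (hf : f ∈ degreeLT A a)
    (hg : g ∈ degreeLT A b) (h : a + b ≤ c + 1) : f * g ∈ degreeLT A c := by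
  rw [mem_degreeLT_iff_coeff] at *
  intro k hk
  rw [coeff_mul]
  refine Finset.sum_eq_zero fun x hx => ?_
  rw [Finset.HasAntidiagonal.mem_antidiagonal] at hx
  by_cases hxa : a ≤ x.1
  · rw [hf _ hxa, zero_mul]
  · rw [hg _ (by omega), mul_zero]

theorem X_pow_mem_degreeLT {k n : ℕ} (h : k < n) : (X ^ k : A[X]) ∈ degreeLT A n := by
  rw [mem_degreeLT_iff_coeff]
  intro j hj
  rw [coeff_X_pow, if_neg (by omega)]

theorem C_mul_mem_degreeLT {n : ℕ} (a : A) {f : A[X]} (hf : f ∈ degreeLT A n) :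
    C a * f ∈ degreeLT A n := by
  rw [← smul_eq_C_mul]
  exact Submodule.smul_mem _ _ hf

theorem mem_degreeLT_of_sub {n : ℕ} {Q : A[X]} (hQ : Q - X ^ n ∈ degreeLT A n) :
    Q ∈ degreeLT A (n + 1) := by
  have := add_mem (mem_degreeLT_mono hQ n.le_succ) (X_pow_mem_degreeLT (A := A) n.lt_succ_self)
  simpa using this

theorem monic_of_sub_mem {n : ℕ} {Q : A[X]} (hQ : Q - X ^ n ∈ degreeLT A n) : Q.Monic := by
  have := monic_X_pow_add (n := n) (p := Q - X ^ n) (mem_degreeLT.1 hQ)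
  simpa using this

theorem coeff_of_sub_mem {n : ℕ} {Q : A[X]} (hQ : Q - X ^ n ∈ degreeLT A n) : Q.coeff n = 1 := by
  have := mem_degreeLT_iff_coeff.1 hQ n le_rfl
  rw [coeff_sub, coeff_X_pow, if_pos rfl] at this
  exact sub_eq_zero.1 this

theorem degree_of_sub_mem [Nontrivial A] {n : ℕ} {Q : A[X]} (hQ : Q - X ^ n ∈ degreeLT A n) :
    Q.degree = n := by
  have := degree_add_eq_left_of_degree_lt (p := X ^ n) (q := Q - X ^ n)
    (by rw [degree_X_pow]; exact mem_degreeLT.1 hQ)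
  simpa using this

theorem mem_degreeLT_of_mul_mem {n d : ℕ} {Q f : A[X]} (hQ : Q - X ^ n ∈ degreeLT A n)
    (h : Q * f ∈ degreeLT A (n + d)) : f ∈ degreeLT A d := by
  nontriviality A
  rw [mem_degreeLT] at h ⊢
  rw [mul_comm, (monic_of_sub_mem hQ).degree_mul, degree_of_sub_mem hQ] at h
  by_cases hf : f = 0
  · rw [hf, degree_zero]
    exact WithBot.bot_lt_coe d
  · rw [degree_eq_natDegree hf] at h ⊢
    norm_cast at h ⊢
    omega

/-- A nonzero multiple of a monic polynomial of degree `n` has degree at least `n`. Most identities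
below are closed in this way: an unknown error term times `Q` turns out to have too small a degree.
-/
theorem eq_zero_of_mul_mem {n : ℕ} {Q f : A[X]} (hQ : Q - X ^ n ∈ degreeLT A n)
    (h : Q * f ∈ degreeLT A n) : f = 0 := by
  have := mem_degreeLT_of_mul_mem (d := 0) hQ h
  ext k
  exact mem_degreeLT_iff_coeff.1 this k (Nat.zero_le k)

theorem eq_zero_of_dvd_of_mem {n : ℕ} {Q f : A[X]} (hQ : Q - X ^ n ∈ degreeLT A n)
    (hf : f ∈ degreeLT A n) (h : Q ∣ f) : f = 0 := by
  obtain ⟨g, rfl⟩ := h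
  rw [eq_zero_of_mul_mem hQ hf, mul_zero]

theorem modByMonic_mem {n : ℕ} {Q : A[X]} (hQ : Q - X ^ n ∈ degreeLT A n) (f : A[X]) :
    f %ₘ Q ∈ degreeLT A n := by
  nontriviality A
  rw [mem_degreeLT, ← degree_of_sub_mem hQ]
  exact degree_modByMonic_lt _ (monic_of_sub_mem hQ)

theorem divByMonic_eq_of {n : ℕ} {Q f g r : A[X]} (hQ : Q - X ^ n ∈ degreeLT A n)
    (hr : r ∈ degreeLT A n) (h : f = r + Q * g) : f /ₘ Q = g ∧ f %ₘ Q = r := by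
  nontriviality A
  refine div_modByMonic_unique g r (monic_of_sub_mem hQ) ⟨h.symm, ?_⟩
  rw [degree_of_sub_mem hQ]
  exact mem_degreeLT.1 hr

theorem sub_mem_map {B : Type*} [CommRing B] (φ : A →+* B) {n : ℕ} {f : A[X]}
    (hf : f ∈ degreeLT A n) : f.map φ ∈ degreeLT B n := by
  rw [mem_degreeLT_iff_coeff] at *
  intro k hk
  rw [coeff_map, hf k hk, map_zero]

/-- Division by `X ^ k`, discarding the remainder. -/
def shiftDown (k : ℕ) (f : A[X]) : A[X] := divX^[k] f

theorem coeff_shiftDown (k : ℕ) (f : A[X]) (j : ℕ) :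
    (shiftDown k f).coeff j = f.coeff (j + k) := by
  unfold shiftDown
  induction k generalizing j with
  | zero => rfl
  | succ k ih => rw [Function.iterate_succ_apply', coeff_divX, ih]; congr 1; omega

theorem shiftDown_map {B : Type*} [CommRing B] (φ : A →+* B) (k : ℕ) (f : A[X]) :
    (shiftDown k f).map φ = shiftDown k (f.map φ) := by
  ext j
  simp [coeff_shiftDown]

theorem shiftDown_add (k : ℕ) (f g : A[X]) :
    shiftDown k (f + g) = shiftDown k f + shiftDown k g := by
  ext j
  simp [coeff_shiftDown]

theorem shiftDown_sum {ι : Type*} (s : Finset ι) (k : ℕ) (f : ι → A[X]) :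
    shiftDown k (∑ i ∈ s, f i) = ∑ i ∈ s, shiftDown k (f i) := by
  ext j
  simp [coeff_shiftDown]

theorem shiftDown_C_mul (k : ℕ) (a : A) (f : A[X]) :
    shiftDown k (C a * f) = C a * shiftDown k f := by
  ext j
  simp [coeff_shiftDown]

theorem shiftDown_mem {k n : ℕ} {f : A[X]} (hf : f ∈ degreeLT A (n + k)) :
    shiftDown k f ∈ degreeLT A n := by
  rw [mem_degreeLT_iff_coeff] at *
  intro j hj
  rw [coeff_shiftDown, hf _ (by omega)]

theorem shiftDown_eq_zero {k : ℕ} {f : A[X]} (hf : f ∈ degreeLT A k) : shiftDown k f = 0 := by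
  ext j
  rw [coeff_shiftDown, mem_degreeLT_iff_coeff.1 hf _ (by omega), coeff_zero]

theorem sub_X_pow_mul_shiftDown_mem (k : ℕ) (f : A[X]) :
    f - X ^ k * shiftDown k f ∈ degreeLT A k := by
  rw [mem_degreeLT_iff_coeff]
  intro j hj
  obtain ⟨i, rfl⟩ := Nat.exists_eq_add_of_le hj
  rw [coeff_sub, add_comm k i, coeff_X_pow_mul, coeff_shiftDown, sub_self]

theorem shiftDown_self {n : ℕ} {Q : A[X]} (hQ : Q - X ^ n ∈ degreeLT A n) :
    shiftDown n Q = 1 := by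
  ext j
  rw [coeff_shiftDown]
  have := mem_degreeLT_iff_coeff.1 hQ (j + n) (by omega)
  rw [coeff_sub, coeff_X_pow, sub_eq_zero] at this
  rw [this, coeff_one]
  congr 1
  simp

/-- The Wronskian-like combination `f₊ g - f g₊` with `f₊ = shiftDown k f`. -/
def shiftWr (k : ℕ) (f g : A[X]) : A[X] := shiftDown k f * g - f * shiftDown k g

/-- The products of the two high parts cancel, so every remaining term pairs a high part with a low
part of degree `< k`; the degree bounds follow from this. -/
theorem shiftWr_eq (k : ℕ) (f g : A[X]) :
    shiftWr k f g = shiftDown k f * (g - X ^ k * shiftDown k g)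
      - (f - X ^ k * shiftDown k f) * shiftDown k g := by
  unfold shiftWr
  ring

theorem shiftWr_mem {k n : ℕ} (hk : k ≤ n) {f g : A[X]} (hf : f ∈ degreeLT A (n + 1))
    (hg : g ∈ degreeLT A n) : shiftWr k f g ∈ degreeLT A n := by
  rw [shiftWr_eq]
  refine sub_mem (mul_mem_degreeLT (a := n + 1 - k) (b := k) (shiftDown_mem ?_)
    (sub_X_pow_mul_shiftDown_mem _ _) (by omega)) (mul_mem_degreeLT (a := k) (b := n - k)
    (sub_X_pow_mul_shiftDown_mem _ _) (shiftDown_mem ?_) (by omega))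
  · exact mem_degreeLT_mono hf (by omega)
  · exact mem_degreeLT_mono hg (by omega)

/-- The gain of one degree over `shiftWr_mem` is what makes `shiftDown k` self-adjoint for the
residue pairing. -/
theorem shiftWr_mem_of_mem {k n : ℕ} (hk : k ≤ n) (hn : 1 ≤ n) {f g : A[X]}
    (hf : f ∈ degreeLT A n)
    (hg : g ∈ degreeLT A n) : shiftWr k f g ∈ degreeLT A (n - 1) := by
  rw [shiftWr_eq]
  refine sub_mem (mul_mem_degreeLT (a := n - k) (b := k) (shiftDown_mem ?_)
    (sub_X_pow_mul_shiftDown_mem _ _) (by omega)) (mul_mem_degreeLT (a := k) (b := n - k)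
    (sub_X_pow_mul_shiftDown_mem _ _) (shiftDown_mem ?_) (by omega))
  · exact mem_degreeLT_mono hf (by omega)
  · exact mem_degreeLT_mono hg (by omega)

/-- Only the leading term of `Q` reaches degree `n - 1`: the rest of `Q` contributes lower degrees
by `shiftWr_mem_of_mem`. -/
theorem coeff_shiftWr {k n : ℕ} (hk : k < n) {Q g : A[X]} (hQ : Q - X ^ n ∈ degreeLT A n)
    (hg : g ∈ degreeLT A n) : (shiftWr (k + 1) Q g).coeff (n - 1) = g.coeff k := by
  have h1 : shiftWr (k + 1) Q g = shiftWr (k + 1) (Q - X ^ n) g + shiftWr (k + 1) (X ^ n) g := by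
    have : shiftDown (k + 1) Q = shiftDown (k + 1) (Q - X ^ n) + shiftDown (k + 1) (X ^ n) := by
      rw [← shiftDown_add, sub_add_cancel]
    unfold shiftWr
    rw [this]
    ring
  have h2 : shiftDown (k + 1) (X ^ n : A[X]) = X ^ (n - 1 - k) := by
    ext j
    rw [coeff_shiftDown, coeff_X_pow, coeff_X_pow]
    congr 1
    simp only [eq_iff_iff]
    omega
  have h3 : shiftWr (k + 1) (X ^ n) g =
      X ^ (n - 1 - k) * (g - X ^ (k + 1) * shiftDown (k + 1) g) := by
    have : (X ^ n : A[X]) = X ^ (n - 1 - k) * X ^ (k + 1) := by rw [← pow_add]; congr 1; omega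
    rw [shiftWr, h2, this]
    ring
  rw [h1, coeff_add, mem_degreeLT_iff_coeff.1 (shiftWr_mem_of_mem hk (by omega) hQ hg) _ le_rfl,
    zero_add, h3, show n - 1 = k + (n - 1 - k) by omega, coeff_X_pow_mul']
  rw [if_pos (by omega), show k + (n - 1 - k) - (k + (n - 1 - k) - k) = k by omega, coeff_sub,
    coeff_X_pow_mul', if_neg (by omega), sub_zero]

end Poly

/-! ### Derivations acting on coefficients. -/

section Deriv

variable {R A : Type*} [CommRing R] [CommRing A] [Algebra R A]

/-- A derivation acting on the coefficients of polynomials. -/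
def coeffDer (D : Derivation R A A) : Derivation R A[X] A[X] :=
  PolynomialModule.equivPolynomialSelf.compDer D.mapCoeffs

theorem coeff_coeffDer (D : Derivation R A A) (f : A[X]) (k : ℕ) :
    (coeffDer D f).coeff k = D (f.coeff k) := rfl

theorem coeffDer_X_pow (D : Derivation R A A) (k : ℕ) : coeffDer D (X ^ k) = 0 := by
  ext j
  rw [coeff_coeffDer, coeff_X_pow]
  split_ifs <;> simp

theorem coeffDer_C (D : Derivation R A A) (a : A) : coeffDer D (C a) = C (D a) := by
  ext j
  rw [coeff_coeffDer, coeff_C, coeff_C]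
  split_ifs <;> simp

theorem coeffDer_mem (D : Derivation R A A) {n : ℕ} {f : A[X]} (hf : f ∈ degreeLT A n) :
    coeffDer D f ∈ degreeLT A n := by
  rw [mem_degreeLT_iff_coeff] at *
  intro k hk
  rw [coeff_coeffDer, hf k hk, map_zero]

theorem coeffDer_shiftDown (D : Derivation R A A) (k : ℕ) (f : A[X]) :
    coeffDer D (shiftDown k f) = shiftDown k (coeffDer D f) := by
  ext j
  simp [coeff_coeffDer, coeff_shiftDown]

theorem coeffDer_sub_X_pow (D : Derivation R A A) {n : ℕ} {f : A[X]}
    (hf : f - X ^ n ∈ degreeLT A n) : coeffDer D f ∈ degreeLT A n := by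
  have := coeffDer_mem D hf
  rwa [map_sub, coeffDer_X_pow, sub_zero] at this

theorem coeffDer_map {B : Type*} [CommRing B] [Algebra R B] {D : Derivation R A A}
    {E : Derivation R B B} {φ : A →ₐ[R] B} (h : ∀ a, φ (D a) = E (φ a)) (f : A[X]) :
    (coeffDer D f).map (φ : A →+* B) = coeffDer E (f.map (φ : A →+* B)) := by
  ext k
  simp [coeff_coeffDer, h]

end Deriv

/-! ### Vectors as polynomials, and Viète polynomials. -/

section VecPoly

variable {A : Type*} [CommRing A] {n : ℕ}

/-- The polynomial of degree `< n` with coefficients `v`, highest power first. -/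
def vecPoly (v : Fin n → A) : A[X] := ∑ i : Fin n, C (v i) * X ^ (n - 1 - (i : ℕ))

theorem coeff_vecPoly (v : Fin n → A) (i : Fin n) : (vecPoly v).coeff (n - 1 - i) = v i := by
  rw [vecPoly, finsetSum_coeff, Finset.sum_eq_single i]
  · simp
  · intro j _ hj
    rw [coeff_C_mul, coeff_X_pow, if_neg, mul_zero]
    intro h
    apply hj
    ext
    omega
  · simp

theorem vecPoly_mem (v : Fin n → A) : vecPoly v ∈ degreeLT A n :=
  sum_mem fun i _ => C_mul_mem_degreeLT _ (X_pow_mem_degreeLT (by omega))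

theorem ext_of_mem {f g : A[X]} (hf : f ∈ degreeLT A n) (hg : g ∈ degreeLT A n)
    (h : ∀ i : Fin n, f.coeff (n - 1 - i) = g.coeff (n - 1 - i)) : f = g := by
  ext k
  by_cases hk : n ≤ k
  · rw [mem_degreeLT_iff_coeff.1 hf k hk, mem_degreeLT_iff_coeff.1 hg k hk]
  · have := h ⟨n - 1 - k, by omega⟩
    simp only at this
    rwa [show n - 1 - (n - 1 - k) = k by omega] at this

theorem vecPoly_coeff {f : A[X]} (hf : f ∈ degreeLT A n) :
    vecPoly (fun i : Fin n => f.coeff (n - 1 - i)) = f :=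
  ext_of_mem (vecPoly_mem _) hf fun i => coeff_vecPoly _ i

theorem vecPoly_map {B : Type*} [CommRing B] (φ : A →+* B) (v : Fin n → A) :
    (vecPoly v).map φ = vecPoly fun i => φ (v i) := by
  simp [vecPoly, Polynomial.map_sum]

/-- The Viète polynomial `X ^ n + q₁ X ^ (n-1) + … + qₙ`. -/
def vietePoly (q : Fin n → A) : A[X] := X ^ n + vecPoly q

theorem vietePoly_sub_mem (q : Fin n → A) : vietePoly q - X ^ n ∈ degreeLT A n := by
  rw [vietePoly, add_sub_cancel_left]
  exact vecPoly_mem q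

theorem vietePoly_map {B : Type*} [CommRing B] (φ : A →+* B) (v : Fin n → A) :
    (vietePoly v).map φ = vietePoly fun i => φ (v i) := by
  simp [vietePoly, vecPoly_map]

theorem vietePoly_monic (q : Fin n → A) : (vietePoly q).Monic :=
  monic_of_sub_mem (vietePoly_sub_mem q)

end VecPoly

end CKdV

end

noncomputable section

namespace CKdV

open Polynomial

/-! ### Mumford triples over a real algebra and their evolution. -/

section Quarter

variable {A : Type*} [CommRing A] [Algebra ℝ A]

/-- The constant polynomial `1 / 4`. -/
def quarter : A[X] := C (algebraMap ℝ A (1 / 4))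

theorem four_mul_quarter : 4 * (quarter : A[X]) = 1 := by
  have : (4 : A[X]) = C (algebraMap ℝ A 4) := by rw [map_ofNat, map_ofNat]
  rw [this, quarter, ← C_mul, ← map_mul]
  norm_num

theorem quarter_map {B : Type*} [CommRing B] [Algebra ℝ B] (φ : A →ₐ[ℝ] B) :
    (quarter : A[X]).map (φ : A →+* B) = quarter := by
  simp only [quarter, map_C]
  congr 1
  exact φ.commutes _

theorem coeffDer_quarter (D : Derivation ℝ A A) : coeffDer D quarter = 0 := by
  rw [quarter, coeffDer_C, Derivation.map_algebraMap, C_0]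

theorem quarter_mul_mem {n : ℕ} {f : A[X]} (hf : f ∈ degreeLT A n) :
    quarter * f ∈ degreeLT A n := C_mul_mem_degreeLT _ hf

theorem eq_zero_of_two_mul {f : A[X]} (h : 2 * f = 0) : f = 0 := by
  linear_combination (-f) * four_mul_quarter (A := A) + 2 * quarter * h

end Quarter

section LowPoly

variable {A : Type*} [CommRing A] {N : ℕ}

/-- The polynomial of degree `< N` with coefficients `w`, lowest power first. -/
def lowPoly (w : Fin N → A) : A[X] := ∑ j : Fin N, C (w j) * X ^ (j : ℕ)

theorem coeff_lowPoly (w : Fin N → A) (j : Fin N) : (lowPoly w).coeff j = w j := by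
  rw [lowPoly, finsetSum_coeff, Finset.sum_eq_single j]
  · simp
  · intro i _ hi
    rw [coeff_C_mul, coeff_X_pow, if_neg, mul_zero]
    intro h
    exact hi (Fin.ext h.symm)
  · simp

theorem lowPoly_mem (w : Fin N → A) : lowPoly w ∈ degreeLT A N :=
  sum_mem fun i _ => C_mul_mem_degreeLT _ (X_pow_mem_degreeLT i.isLt)

theorem lowPoly_map {B : Type*} [CommRing B] (φ : A →+* B) (w : Fin N → A) :
    (lowPoly w).map φ = lowPoly fun i => φ (w i) := by
  simp [lowPoly, Polynomial.map_sum]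

end LowPoly

section Division

variable {A : Type*} [CommRing A] {n N : ℕ} {Q W : A[X]}

theorem div_add_mem (hQ : Q - X ^ n ∈ degreeLT A n) (hW : W + X ^ (n + N) ∈ degreeLT A (n + N)) :
    W /ₘ Q + X ^ N ∈ degreeLT A N := by
  refine mem_degreeLT_of_mul_mem hQ ?_
  have h := modByMonic_add_div W Q
  have h1 : Q * (W /ₘ Q + X ^ N) = (Q - X ^ n) * X ^ N + (W + X ^ (n + N)) - W %ₘ Q := by
    linear_combination h
  rw [h1]
  refine sub_mem (add_mem ?_ hW) (mem_degreeLT_mono (modByMonic_mem hQ _) (by omega))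
  exact mul_mem_degreeLT hQ (X_pow_mem_degreeLT (A := A) N.lt_succ_self) (by omega)

/-- The evolution of the third entry of a Mumford triple. -/
def flowW (k : ℕ) (Q V W : A[X]) : A[X] :=
  W * shiftDown k V - W /ₘ Q * shiftDown k Q * V - V * shiftDown k (W %ₘ Q)

/-- Although `flowW` contains a quotient and a remainder, `Q` times it is exactly what the product
rule for `V² / 4 - Q W` needs in order that the spectral polynomial be conserved. -/
theorem mul_flowW (k : ℕ) (Q V W : A[X]) :
    Q * flowW k Q V W = V * shiftWr k Q (W %ₘ Q) - W * shiftWr k Q V := by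
  have h := modByMonic_add_div W Q
  rw [flowW, shiftWr, shiftWr]
  linear_combination (-shiftDown k Q * V) * h

end Division

section Mumford

variable {A : Type*} [CommRing A] [Algebra ℝ A] (n N : ℕ)

/-- The spectral polynomial `V² / 4 - Q W`. -/
def spectral (Q V W : A[X]) : A[X] := quarter * V ^ 2 - Q * W

/-- The third entry of the Mumford triple: it is determined by `Q`, `V` and its coefficients `L`
below `X ^ N`, because `V² / 4 - Q W` is `X ^ (2n+N)` up to terms of degree `< n + N`. -/
def tripleW (Q V L : A[X]) : A[X] :=
  X ^ N * ((quarter * V ^ 2 - X ^ (2 * n + N)) /ₘ (X ^ N * Q)) + L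

variable {n N} {Q V L W W' : A[X]}

/-- What remains of `S - X ^ (2n+N)` is the remainder of a division by `X ^ N Q`, of degree `n + N`,
minus `Q L`; both have degree `< n + N`. -/
theorem tripleW_spec (hQ : Q - X ^ n ∈ degreeLT A n) (hL : L ∈ degreeLT A N) :
    spectral Q V (tripleW n N Q V L) - X ^ (2 * n + N) ∈ degreeLT A (n + N) := by
  have hXQ : X ^ N * Q - X ^ (n + N) ∈ degreeLT A (n + N) := by
    rw [pow_add, mul_comm (X ^ n : A[X]), ← mul_sub]
    exact mul_mem_degreeLT (X_pow_mem_degreeLT (A := A) N.lt_succ_self) hQ (by omega)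
  have h := modByMonic_add_div (quarter * V ^ 2 - X ^ (2 * n + N)) (X ^ N * Q)
  have h2 := modByMonic_mem hXQ (quarter * V ^ 2 - X ^ (2 * n + N))
  have h3 : spectral Q V (tripleW n N Q V L) - X ^ (2 * n + N)
      = (quarter * V ^ 2 - X ^ (2 * n + N)) %ₘ (X ^ N * Q) - Q * L := by
    rw [spectral, tripleW]
    linear_combination -h
  rw [h3]
  exact sub_mem h2 (mul_mem_degreeLT (mem_degreeLT_of_sub hQ) hL (by omega))

theorem coeff_tripleW {j : ℕ} (hj : j < N) : (tripleW n N Q V L).coeff j = L.coeff j := by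
  rw [tripleW, coeff_add, coeff_X_pow_mul', if_neg (by omega), zero_add]

/-- Subtracting the two conditions bounds the degree of `Q (W' - W)` by that of `S`, so `W' - W` has
degree `< N` and is decided by its low coefficients. -/
theorem triple_unique (hQ : Q - X ^ n ∈ degreeLT A n)
    (h : spectral Q V W - X ^ (2 * n + N) ∈ degreeLT A (n + N))
    (h' : spectral Q V W' - X ^ (2 * n + N) ∈ degreeLT A (n + N))
    (hc : ∀ j < N, W.coeff j = W'.coeff j) : W = W' := by
  have h1 : Q * (W' - W) ∈ degreeLT A (n + N) := by
    have := sub_mem h h'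
    unfold spectral at this
    convert this using 1
    ring
  have h2 := mem_degreeLT_iff_coeff.1 (mem_degreeLT_of_mul_mem hQ h1)
  ext j
  by_cases hj : j < N
  · exact hc j hj
  · have := h2 j (by omega)
    rw [coeff_sub, sub_eq_zero] at this
    exact this.symm

theorem eq_tripleW (hQ : Q - X ^ n ∈ degreeLT A n) (hL : L ∈ degreeLT A N)
    (h : spectral Q V W - X ^ (2 * n + N) ∈ degreeLT A (n + N))
    (hc : ∀ j < N, W.coeff j = L.coeff j) : W = tripleW n N Q V L :=
  triple_unique hQ h (tripleW_spec hQ hL) fun j hj => by rw [hc j hj, coeff_tripleW hj]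

/-- `V²` has degree at most `2n - 2`, so the leading term of `S` can only come from `-Q W`. -/
theorem triple_add_mem (hQ : Q - X ^ n ∈ degreeLT A n) (hV : V ∈ degreeLT A n)
    (h : spectral Q V W - X ^ (2 * n + N) ∈ degreeLT A (n + N)) :
    W + X ^ (n + N) ∈ degreeLT A (n + N) := by
  refine mem_degreeLT_of_mul_mem hQ ?_
  have h1 : Q * (W + X ^ (n + N)) = (Q - X ^ n) * X ^ (n + N) + quarter * (V * V)
      - (spectral Q V W - X ^ (2 * n + N)) := by
    rw [spectral]
    ring
  rw [h1]
  refine sub_mem (add_mem ?_ ?_) (mem_degreeLT_mono h (by omega))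
  · exact mul_mem_degreeLT hQ (X_pow_mem_degreeLT (A := A) (n + N).lt_succ_self) (by omega)
  · exact quarter_mul_mem (mul_mem_degreeLT hV hV (by omega))

theorem tripleW_map {B : Type*} [CommRing B] [Algebra ℝ B] (φ : A →ₐ[ℝ] B)
    (hQ : Q - X ^ n ∈ degreeLT A n) :
    (tripleW n N Q V L).map (φ : A →+* B) = tripleW n N (Q.map (φ : A →+* B))
      (V.map (φ : A →+* B)) (L.map (φ : A →+* B)) := by
  have hm : (X ^ N * Q).Monic := (monic_X_pow N).mul (monic_of_sub_mem hQ)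
  rw [tripleW, tripleW, Polynomial.map_add, Polynomial.map_mul, map_divByMonic _ hm]
  simp [quarter_map]

variable {D E : Derivation ℝ A A} {k : ℕ}

theorem coeffDer_spectral (hV : coeffDer D V = 2 * shiftWr k Q (W %ₘ Q))
    (hQ : coeffDer D Q = shiftWr k Q V) :
    coeffDer D (spectral Q V W) = Q * (flowW k Q V W - coeffDer D W) := by
  rw [mul_sub, mul_flowW, spectral, map_sub, Derivation.leibniz, Derivation.leibniz, pow_two,
    Derivation.leibniz, hQ, hV, coeffDer_quarter]
  simp only [smul_eq_mul]
  linear_combination (V * shiftWr k Q (W %ₘ Q)) * four_mul_quarter (A := A)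

/-- A derivation keeps the degree bound on `S - X ^ (2n+N)`, so the error in the evolution of `W`
has degree `< N`. Hence the flow may be prescribed on the `N` low coefficients only. -/
theorem coeffDer_tripleW (hQ : Q - X ^ n ∈ degreeLT A n)
    (h : spectral Q V W - X ^ (2 * n + N) ∈ degreeLT A (n + N))
    (hDV : coeffDer D V = 2 * shiftWr k Q (W %ₘ Q)) (hDQ : coeffDer D Q = shiftWr k Q V)
    (hDW : ∀ j < N, (coeffDer D W).coeff j = (flowW k Q V W).coeff j) :
    coeffDer D W = flowW k Q V W := by
  have h1 := coeffDer_mem D h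
  rw [map_sub, coeffDer_X_pow, sub_zero, coeffDer_spectral hDV hDQ] at h1
  have h2 := mem_degreeLT_iff_coeff.1 (mem_degreeLT_of_mul_mem hQ h1)
  ext j
  by_cases hj : j < N
  · exact hDW j hj
  · have := h2 j (by omega)
    rw [coeff_sub, sub_eq_zero] at this
    exact this.symm

/-- The Lenard operator `J` applied to `2 Q₊` for a Mumford triple. -/
def lenard (D : Derivation ℝ A A) (k : ℕ) (Q V W : A[X]) : A[X] :=
  coeffDer D (shiftDown k (W %ₘ Q)) + 2 * (W /ₘ Q) * shiftDown k V
    + coeffDer D (W /ₘ Q) * shiftDown k Q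

/-- Differentiating `W = P + Q U` along both flows gives `Q (E U - lenard) = D (Q₊ P - Q P₊) - E P`.
The right side has degree `< n`, so both sides vanish. The first conclusion is the hierarchy's
equation for the potential; the second serves for the commutation of the flows. -/
theorem zero_curvature (hQ : Q - X ^ n ∈ degreeLT A n) (hk : k ≤ n)
    (hDQ : coeffDer D Q = V)
    (hDW : coeffDer D W = -(W /ₘ Q * V))
    (hEQ : coeffDer E Q = shiftWr k Q V) (hEW : coeffDer E W = flowW k Q V W) :
    coeffDer E (W /ₘ Q) = lenard D k Q V W ∧
      coeffDer E (W %ₘ Q) = coeffDer D (shiftWr k Q (W %ₘ Q)) := by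
  have hr := modByMonic_mem hQ W
  have h := modByMonic_add_div W Q
  generalize W %ₘ Q = P at *
  generalize hU : W /ₘ Q = U at *
  have hDP : coeffDer D P = -2 * U * V - coeffDer D U * Q := by
    have : coeffDer D W = coeffDer D P + (Q • coeffDer D U + U • coeffDer D Q) := by
      rw [← h, map_add, Derivation.leibniz]
    rw [hDW, hDQ] at this
    simp only [smul_eq_mul] at this
    linear_combination -this
  have hEP : coeffDer E P = flowW k Q V W - Q * coeffDer E U - U * shiftWr k Q V := by
    have : coeffDer E W = coeffDer E P + (Q • coeffDer E U + U • coeffDer E Q) := by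
      rw [← h, map_add, Derivation.leibniz]
    rw [hEW, hEQ] at this
    simp only [smul_eq_mul] at this
    linear_combination -this
  have hDsP : coeffDer D (shiftWr k Q P) = shiftDown k V * P + shiftDown k Q * coeffDer D P
      - V * shiftDown k P - Q * coeffDer D (shiftDown k P) := by
    rw [shiftWr, map_sub, Derivation.leibniz, Derivation.leibniz, coeffDer_shiftDown, hDQ]
    simp only [smul_eq_mul]
    ring
  have hPW : W %ₘ Q = P := by
    have := modByMonic_add_div W Q
    rw [hU] at this
    linear_combination this - h
  have key : Q * (coeffDer E U - lenard D k Q V W)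
      = coeffDer D (shiftWr k Q P) - coeffDer E P := by
    rw [hEP, hDsP, hDP, lenard, flowW, hU, hPW, shiftWr]
    linear_combination (-shiftDown k V) * h
  have hmem : coeffDer D (shiftWr k Q P) - coeffDer E P ∈ degreeLT A n :=
    sub_mem (coeffDer_mem _ (shiftWr_mem hk (mem_degreeLT_of_sub hQ) hr)) (coeffDer_mem _ hr)
  rw [← key] at hmem
  have h0 := eq_zero_of_mul_mem hQ hmem
  rw [h0, mul_zero] at key
  exact ⟨sub_eq_zero.1 h0, (sub_eq_zero.1 key.symm).symm⟩

/-- This is the derivative of `W = W %ₘ Q + Q (W /ₘ Q)`, since for `k = 0` nothing is truncated. It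
is the source of the stationarity equation. -/
theorem lenard_zero (hDQ : coeffDer D Q = V) (hDW : coeffDer D W = -(W /ₘ Q * V)) :
    lenard D 0 Q V W = 0 := by
  have h := congrArg (coeffDer D) (modByMonic_add_div W Q)
  rw [map_add, Derivation.leibniz, hDQ, hDW] at h
  simp only [smul_eq_mul] at h
  simp only [lenard, shiftDown, Function.iterate_zero, id]
  linear_combination h

end Mumford

/-! ### The Mumford system on the generic triple and the commutation of its flows. -/

section MumfordSystem

variable (n N : ℕ)

/-- The coordinate ring of the space of Mumford triples. -/
abbrev TripleRing : Type := MvPolynomial (Fin n ⊕ Fin n ⊕ Fin N) ℝ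

/-- The generic first entry of a Mumford triple. -/
def genQ : (TripleRing n N)[X] := vietePoly fun i => MvPolynomial.X (.inl i)

/-- The generic second entry of a Mumford triple. -/
def genV : (TripleRing n N)[X] := vecPoly fun i => MvPolynomial.X (.inr (.inl i))

/-- The generic third entry of a Mumford triple. -/
def genW : (TripleRing n N)[X] :=
  tripleW n N (genQ n N) (genV n N) (lowPoly fun j => MvPolynomial.X (.inr (.inr j)))

/-- The generic Schrödinger potential. -/
def genU : (TripleRing n N)[X] := genW n N /ₘ genQ n N

/-- The `(n - k)`-th (from `0`) flow on the space of Mumford triples. -/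
def tripleFlow (k : ℕ) : Derivation ℝ (TripleRing n N) (TripleRing n N) :=
  MvPolynomial.mkDerivation ℝ <| Sum.elim
    (fun i => (shiftWr k (genQ n N) (genV n N)).coeff (n - 1 - i)) <| Sum.elim
    (fun i => (2 * shiftWr k (genQ n N) (genW n N %ₘ genQ n N)).coeff (n - 1 - i))
    (fun j => (flowW k (genQ n N) (genV n N) (genW n N)).coeff j)

variable {n N}

theorem genQ_mem : genQ n N - X ^ n ∈ degreeLT _ n := vietePoly_sub_mem _

theorem genV_mem : genV n N ∈ degreeLT _ n := vecPoly_mem _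

theorem genW_spec : spectral (genQ n N) (genV n N) (genW n N) - X ^ (2 * n + N)
    ∈ degreeLT _ (n + N) := tripleW_spec genQ_mem (lowPoly_mem _)

theorem genU_mem : genU n N + X ^ N ∈ degreeLT _ N :=
  div_add_mem genQ_mem (triple_add_mem genQ_mem genV_mem genW_spec)

theorem coeff_genQ (i : Fin n) : (genQ n N).coeff (n - 1 - i) = MvPolynomial.X (.inl i) := by
  rw [genQ, vietePoly, coeff_add, coeff_vecPoly, coeff_X_pow, if_neg (by omega), zero_add]

theorem coeff_genV (i : Fin n) :
    (genV n N).coeff (n - 1 - i) = MvPolynomial.X (.inr (.inl i)) := coeff_vecPoly _ _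

theorem coeff_genW (j : Fin N) : (genW n N).coeff j = MvPolynomial.X (.inr (.inr j)) := by
  rw [genW, coeff_tripleW j.isLt, coeff_lowPoly]

variable {k : ℕ}

theorem tripleFlow_genQ (hk : k ≤ n) :
    coeffDer (tripleFlow n N k) (genQ n N) = shiftWr k (genQ n N) (genV n N) := by
  refine ext_of_mem (coeffDer_sub_X_pow _ genQ_mem)
    (shiftWr_mem hk (mem_degreeLT_of_sub genQ_mem) genV_mem) fun i => ?_
  rw [coeff_coeffDer, coeff_genQ, tripleFlow, MvPolynomial.mkDerivation_X]
  rfl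

theorem tripleFlow_genV (hk : k ≤ n) : coeffDer (tripleFlow n N k) (genV n N)
    = 2 * shiftWr k (genQ n N) (genW n N %ₘ genQ n N) := by
  refine ext_of_mem (coeffDer_mem _ genV_mem) ?_ fun i => ?_
  · have := shiftWr_mem hk (mem_degreeLT_of_sub genQ_mem) (modByMonic_mem genQ_mem (genW n N))
    rw [two_mul]
    exact add_mem this this
  · rw [coeff_coeffDer, coeff_genV, tripleFlow, MvPolynomial.mkDerivation_X]
    rfl

theorem tripleFlow_genW (hk : k ≤ n) : coeffDer (tripleFlow n N k) (genW n N)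
    = flowW k (genQ n N) (genV n N) (genW n N) := by
  refine coeffDer_tripleW genQ_mem genW_spec (tripleFlow_genV hk) (tripleFlow_genQ hk) ?_
  intro j hj
  have := coeff_genW (n := n) (N := N) ⟨j, hj⟩
  simp only at this
  rw [coeff_coeffDer, this, tripleFlow, MvPolynomial.mkDerivation_X]
  rfl

theorem tripleFlow_spectral (hk : k ≤ n) :
    coeffDer (tripleFlow n N k) (spectral (genQ n N) (genV n N) (genW n N)) = 0 := by
  rw [coeffDer_spectral (tripleFlow_genV hk) (tripleFlow_genQ hk), tripleFlow_genW hk, sub_self,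
    mul_zero]

theorem shiftWr_self {A : Type*} [CommRing A] {Q f : A[X]} (hQ : Q - X ^ n ∈ degreeLT A n)
    (hf : f ∈ degreeLT A n) : shiftWr n Q f = f := by
  rw [shiftWr, shiftDown_self hQ, shiftDown_eq_zero hf]
  ring

variable (n N) in
/-- The flow of the Mumford system that corresponds to the translation in `x`. -/
def tripleDx : Derivation ℝ (TripleRing n N) (TripleRing n N) := tripleFlow n N n

theorem tripleDx_genQ : coeffDer (tripleDx n N) (genQ n N) = genV n N := by
  rw [tripleDx, tripleFlow_genQ le_rfl, shiftWr_self genQ_mem genV_mem]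

theorem tripleDx_genV : coeffDer (tripleDx n N) (genV n N) = 2 * (genW n N %ₘ genQ n N) := by
  rw [tripleDx, tripleFlow_genV le_rfl, shiftWr_self genQ_mem (modByMonic_mem genQ_mem _)]

theorem tripleDx_genW : coeffDer (tripleDx n N) (genW n N) = -(genU n N * genV n N) := by
  rw [tripleDx, tripleFlow_genW le_rfl, flowW, shiftDown_self genQ_mem,
    shiftDown_eq_zero genV_mem, shiftDown_eq_zero (modByMonic_mem genQ_mem _), genU]
  ring

theorem tripleFlow_genU (hk : k ≤ n) : coeffDer (tripleFlow n N k) (genU n N)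
    = lenard (tripleDx n N) k (genQ n N) (genV n N) (genW n N) :=
  (zero_curvature genQ_mem hk tripleDx_genQ tripleDx_genW
    (tripleFlow_genQ hk) (tripleFlow_genW hk)).1

theorem lenard_genTriple :
    lenard (tripleDx n N) 0 (genQ n N) (genV n N) (genW n N) = 0 :=
  lenard_zero tripleDx_genQ tripleDx_genW

theorem coeffDer_lie {A : Type*} [CommRing A] [Algebra ℝ A] (D E : Derivation ℝ A A) (f : A[X]) :
    coeffDer ⁅D, E⁆ f = coeffDer D (coeffDer E f) - coeffDer E (coeffDer D f) := by
  ext j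
  simp [coeff_coeffDer, Derivation.commutator_apply]

/-- A derivation of a polynomial ring is zero once it kills the coordinates, that is, the
coefficients of the generic triple. For `Q` this is the product rule, for `V` it is the second half
of `zero_curvature`, and for `W` it follows from conservation of the spectral polynomial. -/
theorem tripleFlow_lie (hk : k ≤ n) : ⁅tripleFlow n N k, tripleDx n N⁆ = 0 := by
  have hQ : coeffDer ⁅tripleFlow n N k, tripleDx n N⁆ (genQ n N) = 0 := by
    rw [coeffDer_lie, tripleDx_genQ, tripleFlow_genQ hk, tripleFlow_genV hk, shiftWr, shiftWr, map_sub,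
      Derivation.leibniz, Derivation.leibniz, coeffDer_shiftDown, coeffDer_shiftDown,
      tripleDx_genQ, tripleDx_genV, two_mul (genW n N %ₘ genQ n N), shiftDown_add]
    simp only [smul_eq_mul]
    ring
  have hV : coeffDer ⁅tripleFlow n N k, tripleDx n N⁆ (genV n N) = 0 := by
    rw [coeffDer_lie, tripleDx_genV, tripleFlow_genV hk, Derivation.leibniz, Derivation.leibniz,
      (zero_curvature genQ_mem hk tripleDx_genQ tripleDx_genW
        (tripleFlow_genQ hk) (tripleFlow_genW hk)).2]
    have h2 : ∀ D : Derivation ℝ (TripleRing n N) (TripleRing n N), coeffDer D 2 = 0 := by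
      intro D
      exact_mod_cast (coeffDer D).map_natCast 2
    rw [h2, h2, smul_zero, smul_zero, sub_self]
  have hS : coeffDer ⁅tripleFlow n N k, tripleDx n N⁆
      (spectral (genQ n N) (genV n N) (genW n N)) = 0 := by
    rw [coeffDer_lie, tripleDx, tripleFlow_spectral le_rfl, tripleFlow_spectral hk, map_zero,
      map_zero, sub_zero]
  -- The commutator kills `Q`, `V` and `V² / 4 - Q W`, so it sends `W` to something annihilated by
  -- the monic `Q`.
  have hW : coeffDer ⁅tripleFlow n N k, tripleDx n N⁆ (genW n N) = 0 := by
    rw [spectral, map_sub, Derivation.leibniz, Derivation.leibniz, pow_two, Derivation.leibniz,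
      hQ, hV, coeffDer_quarter] at hS
    simp only [smul_eq_mul] at hS
    refine eq_zero_of_mul_mem genQ_mem ?_
    convert zero_mem (degreeLT (TripleRing n N) n) using 1
    linear_combination -hS
  refine MvPolynomial.derivation_ext fun a => ?_
  rw [Derivation.zero_apply]
  rcases a with i | i | j
  · rw [← coeff_genQ, ← coeff_coeffDer, hQ, coeff_zero]
  · rw [← coeff_genV, ← coeff_coeffDer, hV, coeff_zero]
  · rw [← coeff_genW, ← coeff_coeffDer, hW, coeff_zero]

theorem tripleFlow_comm (hk : k ≤ n) (f : TripleRing n N) :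
    tripleFlow n N k (tripleDx n N f) = tripleDx n N (tripleFlow n N k f) := by
  have := DFunLike.congr_fun (tripleFlow_lie (N := N) hk) f
  rwa [Derivation.commutator_apply, Derivation.zero_apply, sub_eq_zero] at this

theorem tripleFlow_comm_iterate (hk : k ≤ n) (f : TripleRing n N) (j : ℕ) :
    tripleFlow n N k ((tripleDx n N)^[j] f) = (tripleDx n N)^[j] (tripleFlow n N k f) := by
  induction j with
  | zero => rfl
  | succ j ih =>
    rw [Function.iterate_succ_apply', Function.iterate_succ_apply', tripleFlow_comm hk, ih]

end MumfordSystem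

end CKdV

end

noncomputable section

namespace CKdV

open Polynomial

/-! ### The quadratic equation `𝒥(f, f) = X ^ (2n+N) + …` and its uniqueness. -/

section Bilinear

variable {A : Type*} [CommRing A] [Algebra ℝ A]

/-- The bilinear operator `𝒥(f, g)` for polynomials in the spectral parameter. -/
def bilPoly (D : Derivation ℝ A A) (U f g : A[X]) : A[X] :=
  -(quarter * quarter * (coeffDer D (coeffDer D f) * g + f * coeffDer D (coeffDer D g)
    - coeffDer D f * coeffDer D g)) - quarter * U * f * g

/-- The operator `2 J = D³ / 2 + 2 U D + U'` for polynomials in the spectral parameter. -/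
def lenardOp (D : Derivation ℝ A A) (U f : A[X]) : A[X] :=
  2 * quarter * coeffDer D (coeffDer D (coeffDer D f)) + 2 * U * coeffDer D f + coeffDer D U * f

theorem bilPoly_map {B : Type*} [CommRing B] [Algebra ℝ B] {D : Derivation ℝ A A}
    {E : Derivation ℝ B B} {φ : A →ₐ[ℝ] B} (h : ∀ a, φ (D a) = E (φ a)) (U f g : A[X]) :
    (bilPoly D U f g).map (φ : A →+* B) = bilPoly E (U.map (φ : A →+* B)) (f.map (φ : A →+* B))
      (g.map (φ : A →+* B)) := by
  simp only [bilPoly, Polynomial.map_sub, Polynomial.map_neg, Polynomial.map_mul,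
    Polynomial.map_add, quarter_map, coeffDer_map h]

theorem coeffDer_const_mul (D : Derivation ℝ A A) (k : ℕ) (f : A[X]) :
    coeffDer D (k * f) = k * coeffDer D f := by
  rw [Derivation.leibniz, Derivation.map_natCast]
  simp

theorem coeffDer_two_mul (D : Derivation ℝ A A) (f : A[X]) :
    coeffDer D (2 * f) = 2 * coeffDer D f := coeffDer_const_mul D 2 f

theorem coeffDer_quarter_mul (D : Derivation ℝ A A) (f : A[X]) :
    coeffDer D (quarter * f) = quarter * coeffDer D f := by
  rw [Derivation.leibniz, coeffDer_quarter]
  simp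

theorem bilPoly_add_left (D : Derivation ℝ A A) (U f f' g : A[X]) :
    bilPoly D U (f + f') g = bilPoly D U f g + bilPoly D U f' g := by
  simp only [bilPoly, map_add]
  ring

theorem bilPoly_add_right (D : Derivation ℝ A A) (U f g g' : A[X]) :
    bilPoly D U f (g + g') = bilPoly D U f g + bilPoly D U f g' := by
  simp only [bilPoly, map_add]
  ring

theorem bilPoly_sum {ι : Type*} (D : Derivation ℝ A A) (U : A[X]) (s : Finset ι) (f : ι → A[X])
    (g : A[X]) : bilPoly D U (∑ i ∈ s, f i) g = ∑ i ∈ s, bilPoly D U (f i) g := by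
  classical
  induction s using Finset.induction_on with
  | empty => simp [bilPoly]
  | insert a s ha ih => rw [Finset.sum_insert ha, Finset.sum_insert ha, bilPoly_add_left, ih]

theorem bilPoly_sum_right {ι : Type*} (D : Derivation ℝ A A) (U : A[X]) (s : Finset ι)
    (f : ι → A[X]) (g : A[X]) :
    bilPoly D U g (∑ i ∈ s, f i) = ∑ i ∈ s, bilPoly D U g (f i) := by
  classical
  induction s using Finset.induction_on with
  | empty => simp [bilPoly]
  | insert a s ha ih => rw [Finset.sum_insert ha, Finset.sum_insert ha, bilPoly_add_right, ih]

theorem coeffDer_mul_X_pow (D : Derivation ℝ A A) (f : A[X]) (a : ℕ) :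
    coeffDer D (f * X ^ a) = coeffDer D f * X ^ a := by
  rw [Derivation.leibniz, coeffDer_X_pow]
  simp [mul_comm]

theorem bilPoly_mul_X_pow (D : Derivation ℝ A A) (U f g : A[X]) (a b : ℕ) :
    bilPoly D U (f * X ^ a) (g * X ^ b) = bilPoly D U f g * X ^ (a + b) := by
  simp only [bilPoly, coeffDer_mul_X_pow]
  ring

/-- The bridge between the hierarchy and Mumford triples: `𝒥` on the diagonal is a spectral
polynomial. -/
theorem bilPoly_two_mul {D : Derivation ℝ A A} {U Q V P : A[X]} (hQ : coeffDer D Q = V)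
    (hV : coeffDer D V = 2 * P) :
    bilPoly D U (2 * Q) (2 * Q) = spectral Q V (P + Q * U) := by
  simp only [bilPoly, coeffDer_two_mul, hQ, hV, spectral]
  have h := four_mul_quarter (A := A)
  linear_combination ((quarter * V ^ 2 - P * Q * 4 * quarter) - P * Q - U * Q ^ 2) * h

/-- The term `-¼ U (f² - g²)` in the difference has degree `n + N` plus that of `f - g`, because `-¼
U (f + g)` is monic of degree `n + N`. The terms with derivatives have degree at most `n` plus that
of `f - g`. As `N ≥ 1`, the degree of `f - g` can be lowered again and again. -/
theorem bilPoly_unique {D : Derivation ℝ A A} {n N : ℕ} (hN : 1 ≤ N) {U f g : A[X]}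
    (hU : U + X ^ N ∈ degreeLT A N) (hf : f - 2 * X ^ n ∈ degreeLT A n)
    (hg : g - 2 * X ^ n ∈ degreeLT A n)
    (hff : bilPoly D U f f - X ^ (2 * n + N) ∈ degreeLT A (n + N))
    (hgg : bilPoly D U g g - X ^ (2 * n + N) ∈ degreeLT A (n + N)) : f = g := by
  have hq := four_mul_quarter (A := A)
  have hs : quarter * (f + g) - X ^ n ∈ degreeLT A n := by
    have := quarter_mul_mem (add_mem hf hg)
    convert this using 1
    linear_combination (X ^ n) * hq
  have hM : -U * (quarter * (f + g)) - X ^ (n + N) ∈ degreeLT A (n + N) := by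
    have h1 := mul_mem_degreeLT (c := n + N) hU (mem_degreeLT_of_sub hs) (by omega)
    have h2 := mul_mem_degreeLT (c := n + N) (X_pow_mem_degreeLT (A := A) N.lt_succ_self) hs
      (by omega)
    convert sub_mem h2 h1 using 1
    ring
  have h2X : coeffDer D (2 * X ^ n) = 0 := by rw [coeffDer_two_mul, coeffDer_X_pow, mul_zero]
  have hDf : coeffDer D f ∈ degreeLT A n := by
    have := coeffDer_mem D hf
    rwa [map_sub, h2X, sub_zero] at this
  have hDg : coeffDer D g ∈ degreeLT A n := by
    have := coeffDer_mem D hg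
    rwa [map_sub, h2X, sub_zero] at this
  have hfg : f - g ∈ degreeLT A n := by
    convert sub_mem hf hg using 1
    ring
  have hall : ∀ j, f - g ∈ degreeLT A (n - j) := by
    intro j
    induction j with
    | zero => exact hfg
    | succ j ih =>
      rcases hd : n - j with _ | d
      · rw [hd] at ih
        exact mem_degreeLT_mono ih (by omega)
      · rw [hd] at ih
        have hd' : n - (j + 1) = d := by omega
        rw [hd']
        refine mem_degreeLT_of_mul_mem hM ?_
        have hDe := coeffDer_mem D ih
        have hDDe := coeffDer_mem D hDe
        -- The difference of the two quadratic expressions, polarised so that each derivative term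
        -- contains `f - g` or one of its derivatives.
        have h1 : -U * (quarter * (f + g)) * (f - g)
            = ((bilPoly D U f f - X ^ (2 * n + N)) - (bilPoly D U g g - X ^ (2 * n + N)))
              + quarter * (quarter * (coeffDer D (coeffDer D f + coeffDer D g) * (f - g)
                + 4 * (quarter * (f + g)) * coeffDer D (coeffDer D (f - g))
                - (coeffDer D f + coeffDer D g) * coeffDer D (f - g))) := by
          simp only [bilPoly, map_add, map_sub]
          linear_combination (-quarter * quarter * (f + g)
            * (coeffDer D (coeffDer D f) - coeffDer D (coeffDer D g))) * hq
        rw [h1]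
        refine add_mem (mem_degreeLT_mono (sub_mem hff hgg) (by omega)) (quarter_mul_mem
          (quarter_mul_mem (sub_mem (add_mem ?_ ?_) ?_)))
        · exact mul_mem_degreeLT (coeffDer_mem D (add_mem hDf hDg)) ih (by omega)
        · rw [show (4 : A[X]) * (quarter * (f + g)) = f + g by linear_combination (f + g) * hq]
          -- Here `f + g` has full degree `n`, so this term is the one whose bound needs `1 ≤ N`.
          refine mul_mem_degreeLT (a := n + 1) ?_ hDDe (by omega)
          have h4 := C_mul_mem_degreeLT 4 (mem_degreeLT_of_sub hs)
          convert h4 using 1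
          rw [map_ofNat]
          linear_combination (-(f + g)) * hq
        · exact mul_mem_degreeLT (add_mem hDf hDg) hDe (by omega)
  have := hall n
  rw [Nat.sub_self] at this
  rw [← sub_eq_zero]
  ext k
  exact mem_degreeLT_iff_coeff.1 this k (Nat.zero_le k)

end Bilinear

/-! ### The truncated series of the hierarchy, the functions `h_k` and the vector fields `K_r`. -/

section Hierarchy

variable (N n : ℕ)

/-- The energy dependent potential `∑ u_i X ^ i`. -/
def fieldPoly : (DiffPoly N)[X] := ∑ i ∈ Finset.range (N + 1), C (field N i) * X ^ i

theorem coeff_fieldPoly (i : ℕ) : (fieldPoly N).coeff i = field N i := by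
  rw [fieldPoly, finsetSum_coeff]
  simp only [coeff_C_mul_X_pow]
  rw [Finset.sum_ite_eq]
  split_ifs with h
  · rfl
  · rw [Finset.mem_range] at h
    rw [field, dif_neg (by omega), if_neg (by omega)]

/-- The polynomial `X ^ n + ½ ∑ P_i X ^ (n-i)`. -/
def diffQ : (DiffPoly N)[X] := vietePoly fun i : Fin n => (1 / 2 : ℝ) • coeffP N (i + 1)

theorem diffQ_mem : diffQ N n - X ^ n ∈ degreeLT _ n := vietePoly_sub_mem _

theorem coeff_two_mul_diffQ {a : ℕ} (ha : a ≤ n) :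
    (2 * diffQ N n).coeff (n - a) = coeffP N a := by
  have h2 : (2 : (DiffPoly N)[X]) = C 2 := by rw [map_ofNat]
  rw [h2, coeff_C_mul]
  rcases a with _ | a
  · rw [Nat.sub_zero, coeff_of_sub_mem (diffQ_mem N n), mul_one, coeffP]
  · have := coeff_vecPoly (fun i : Fin n => (1 / 2 : ℝ) • coeffP N (i + 1)) ⟨a, ha⟩
    simp only at this
    rw [diffQ, vietePoly, coeff_add, coeff_X_pow, if_neg (by omega), zero_add,
      show n - (a + 1) = n - 1 - a by omega, this, two_mul, ← add_smul]
    norm_num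

theorem two_mul_diffQ :
    2 * diffQ N n = ∑ a ∈ Finset.range (n + 1), C (coeffP N a) * X ^ (n - a) := by
  ext1 k
  rw [finsetSum_coeff]
  simp only [coeff_C_mul_X_pow]
  by_cases hk : k ≤ n
  · rw [Finset.sum_eq_single (n - k), if_pos (by omega)]
    · have := coeff_two_mul_diffQ N n (a := n - k) (by omega)
      rwa [show n - (n - k) = k by omega] at this
    · intro b hb hne
      rw [Finset.mem_range] at hb
      rw [if_neg (by omega)]
    · intro h
      exact absurd (Finset.mem_range.2 (by omega)) h
  · rw [Finset.sum_eq_zero]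
    · rw [two_mul, coeff_add, mem_degreeLT_iff_coeff.1 (mem_degreeLT_of_sub (diffQ_mem N n)) k
        (by omega), add_zero]
    · intro b hb
      rw [if_neg (by omega)]

variable {N} in
theorem quarter_eq : (quarter : (DiffPoly N)[X]) = C (MvPolynomial.C (1 / 4)) := rfl

variable {N} in
theorem bilPoly_C (f g : DiffPoly N) : bilPoly dx (fieldPoly N) (C f) (C g)
    = ∑ i ∈ Finset.range (N + 1), C (bilJ N i f g) * X ^ i := by
  have hb : ∀ i, C (bilJ N i f g) * X ^ i
      = (if i = 0 then -(quarter * quarter * (C (dx (dx f)) * C g + C f * C (dx (dx g))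
        - C (dx f) * C (dx g))) else 0) - quarter * (C (field N i) * X ^ i) * C f * C g := by
    intro i
    have h16 : (1 / 16 : ℝ) = 1 / 4 * (1 / 4) := by norm_num
    rw [bilJ, MvPolynomial.smul_eq_C_mul, MvPolynomial.smul_eq_C_mul, quarter_eq, h16]
    split_ifs with h
    · subst h
      simp only [map_sub, map_neg, map_mul, map_add]
      ring
    · simp only [map_sub, map_mul, map_zero]
      ring
  simp only [hb]
  rw [Finset.sum_sub_distrib, Finset.sum_ite_eq' (Finset.range (N + 1)) 0,
    if_pos (Finset.mem_range.2 (by omega)), ← Finset.sum_mul, ← Finset.sum_mul,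
    ← Finset.mul_sum, bilPoly, fieldPoly]
  simp only [coeffDer_C]

theorem bilPoly_diffQ : bilPoly dx (fieldPoly N) (2 * diffQ N n) (2 * diffQ N n)
    = ∑ a ∈ Finset.range (n + 1), ∑ b ∈ Finset.range (n + 1), ∑ i ∈ Finset.range (N + 1),
      C (bilJ N i (coeffP N a) (coeffP N b)) * X ^ (i + ((n - a) + (n - b))) := by
  rw [two_mul_diffQ, bilPoly_sum]
  refine Finset.sum_congr rfl fun a _ => ?_
  rw [bilPoly_sum_right]
  refine Finset.sum_congr rfl fun b _ => ?_
  rw [bilPoly_mul_X_pow, bilPoly_C, Finset.sum_mul]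
  refine Finset.sum_congr rfl fun i _ => ?_
  rw [mul_assoc, ← pow_add]

theorem coeff_bilPoly_diffQ (k : ℕ) :
    (bilPoly dx (fieldPoly N) (2 * diffQ N n) (2 * diffQ N n)).coeff k
    = ∑ i ∈ Finset.range (N + 1), ∑ a ∈ Finset.range (n + 1), ∑ b ∈ Finset.range (n + 1),
      if k = i + ((n - a) + (n - b)) then bilJ N i (coeffP N a) (coeffP N b) else 0 := by
  rw [bilPoly_diffQ]
  simp only [finsetSum_coeff, coeff_C_mul_X_pow]
  rw [Finset.sum_comm]
  conv_rhs => rw [Finset.sum_comm]; enter [2, a]; rw [Finset.sum_comm]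
  rw [Finset.sum_comm]

/-- In degree `2n + N - j` with `j ≤ n` only `P_a` with `a ≤ j` occur, so cutting the series off at
`P_n` does not disturb these coefficients, and `coeffP_quadratic` applies to them. -/
theorem bilPoly_diffQ_mem (hN : 1 ≤ N) : bilPoly dx (fieldPoly N) (2 * diffQ N n) (2 * diffQ N n)
    - X ^ (2 * n + N) ∈ degreeLT _ (n + N) := by
  rw [mem_degreeLT_iff_coeff]
  intro k hk
  rw [coeff_sub, coeff_bilPoly_diffQ, coeff_X_pow, sub_eq_zero]
  by_cases hk2 : k ≤ 2 * n + N
  · obtain ⟨j, hj⟩ := Nat.exists_eq_add_of_le hk2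
    have hjn : j ≤ n := by omega
    rw [show (if k = 2 * n + N then (1 : DiffPoly N) else 0) = if j = 0 then 1 else 0 by
      congr 1; simp only [eq_iff_iff]; omega, ← coeffP_quadratic N j hN]
    refine Finset.sum_congr rfl fun i hi => ?_
    rw [Finset.mem_range] at hi
    have hsub : Finset.range (j + 1) ⊆ Finset.range (n + 1) :=
      Finset.range_subset_range.2 (by omega)
    rw [← Finset.sum_subset hsub]
    · refine Finset.sum_congr rfl fun a ha => ?_
      rw [Finset.mem_range] at ha
      rw [← Finset.sum_subset hsub]
      · refine Finset.sum_congr rfl fun b hb => ?_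
        rw [Finset.mem_range] at hb
        congr 1
        simp only [eq_iff_iff]
        omega
      · intro b hb hb'
        rw [Finset.mem_range] at hb hb'
        rw [if_neg (by omega)]
    · intro a ha ha'
      rw [Finset.mem_range] at ha ha'
      refine Finset.sum_eq_zero fun b hb => ?_
      rw [Finset.mem_range] at hb
      rw [if_neg (by omega)]
  · rw [if_neg (by omega)]
    refine Finset.sum_eq_zero fun i hi => Finset.sum_eq_zero fun a ha =>
      Finset.sum_eq_zero fun b hb => ?_
    rw [Finset.mem_range] at hi
    rw [if_neg (by omega)]

theorem coeffH_eq (k : ℕ) :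
    coeffH N n k = (bilPoly dx (fieldPoly N) (2 * diffQ N n) (2 * diffQ N n)).coeff k := by
  rw [coeff_bilPoly_diffQ, coeffH]
  refine Finset.sum_congr rfl fun i hi => ?_
  have h0 : ∀ x : DiffPoly N, bilJ N i 0 x = 0 := by intro x; simp [bilJ]
  have h0' : ∀ x : DiffPoly N, bilJ N i x 0 = 0 := by intro x; simp [bilJ]
  rw [← Finset.sum_product', ← Finset.sum_filter]
  symm
  -- A pair `(a, b)` of indices corresponds to `j = i + n - b`, obtained from `b = n + i - j`. Only
  -- nonzero terms are matched, since `coeffPZ` vanishes at negative indices.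
  refine Finset.sum_bij_ne_zero (fun p _ _ => i + (n - p.2)) ?_ ?_ ?_ ?_
  · intro p hp _
    simp only [Finset.mem_filter, Finset.mem_product, Finset.mem_range] at hp
    rw [Finset.mem_Icc]
    omega
  · intro p hp _ p' hp' _ h
    simp only [Finset.mem_filter, Finset.mem_product, Finset.mem_range] at hp hp'
    ext <;> omega
  · intro j hj hne
    rw [Finset.mem_Icc] at hj
    have h1 : 0 ≤ (n : ℤ) - k + j := by
      by_contra h
      rw [coeffPZ, if_neg h, h0] at hne
      exact hne rfl
    have h2 : 0 ≤ (n : ℤ) + i - j := by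
      by_contra h
      rw [coeffPZ, coeffPZ, if_neg h, h0'] at hne
      exact hne rfl
    refine ⟨(n + j - k, n + i - j), ?_, ?_, ?_⟩
    · simp only [Finset.mem_filter, Finset.mem_product, Finset.mem_range]
      omega
    · rw [coeffPZ, coeffPZ, if_pos h1, if_pos h2] at hne
      convert hne using 3 <;> simp only <;> omega
    · simp only
      omega
  · intro p hp _
    simp only [Finset.mem_filter, Finset.mem_product, Finset.mem_range] at hp
    rw [coeffPZ, coeffPZ, if_pos (by omega), if_pos (by omega)]
    congr 2 <;> omega

variable {N n}

theorem coeffPZ_eq {r l : ℕ} (hr : r ≤ n) :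
    coeffPZ N ((r : ℤ) - l) = (2 * shiftDown (n - r) (diffQ N n)).coeff l := by
  have h2 : (2 : (DiffPoly N)[X]) = C 2 := by rw [map_ofNat]
  rw [h2, coeff_C_mul, coeff_shiftDown, ← coeff_C_mul, ← h2]
  by_cases hl : l ≤ r
  · rw [coeffPZ, if_pos (by omega), show l + (n - r) = n - (r - l) by omega,
      coeff_two_mul_diffQ N n (by omega)]
    congr 1
    omega
  · rw [coeffPZ, if_neg (by omega), two_mul, coeff_add,
      mem_degreeLT_iff_coeff.1 (mem_degreeLT_of_sub (diffQ_mem N n)) _ (by omega), add_zero]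

/-- The sum over `j` is a Cauchy product: the coefficient of `X ^ i` in `2 J` applied to the
truncation of `Q`. The factor 2 appears because `P_k` is twice a coefficient of `Q`. The case `r =
n` has no truncation and gives the stationarity equation. -/
theorem fieldK_eq {r : ℕ} (hr : r ≤ n) (i : Fin N) : fieldK N (r + 1) i
    = (lenardOp dx (fieldPoly N) (shiftDown (n - r) (diffQ N n))).coeff i := by
  generalize hF : shiftDown (n - r) (diffQ N n) = F
  have h4 : (4 : DiffPoly N) * MvPolynomial.C (1 / 4) = 1 := by
    have := four_mul_quarter (A := DiffPoly N)
    rw [quarter_eq, show (4 : (DiffPoly N)[X]) = C 4 by rw [map_ofNat], ← C_mul, ← C_1] at this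
    exact C_injective this
  have hterm : ∀ j ∈ Finset.range ((i : ℕ) + 1),
      opJ N j (coeffPZ N ((j : ℤ) - ((i : ℤ) + 1) + (r + 1 : ℕ)))
      = (if j = 0 then 2 * MvPolynomial.C (1 / 4) * dx (dx (dx (F.coeff i))) else 0)
        + (2 * (field N j * dx (F.coeff (i - j))) + dx (field N j) * F.coeff (i - j)) := by
    intro j hj
    rw [Finset.mem_range] at hj
    have h2 : (2 : (DiffPoly N)[X]) = C 2 := by rw [map_ofNat]
    have h2d : ∀ f : DiffPoly N, dx (2 * f) = 2 * dx f := by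
      intro f
      rw [two_mul, map_add, two_mul]
    have h12 : (1 / 2 : ℝ) = 1 / 4 + 1 / 4 := by norm_num
    rw [show (j : ℤ) - ((i : ℤ) + 1) + (r + 1 : ℕ) = (r : ℤ) - ((i : ℕ) - j : ℕ) by
      push_cast [Nat.cast_sub (show j ≤ (i : ℕ) by omega)]; ring, coeffPZ_eq hr, hF, h2,
      coeff_C_mul, opJ, MvPolynomial.smul_eq_C_mul, MvPolynomial.smul_eq_C_mul, h12, map_add]
    have hmain : ∀ g : DiffPoly N, (MvPolynomial.C (1 / 4) + MvPolynomial.C (1 / 4))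
        * (field N j * dx (2 * g) + dx (field N j * (2 * g)))
        = 2 * (field N j * dx g) + dx (field N j) * g := by
      intro g
      rw [Derivation.leibniz dx (field N j), h2d]
      simp only [smul_eq_mul]
      linear_combination (2 * (field N j * dx g) + dx (field N j) * g) * h4
    rw [hmain]
    congr 1
    split_ifs with h
    · subst h
      rw [h2d, h2d, h2d, Nat.sub_zero]
      ring
    · rfl
  rw [fieldK, Finset.sum_congr rfl hterm, Finset.sum_add_distrib, Finset.sum_ite_eq',
    if_pos (Finset.mem_range.2 (by omega)), Finset.sum_add_distrib, lenardOp, coeff_add, coeff_add,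
    add_assoc]
  congr 1
  · rw [quarter_eq, show (2 : (DiffPoly N)[X]) = C 2 by rw [map_ofNat], ← C_mul, coeff_C_mul]
    rfl
  · congr 1
    · rw [show (2 : (DiffPoly N)[X]) = C 2 by rw [map_ofNat], mul_assoc, coeff_C_mul, coeff_mul,
        Finset.Nat.sum_antidiagonal_eq_sum_range_succ_mk, Finset.mul_sum]
      simp only [coeff_fieldPoly]
      rfl
    · rw [coeff_mul, Finset.Nat.sum_antidiagonal_eq_sum_range_succ_mk]
      simp only [coeff_coeffDer, coeff_fieldPoly]

end Hierarchy

end CKdV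

end

noncomputable section

namespace CKdV

open Polynomial

/-! ### From differential polynomials to functions of triples. -/

section Lenard

variable {A : Type*} [CommRing A] [Algebra ℝ A]

theorem lenardOp_map {B : Type*} [CommRing B] [Algebra ℝ B] {D : Derivation ℝ A A}
    {E : Derivation ℝ B B} {φ : A →ₐ[ℝ] B} (h : ∀ a, φ (D a) = E (φ a)) (U f : A[X]) :
    (lenardOp D U f).map (φ : A →+* B)
      = lenardOp E (U.map (φ : A →+* B)) (f.map (φ : A →+* B)) := by
  simp only [lenardOp, Polynomial.map_mul, Polynomial.map_add, quarter_map, coeffDer_map h,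
    Polynomial.map_ofNat]

/-- `D² Q` is twice `W %ₘ Q`, so the third-order term of `2 J` becomes a first derivative. -/
theorem lenardOp_shiftDown {D : Derivation ℝ A A} {Q V W : A[X]} {k : ℕ}
    (hQ : coeffDer D Q = V) (hV : coeffDer D V = 2 * (W %ₘ Q)) :
    lenardOp D (W /ₘ Q) (shiftDown k Q) = lenard D k Q V W := by
  rw [lenardOp, lenard, coeffDer_shiftDown, hQ, coeffDer_shiftDown, hV, two_mul (W %ₘ Q),
    shiftDown_add, map_add]
  linear_combination (coeffDer D (shiftDown k (W %ₘ Q))) * four_mul_quarter (A := A)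

theorem eq_of_two_mul_eq {f g : A[X]} (h : 2 * f = 2 * g) : f = g := by
  rw [← sub_eq_zero]
  exact eq_zero_of_two_mul (by linear_combination h)

end Lenard

variable (N n : ℕ)

/-- Differential polynomials as functions of Mumford triples. -/
def toTriple : DiffPoly N →ₐ[ℝ] TripleRing n N :=
  MvPolynomial.aeval fun a => (tripleDx n N)^[a.2] ((genU n N).coeff a.1)

/-- The prolonged flow `u_{t_r} = K_r` as a derivation of differential polynomials. -/
def flowDer (r : ℕ) : Derivation ℝ (DiffPoly N) (DiffPoly N) :=
  MvPolynomial.mkDerivation ℝ fun a => dx^[a.2] (fieldK N r a.1)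

variable {N n}

theorem algHom_comp_derivation {σ : Type*} {B : Type*} [CommRing B] [Algebra ℝ B]
    {D : Derivation ℝ (MvPolynomial σ ℝ) (MvPolynomial σ ℝ)} {E : Derivation ℝ B B}
    {φ : MvPolynomial σ ℝ →ₐ[ℝ] B}
    (h : ∀ a, φ (D (MvPolynomial.X a)) = E (φ (MvPolynomial.X a))) (f : MvPolynomial σ ℝ) :
    φ (D f) = E (φ f) := by
  induction f using MvPolynomial.induction_on with
  | C r =>
    rw [← MvPolynomial.algebraMap_eq, Derivation.map_algebraMap, map_zero, φ.commutes,
      Derivation.map_algebraMap]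
  | add f g hf hg => simp only [map_add, hf, hg]
  | mul_X f a hf =>
    rw [Derivation.leibniz, map_mul, Derivation.leibniz]
    simp only [map_add, smul_eq_mul, map_mul, hf, h]

theorem toTriple_X (a : Fin N × ℕ) : toTriple N n (MvPolynomial.X a)
    = (tripleDx n N)^[a.2] ((genU n N).coeff a.1) := by
  rw [toTriple, MvPolynomial.aeval_X]

theorem toTriple_dx (f : DiffPoly N) : toTriple N n (dx f) = tripleDx n N (toTriple N n f) := by
  refine algHom_comp_derivation (fun a => ?_) f
  rw [dx, MvPolynomial.mkDerivation_X, toTriple_X, toTriple_X, Function.iterate_succ_apply']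

theorem toTriple_dx_iterate (f : DiffPoly N) (k : ℕ) :
    toTriple N n (dx^[k] f) = (tripleDx n N)^[k] (toTriple N n f) := by
  induction k with
  | zero => rfl
  | succ k ih => rw [Function.iterate_succ_apply', Function.iterate_succ_apply', toTriple_dx, ih]

theorem toTriple_fieldPoly :
    (fieldPoly N).map (toTriple N n : DiffPoly N →+* TripleRing n N) = genU n N := by
  ext1 k
  rw [coeff_map, coeff_fieldPoly, field]
  by_cases hk : k < N
  · rw [dif_pos hk]
    exact toTriple_X (N := N) (n := n) (⟨k, hk⟩, 0)
  · have := mem_degreeLT_iff_coeff.1 (genU_mem (n := n) (N := N)) k (by omega)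
    rw [coeff_add, coeff_X_pow] at this
    rw [dif_neg hk, eq_neg_of_add_eq_zero_left this]
    split_ifs <;> simp

theorem spectral_gen : bilPoly (tripleDx n N) (genU n N) (2 * genQ n N) (2 * genQ n N)
    = spectral (genQ n N) (genV n N) (genW n N) := by
  rw [bilPoly_two_mul tripleDx_genQ tripleDx_genV, genU, modByMonic_add_div]

/-- The substituted truncated series and the generic `Q` solve the same quadratic equation with
potential `genU`, so `bilPoly_unique` identifies them. -/
theorem toTriple_diffQ (hN : 1 ≤ N) :
    (diffQ N n).map (toTriple N n : DiffPoly N →+* TripleRing n N) = genQ n N := by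
  have h2 : ∀ {A : Type} [CommRing A] {Q : A[X]}, Q - X ^ n ∈ degreeLT A n →
      2 * Q - 2 * X ^ n ∈ degreeLT A n := by
    intro A _ Q hQ
    convert add_mem hQ hQ using 1
    ring
  refine eq_of_two_mul_eq (bilPoly_unique hN (genU_mem (n := n) (N := N)) (n := n)
    (D := tripleDx n N) (h2 ?_) (h2 genQ_mem) ?_ ?_)
  · have := sub_mem_map (toTriple N n : DiffPoly N →+* TripleRing n N) (diffQ_mem N n)
    simpa using this
  · have := sub_mem_map (toTriple N n : DiffPoly N →+* TripleRing n N) (bilPoly_diffQ_mem N n hN)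
    rw [Polynomial.map_sub, bilPoly_map toTriple_dx, toTriple_fieldPoly] at this
    simpa using this
  · rw [spectral_gen]
    exact genW_spec

theorem toTriple_coeffP (hN : 1 ≤ N) (i : Fin n) :
    toTriple N n (coeffP N (i + 1)) = 2 * MvPolynomial.X (.inl i) := by
  have h := congrArg (fun f => f.coeff (n - ((i : ℕ) + 1))) (toTriple_diffQ (n := n) hN)
  simp only [coeff_map] at h
  have h2 : ∀ {A : Type} [CommRing A] (f : A[X]) (k : ℕ), (2 * f).coeff k = 2 * f.coeff k := by
    intro A _ f k
    rw [two_mul, coeff_add, two_mul]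
  rw [← coeff_two_mul_diffQ N n (a := i + 1) (by omega), h2, map_mul, ← coeff_genQ,
    show n - 1 - (i : ℕ) = n - (i + 1) by omega, ← h, map_ofNat]
  rfl

theorem toTriple_coeffH (hN : 1 ≤ N) (k : ℕ) : toTriple N n (coeffH N n k)
    = (spectral (genQ n N) (genV n N) (genW n N)).coeff k := by
  have h := bilPoly_map (toTriple_dx (n := n)) (fieldPoly N) (2 * diffQ N n) (2 * diffQ N n)
  rw [toTriple_fieldPoly, Polynomial.map_mul, toTriple_diffQ hN, Polynomial.map_ofNat,
    spectral_gen] at h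
  rw [coeffH_eq, ← h, coeff_map]
  rfl

theorem toTriple_fieldK (hN : 1 ≤ N) {r : ℕ} (hr : r ≤ n) (i : Fin N) :
    toTriple N n (fieldK N (r + 1) i)
      = (lenard (tripleDx n N) (n - r) (genQ n N) (genV n N) (genW n N)).coeff i := by
  have h := lenardOp_map (toTriple_dx (n := n)) (fieldPoly N) (shiftDown (n - r) (diffQ N n))
  rw [toTriple_fieldPoly, shiftDown_map, toTriple_diffQ hN, genU,
    lenardOp_shiftDown tripleDx_genQ tripleDx_genV] at h
  rw [fieldK_eq hr, ← h, coeff_map]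
  rfl

theorem toTriple_stationary (hN : 1 ≤ N) (i : Fin N) (k : ℕ) :
    toTriple N n (dx^[k] (fieldK N (n + 1) i)) = 0 := by
  rw [toTriple_dx_iterate, toTriple_fieldK hN le_rfl, Nat.sub_self, lenard_genTriple, coeff_zero]
  exact Function.iterate_fixed (map_zero _) k

/-- Since the Mumford flows commute with `tripleDx`, it suffices to compare on the undifferentiated
fields, where the equality is `tripleFlow_genU`. -/
theorem toTriple_flowDer (hN : 1 ≤ N) {r : ℕ} (hr : r ≤ n) (f : DiffPoly N) :
    toTriple N n (flowDer N (r + 1) f) = tripleFlow n N (n - r) (toTriple N n f) := by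
  refine algHom_comp_derivation (fun a => ?_) f
  rw [flowDer, MvPolynomial.mkDerivation_X, toTriple_X, tripleFlow_comm_iterate (by omega),
    toTriple_dx_iterate, toTriple_fieldK hN hr, ← coeff_coeffDer, tripleFlow_genU (by omega)]

/-! ### From functions of triples back to differential polynomials, modulo stationarity. -/

section Inverse

variable (N n)

/-- The derivative of `diffQ`. -/
def diffV : (DiffPoly N)[X] := coeffDer dx (diffQ N n)

/-- The third entry of the Mumford triple of the hierarchy. -/
def diffW : (DiffPoly N)[X] :=
  2 * quarter * coeffDer dx (diffV N n) + diffQ N n * fieldPoly N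

/-- The coordinates of Mumford triples as differential polynomials. -/
def ofTriple : TripleRing n N →ₐ[ℝ] DiffPoly N :=
  MvPolynomial.aeval <| Sum.elim (fun i => (1 / 2 : ℝ) • coeffP N (i + 1)) <| Sum.elim
    (fun i => (diffV N n).coeff (n - 1 - i)) (fun j => (diffW N n).coeff j)

variable {N n}

theorem diffV_mem : diffV N n ∈ degreeLT _ n := coeffDer_sub_X_pow _ (diffQ_mem N n)

theorem spectral_diff : spectral (diffQ N n) (diffV N n) (diffW N n)
    = bilPoly dx (fieldPoly N) (2 * diffQ N n) (2 * diffQ N n) := by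
  refine (bilPoly_two_mul rfl ?_).symm
  rw [← diffV]
  linear_combination (-coeffDer dx (diffV N n)) * four_mul_quarter (A := DiffPoly N)

theorem diffW_div : diffW N n /ₘ diffQ N n = fieldPoly N ∧
    diffW N n %ₘ diffQ N n = 2 * quarter * coeffDer dx (diffV N n) := by
  refine divByMonic_eq_of (diffQ_mem N n) ?_ rfl
  have := quarter_mul_mem (coeffDer_mem dx (diffV_mem (N := N) (n := n)))
  convert add_mem this this using 1
  ring

theorem ofTriple_genQ :
    (genQ n N).map (ofTriple N n : TripleRing n N →+* DiffPoly N) = diffQ N n := by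
  rw [genQ, vietePoly_map, diffQ]
  congr 1
  funext i
  exact MvPolynomial.aeval_X _ _

theorem ofTriple_genV :
    (genV n N).map (ofTriple N n : TripleRing n N →+* DiffPoly N) = diffV N n := by
  rw [genV, vecPoly_map, ← vecPoly_coeff (diffV_mem (N := N) (n := n))]
  congr 1
  funext i
  exact MvPolynomial.aeval_X _ _

theorem ofTriple_genW (hN : 1 ≤ N) :
    (genW n N).map (ofTriple N n : TripleRing n N →+* DiffPoly N) = diffW N n := by
  rw [genW, tripleW_map _ genQ_mem, ofTriple_genQ, ofTriple_genV, lowPoly_map]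
  symm
  refine eq_tripleW (diffQ_mem N n) (lowPoly_mem _) ?_ ?_
  · rw [spectral_diff]
    exact bilPoly_diffQ_mem N n hN
  · intro j hj
    have := coeff_lowPoly (fun i => ofTriple N n (MvPolynomial.X (.inr (.inr i)))) ⟨j, hj⟩
    simp only at this
    refine Eq.trans ?_ this.symm
    rw [ofTriple, MvPolynomial.aeval_X]
    rfl

theorem ofTriple_genU (hN : 1 ≤ N) :
    (genU n N).map (ofTriple N n : TripleRing n N →+* DiffPoly N) = fieldPoly N := by
  rw [genU, map_divByMonic _ (monic_of_sub_mem genQ_mem), ofTriple_genW hN, ofTriple_genQ]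
  exact diffW_div.1

variable {I : Ideal (DiffPoly N)}

/-- The substitution need not commute with the `x`-derivations. On coordinates, the defect lies only
in the coefficients of `W`, and the product rule spreads it within the ideal. -/
theorem ofTriple_tripleDx_mem (hN : 1 ≤ N) (hI : ∀ i, fieldK N (n + 1) i ∈ I)
    (f : TripleRing n N) : ofTriple N n (tripleDx n N f) - dx (ofTriple N n f) ∈ I := by
  have h2q : 2 * (2 * quarter * coeffDer dx (diffV N n)) = coeffDer dx (diffV N n) := by
    linear_combination coeffDer dx (diffV N n) * four_mul_quarter (A := DiffPoly N)
  induction f using MvPolynomial.induction_on with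
  | C r =>
    rw [← MvPolynomial.algebraMap_eq, Derivation.map_algebraMap, map_zero, AlgHom.commutes,
      Derivation.map_algebraMap, sub_zero]
    exact I.zero_mem
  | add f g hf hg =>
    simp only [map_add]
    convert I.add_mem hf hg using 1
    ring
  | mul_X f a hf =>
    have ha : ofTriple N n (tripleDx n N (MvPolynomial.X a))
        - dx (ofTriple N n (MvPolynomial.X a)) ∈ I := by
      have hmap : ∀ (p : (TripleRing n N)[X]) (k : ℕ), ofTriple N n (p.coeff k)
          = (p.map (ofTriple N n : TripleRing n N →+* DiffPoly N)).coeff k :=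
        fun p k => (coeff_map _ _).symm
      rcases a with i | i | j
      · rw [← coeff_genQ, ← coeff_coeffDer, hmap, hmap, tripleDx_genQ, ofTriple_genV,
          ofTriple_genQ, ← coeff_coeffDer, diffV, sub_self]
        exact I.zero_mem
      · rw [← coeff_genV, ← coeff_coeffDer, hmap, hmap, tripleDx_genV, ofTriple_genV,
          Polynomial.map_mul, map_modByMonic _ (monic_of_sub_mem genQ_mem), ofTriple_genQ,
          ofTriple_genW hN, diffW_div.2, Polynomial.map_ofNat, h2q, ← coeff_coeffDer, sub_self]
        exact I.zero_mem
      -- Only here does stationarity enter: `W_x + U V` is `2 J` applied to `Q`, whose coefficients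
      -- below `X ^ N` are the components of `K_{n+1}`.
      · rw [← coeff_genW, ← coeff_coeffDer, hmap, hmap, tripleDx_genW, Polynomial.map_neg,
          Polynomial.map_mul, ofTriple_genU hN, ofTriple_genV, ofTriple_genW hN,
          ← coeff_coeffDer, ← coeff_sub]
        have h := fieldK_eq (N := N) (n := n) le_rfl j
        have h0 : shiftDown (n - n) (diffQ N n) = diffQ N n := by rw [Nat.sub_self]; rfl
        rw [h0, lenardOp, ← diffV] at h
        have h1 : -(fieldPoly N * diffV N n) - coeffDer dx (diffW N n)
            = -(2 * quarter * coeffDer dx (coeffDer dx (diffV N n))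
              + 2 * fieldPoly N * diffV N n + coeffDer dx (fieldPoly N) * diffQ N n) := by
          rw [diffW, map_add, mul_assoc, coeffDer_two_mul, coeffDer_quarter_mul,
            Derivation.leibniz, ← diffV]
          simp only [smul_eq_mul]
          ring
        rw [h1, coeff_neg, ← h]
        exact I.neg_mem (hI j)
    rw [Derivation.leibniz, map_mul, Derivation.leibniz]
    simp only [map_add, smul_eq_mul, map_mul]
    convert I.add_mem (I.mul_mem_left (ofTriple N n f) ha)
      (I.mul_mem_left (ofTriple N n (MvPolynomial.X a)) hf) using 1
    ring

/-- Without derivatives the equality is exact, because `U` is the quotient of `diffW` by `diffQ`.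
Each further derivative costs an element of `I`, which is closed under `dx`. -/
theorem ofTriple_toTriple_mem (hN : 1 ≤ N) (hI : ∀ i, fieldK N (n + 1) i ∈ I)
    (hdx : ∀ f ∈ I, dx f ∈ I) (a : Fin N × ℕ) :
    ofTriple N n (toTriple N n (MvPolynomial.X a)) - MvPolynomial.X a ∈ I := by
  obtain ⟨i, k⟩ := a
  rw [toTriple_X]
  simp only
  induction k with
  | zero =>
    have h : ofTriple N n ((genU n N).coeff i) = (fieldPoly N).coeff i := by
      rw [← ofTriple_genU hN, coeff_map]
      rfl
    rw [Function.iterate_zero, id, h, coeff_fieldPoly, field, dif_pos i.isLt, sub_self]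
    exact I.zero_mem
  | succ k ih =>
    rw [Function.iterate_succ_apply']
    have h1 := ofTriple_tripleDx_mem hN hI ((tripleDx n N)^[k] ((genU n N).coeff i))
    have h2 := hdx _ ih
    have h3 : dx (MvPolynomial.X (i, k) : DiffPoly N) = MvPolynomial.X (i, k + 1) := by
      rw [dx, MvPolynomial.mkDerivation_X]
    rw [map_sub, h3] at h2
    convert I.add_mem h1 h2 using 1
    ring

end Inverse

/-! ### Jets on the stationary manifold and the first flow. -/

section Jets

/-- The differential polynomials that vanish at a jet together with all their derivatives. -/
def jetIdeal (ξ : Jet N) : Ideal (DiffPoly N) where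
  carrier := {f | ∀ k : ℕ, val ξ (dx^[k] f) = 0}
  zero_mem' := fun k => by
    rw [Function.iterate_fixed (map_zero _) k]
    exact map_zero _
  add_mem' := by
    intro f g hf hg k
    rw [iterate_map_add]
    exact (map_add (MvPolynomial.eval ξ) _ _).trans (by
      change val ξ _ + val ξ _ = 0
      rw [hf k, hg k, add_zero])
  smul_mem' := by
    intro c f hf k
    rw [smul_eq_mul]
    replace hf : ∀ k : ℕ, val ξ (dx^[k] f) = 0 := hf
    induction k generalizing c f with
    | zero =>
      refine (map_mul (MvPolynomial.eval ξ) _ _).trans ?_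
      change val ξ c * val ξ f = 0
      rw [show val ξ f = 0 from hf 0, mul_zero]
    | succ k ih =>
      rw [Function.iterate_succ_apply, Derivation.leibniz, smul_eq_mul, smul_eq_mul, mul_comm f,
        iterate_map_add]
      refine (map_add (MvPolynomial.eval ξ) _ _).trans ?_
      change val ξ _ + val ξ _ = 0
      rw [ih (f := dx f) c fun j => by rw [← Function.iterate_succ_apply]; exact hf (j + 1),
        ih (f := f) (dx c) hf, add_zero]

theorem val_ofTriple_toTriple (hN : 1 ≤ N) {ξ : Jet N} (hξ : ξ ∈ stationaryManifold N n)
    (a : Fin N × ℕ) : val ξ (ofTriple N n (toTriple N n (MvPolynomial.X a))) = ξ a := by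
  have h := ofTriple_toTriple_mem (I := jetIdeal ξ) (n := n) hN (fun i k => hξ i k) (fun f hf k => by
    rw [← Function.iterate_succ_apply]
    exact hf (k + 1)) a 0
  have h' : val ξ (ofTriple N n (toTriple N n (MvPolynomial.X a)))
      - val ξ (MvPolynomial.X a) = 0 := (map_sub (MvPolynomial.eval ξ) _ _).symm.trans h
  rw [sub_eq_zero.1 h']
  exact MvPolynomial.eval_X a

/-- For `n = 0` the polynomial `Q` is `1`, and `2 J` applied to `1` is `U_x`. -/
theorem jetFlow_one (ξ : Jet N) (a : Fin N × ℕ) : jetFlow N 1 ξ a = ξ (a.1, a.2 + 1) := by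
  have hK : fieldK N 1 a.1 = MvPolynomial.X (a.1, 1) := by
    have h := fieldK_eq (N := N) (n := 0) le_rfl a.1
    have hQ : shiftDown (0 - 0) (diffQ N 0) = 1 := by
      rw [Nat.sub_self]
      exact shiftDown_self (diffQ_mem N 0)
    rw [hQ, lenardOp, Derivation.map_one_eq_zero] at h
    rw [zero_add] at h
    rw [h, map_zero, map_zero]
    simp only [mul_zero, zero_add, mul_one]
    rw [coeff_coeffDer, coeff_fieldPoly, field, dif_pos a.1.isLt, dx, MvPolynomial.mkDerivation_X]
  have hX : ∀ k : ℕ, dx^[k] (MvPolynomial.X (a.1, 1) : DiffPoly N)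
      = MvPolynomial.X (a.1, k + 1) := by
    intro k
    induction k with
    | zero => rfl
    | succ k ih => rw [Function.iterate_succ_apply', ih, dx, MvPolynomial.mkDerivation_X]
  rw [jetFlow, hK, hX]
  exact MvPolynomial.eval_X _

end Jets

end CKdV

end

noncomputable section

namespace CKdV

open Polynomial

/-! ### The residue pairing modulo a monic polynomial. -/

section Residue

variable {A : Type*} [CommRing A] {n k : ℕ} {Q : A[X]}

/-- The residue at infinity of `f / Q` for monic `Q` of degree `n`. -/
def residue (n : ℕ) (Q f : A[X]) : A := (f %ₘ Q).coeff (n - 1)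

theorem residue_add (f g : A[X]) : residue n Q (f + g) = residue n Q f + residue n Q g := by
  rw [residue, add_modByMonic, coeff_add, residue, residue]

theorem residue_sub (f g : A[X]) : residue n Q (f - g) = residue n Q f - residue n Q g := by
  rw [residue, sub_modByMonic, coeff_sub, residue, residue]

theorem residue_C_mul (a : A) (f : A[X]) : residue n Q (C a * f) = a * residue n Q f := by
  rw [residue, ← smul_eq_C_mul, smul_modByMonic, coeff_smul, smul_eq_mul, residue]

theorem residue_sum {ι : Type*} (s : Finset ι) (f : ι → A[X]) :
    residue n Q (∑ i ∈ s, f i) = ∑ i ∈ s, residue n Q (f i) := by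
  classical
  induction s using Finset.induction_on with
  | empty => simp [residue]
  | insert a s ha ih => rw [Finset.sum_insert ha, Finset.sum_insert ha, residue_add, ih]

theorem residue_congr (hQ : Q - X ^ n ∈ degreeLT A n) {f g : A[X]} (h : Q ∣ f - g) :
    residue n Q f = residue n Q g := by
  rw [residue, modByMonic_eq_of_dvd_sub (monic_of_sub_mem hQ) h, residue]

theorem residue_of_mem (hQ : Q - X ^ n ∈ degreeLT A n) {f : A[X]} (hf : f ∈ degreeLT A n) :
    residue n Q f = f.coeff (n - 1) := by
  rw [residue, (divByMonic_eq_of (g := 0) hQ hf (by rw [mul_zero, add_zero])).2]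

/-- Modulo `Q` the product agrees with `shiftWr`, whose top coefficient is known. Thus the
truncations of `Q` form the basis dual to the monomials. -/
theorem residue_shiftDown_mul (hQ : Q - X ^ n ∈ degreeLT A n) (hk : k < n) {g : A[X]}
    (hg : g ∈ degreeLT A n) : residue n Q (shiftDown (k + 1) Q * g) = g.coeff k := by
  rw [← coeff_shiftWr hk hQ hg,
    ← residue_of_mem hQ (shiftWr_mem hk (mem_degreeLT_of_sub hQ) hg)]
  refine residue_congr hQ ⟨shiftDown (k + 1) g, ?_⟩
  rw [shiftWr]
  ring

theorem residue_shiftDown_mul' (hQ : Q - X ^ n ∈ degreeLT A n) (hk : k < n) (g : A[X]) :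
    residue n Q (shiftDown (k + 1) Q * g) = (g %ₘ Q).coeff k := by
  rw [← residue_shiftDown_mul hQ hk (modByMonic_mem hQ g)]
  refine residue_congr hQ ⟨shiftDown (k + 1) Q * (g /ₘ Q), ?_⟩
  linear_combination (-shiftDown (k + 1) Q) * modByMonic_add_div g Q

theorem residue_shiftDown_symm (hQ : Q - X ^ n ∈ degreeLT A n) (hn : 1 ≤ n) (hk : k ≤ n)
    {f g : A[X]} (hf : f ∈ degreeLT A n) (hg : g ∈ degreeLT A n) :
    residue n Q (shiftDown k f * g) = residue n Q (f * shiftDown k g) := by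
  have h := shiftWr_mem_of_mem hk hn hf hg
  rw [← sub_eq_zero, ← residue_sub]
  change residue n Q (shiftWr k f g) = 0
  rw [residue_of_mem hQ (mem_degreeLT_mono h (by omega)), mem_degreeLT_iff_coeff.1 h _ le_rfl]

/-- The polynomial of degree `< n` whose pairings with the monomials are the numbers `p`. -/
def momentPoly (Q : A[X]) (p : Fin n → A) : A[X] :=
  ∑ j : Fin n, C (p j) * shiftDown (n - 1 - j + 1) Q

theorem shiftDown_succ_mem (hQ : Q - X ^ n ∈ degreeLT A n) (k : ℕ) :
    shiftDown (k + 1) Q ∈ degreeLT A n :=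
  shiftDown_mem (mem_degreeLT_mono (mem_degreeLT_of_sub hQ) (by omega))

theorem momentPoly_mem (hQ : Q - X ^ n ∈ degreeLT A n) (p : Fin n → A) :
    momentPoly Q p ∈ degreeLT A n :=
  sum_mem fun _ _ => C_mul_mem_degreeLT _ (shiftDown_succ_mem hQ _)

theorem residue_momentPoly_mul (hQ : Q - X ^ n ∈ degreeLT A n) (p : Fin n → A) {g : A[X]}
    (hg : g ∈ degreeLT A n) :
    residue n Q (momentPoly Q p * g) = ∑ j : Fin n, p j * g.coeff (n - 1 - j) := by
  rw [momentPoly, Finset.sum_mul, residue_sum]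
  refine Finset.sum_congr rfl fun j _ => ?_
  rw [mul_assoc, residue_C_mul, residue_shiftDown_mul hQ (by omega) hg]

/-- Expansion of `f` in the dual basis. It reconstructs a polynomial from its pairings, as needed to
turn `-∂H/∂q` into a polynomial. -/
theorem momentPoly_residue (hQ : Q - X ^ n ∈ degreeLT A n) {f : A[X]} (hf : f ∈ degreeLT A n) :
    momentPoly Q (fun i : Fin n => residue n Q (f * X ^ (n - 1 - (i : ℕ)))) = f := by
  have hm := momentPoly_mem hQ (fun i : Fin n => residue n Q (f * X ^ (n - 1 - (i : ℕ))))
  refine ext_of_mem hm hf fun i => ?_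
  have hi : n - 1 - (i : ℕ) < n := by omega
  rw [← residue_shiftDown_mul hQ hi hm, ← residue_shiftDown_mul hQ hi hf, mul_comm,
    residue_momentPoly_mul hQ _ (shiftDown_succ_mem hQ _)]
  conv_rhs => rw [← vecPoly_coeff (shiftDown_succ_mem hQ (n - 1 - (i : ℕ)))]
  rw [vecPoly, Finset.sum_mul, residue_sum]
  refine Finset.sum_congr rfl fun j _ => ?_
  rw [mul_assoc, residue_C_mul, mul_comm f, mul_comm]

/-- Horner's scheme: the truncations satisfy `X f_{j+1} = f_j - f.coeff j`, and the sum telescopes.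
-/
theorem mul_sum_shiftDown (f : A[X]) (y : A) (n : ℕ) :
    (X - C y) * ∑ j ∈ Finset.range n, C (y ^ j) * shiftDown (j + 1) f
      = f - C (y ^ n) * shiftDown n f - C (∑ j ∈ Finset.range n, y ^ j * f.coeff j) := by
  induction n with
  | zero => simp [shiftDown]
  | succ n ih =>
    have h : X * shiftDown (n + 1) f = shiftDown n f - C (f.coeff n) := by
      ext k
      rcases k with _ | k
      · simp [coeff_shiftDown]
      · rw [coeff_X_mul, coeff_sub, coeff_shiftDown, coeff_shiftDown, coeff_C_succ, sub_zero]
        congr 1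
        omega
    rw [Finset.sum_range_succ, mul_add, ih, Finset.sum_range_succ, pow_succ, C_add, C_mul, C_mul]
    linear_combination C (y ^ n) * h

theorem mul_sum_shiftDown_root (hQ : Q - X ^ n ∈ degreeLT A n) {y : A} (hy : Q.eval y = 0) :
    (X - C y) * ∑ i : Fin n, C (y ^ (n - 1 - (i : ℕ))) * shiftDown (n - 1 - i + 1) Q = Q := by
  rw [Fin.sum_univ_eq_sum_range (fun i => C (y ^ (n - 1 - i)) * shiftDown (n - 1 - i + 1) Q) n,
    Finset.sum_range_reflect (fun i => C (y ^ i) * shiftDown (i + 1) Q) n, mul_sum_shiftDown,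
    shiftDown_self hQ, mul_one, sub_sub, ← C_add]
  have : y ^ n + ∑ j ∈ Finset.range n, y ^ j * Q.coeff j = 0 := by
    rw [← hy, eval_eq_sum_range' (n := n + 1), Finset.sum_range_succ, coeff_of_sub_mem hQ, one_mul,
      add_comm]
    · simp only [mul_comm]
    · nontriviality A
      rw [natDegree_eq_of_degree_eq_some (degree_of_sub_mem hQ)]
      omega
  rw [this, C_0, sub_zero]

end Residue

/-! ### The matrices `R`, `G_m`, `A_k` and the elementary potentials as operations modulo `Q`. -/

section Matrices

variable {n : ℕ} (q : Fin n → ℝ)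

theorem coeff_vietePoly (k : ℕ) : (vietePoly q).coeff k = qExt q ((n : ℤ) - k) := by
  rw [qExt]
  by_cases hk : k < n
  · rw [if_neg (by omega), Finset.sum_eq_single (⟨n - 1 - k, by omega⟩ : Fin n), if_pos, vietePoly,
      coeff_add, coeff_X_pow, if_neg (by omega), zero_add]
    · have := coeff_vecPoly q ⟨n - 1 - k, by omega⟩
      simp only at this
      rwa [show n - 1 - (n - 1 - k) = k by omega] at this
    · simp only
      omega
    · intro j _ hj
      rw [if_neg]
      intro h
      apply hj
      ext
      simp only
      omega
    · simp
  · have := mem_degreeLT_iff_coeff.1 (vietePoly_sub_mem q) k (by omega)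
    rw [coeff_sub, coeff_X_pow, sub_eq_zero] at this
    rw [this, Finset.sum_eq_zero]
    · congr 1
      simp only [eq_iff_iff]
      omega
    · intro j _
      rw [if_neg (by omega)]

/-- `R` is multiplication by `X` modulo `Q`: the leading coefficient of `v` is removed by a multiple
of `Q`. -/
theorem vecPoly_matR (hn : 1 ≤ n) (v : Fin n → ℝ) : vecPoly (Matrix.mulVec (matR q) v)
    = X * vecPoly v - C (v ⟨0, hn⟩) * vietePoly q := by
  have hc : (vecPoly v).coeff (n - 1) = v ⟨0, hn⟩ := coeff_vecPoly v ⟨0, hn⟩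
  refine ext_of_mem (n := n) (vecPoly_mem _) ?_ fun i => ?_
  · rw [mem_degreeLT_iff_coeff]
    intro k hk
    obtain ⟨l, rfl⟩ : ∃ l, k = l + 1 := ⟨k - 1, by omega⟩
    rw [coeff_sub, coeff_X_mul, coeff_C_mul]
    by_cases hl : l + 1 = n
    · rw [hl, coeff_of_sub_mem (vietePoly_sub_mem q), mul_one, show l = n - 1 by omega, hc,
        sub_self]
    · rw [mem_degreeLT_iff_coeff.1 (vecPoly_mem v) l (by omega),
        mem_degreeLT_iff_coeff.1 (mem_degreeLT_of_sub (vietePoly_sub_mem q)) _ (by omega),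
        mul_zero, sub_zero]
  · have hq : (vietePoly q).coeff (n - 1 - i) = q i := by
      rw [vietePoly, coeff_add, coeff_vecPoly, coeff_X_pow, if_neg (by omega), zero_add]
    rw [coeff_vecPoly, coeff_sub, coeff_C_mul, hq, Matrix.mulVec, dotProduct]
    simp only [matR, Matrix.of_apply, add_mul, Finset.sum_add_distrib, ite_mul, zero_mul, one_mul]
    rw [Finset.sum_eq_single (⟨0, hn⟩ : Fin n), if_pos rfl]
    · by_cases hi : (i : ℕ) + 1 < n
      · rw [Finset.sum_eq_single (⟨(i : ℕ) + 1, hi⟩ : Fin n), if_pos rfl,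
          show n - 1 - (i : ℕ) = (n - 1 - ((i : ℕ) + 1)) + 1 by omega, coeff_X_mul]
        · have := coeff_vecPoly v ⟨(i : ℕ) + 1, hi⟩
          simp only at this
          rw [this]
          ring
        · intro j _ hj
          rw [if_neg]
          intro h
          exact hj (Fin.ext h)
        · simp
      · rw [Finset.sum_eq_zero, show n - 1 - (i : ℕ) = 0 by omega, coeff_X_mul_zero]
        · ring
        · intro j _
          rw [if_neg (by omega)]
    · intro j _ hj
      rw [if_neg]
      intro h
      exact hj (Fin.ext h)
    · simp

theorem dvd_vecPoly_matR_pow (hn : 1 ≤ n) (m : ℕ) (v : Fin n → ℝ) :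
    vietePoly q ∣ X ^ m * vecPoly v - vecPoly (Matrix.mulVec (matR q ^ m) v) := by
  induction m with
  | zero => simp
  | succ m ih =>
    rw [pow_succ', pow_succ', ← Matrix.mulVec_mulVec, vecPoly_matR q hn]
    obtain ⟨g, hg⟩ := ih
    exact ⟨X * g + C (Matrix.mulVec (matR q ^ m) v ⟨0, hn⟩), by linear_combination X * hg⟩

theorem vecPoly_metricZero (p : Fin n → ℝ) : vecPoly (Matrix.mulVec (metricZero q) p)
    = 2 * momentPoly (vietePoly q) p := by
  refine ext_of_mem (n := n) (vecPoly_mem _) ?_ fun i => ?_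
  · rw [two_mul]
    exact add_mem (momentPoly_mem (vietePoly_sub_mem q) p) (momentPoly_mem (vietePoly_sub_mem q) p)
  · rw [coeff_vecPoly, two_mul, coeff_add, ← two_mul, momentPoly, finsetSum_coeff,
      Finset.mul_sum, Matrix.mulVec, dotProduct]
    refine Finset.sum_congr rfl fun j _ => ?_
    rw [metricZero, Matrix.of_apply, coeff_C_mul, coeff_shiftDown, coeff_vietePoly]
    rw [show (n : ℤ) - (n - 1 - (i : ℕ) + (n - 1 - (j : ℕ) + 1) : ℕ)
      = ((i : ℤ) + 1) + ((j : ℤ) + 1) - n - 1 by omega]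
    ring

/-- The two products in `shiftWr` contribute `q_{i-j+k-1}` (indices from one) for `i ≤ j` and for `j
< k` respectively, with opposite signs. They cancel on the overlap, which leaves the case
distinction in `killing`. -/
theorem vecPoly_killing (k : Fin n) (v : Fin n → ℝ) : vecPoly (Matrix.mulVec (killing q k) v)
    = shiftWr (n - k) (vietePoly q) (vecPoly v) := by
  refine ext_of_mem (n := n) (vecPoly_mem _) (shiftWr_mem (by omega)
    (mem_degreeLT_of_sub (vietePoly_sub_mem q)) (vecPoly_mem v)) fun i => ?_
  have hsum : shiftWr (n - k) (vietePoly q) (vecPoly v) = ∑ j : Fin n, C (v j) *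
      (shiftDown (n - k) (vietePoly q) * X ^ (n - 1 - (j : ℕ))
        - vietePoly q * shiftDown (n - k) (X ^ (n - 1 - (j : ℕ)))) := by
    rw [shiftWr, vecPoly, shiftDown_sum, Finset.mul_sum, Finset.mul_sum,
      ← Finset.sum_sub_distrib]
    refine Finset.sum_congr rfl fun j _ => ?_
    rw [shiftDown_C_mul]
    ring
  rw [hsum, finsetSum_coeff, coeff_vecPoly, Matrix.mulVec, dotProduct]
  refine Finset.sum_congr rfl fun j _ => ?_
  rw [coeff_C_mul, mul_comm]
  congr 1
  have hsh : shiftDown (n - k) (X ^ (n - 1 - (j : ℕ)) : ℝ[X])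
      = if j < k then X ^ ((k : ℕ) - 1 - j) else 0 := by
    ext l
    rw [coeff_shiftDown, coeff_X_pow]
    split_ifs with h1 h2 h2
    · rw [coeff_X_pow, if_pos]
      have : (j : ℕ) < k := h2
      omega
    · exfalso
      apply h2
      rw [Fin.lt_def]
      omega
    · rw [coeff_X_pow, if_neg]
      have : (j : ℕ) < k := h2
      omega
    · rw [coeff_zero]
  rw [hsh, coeff_sub, coeff_mul_X_pow', coeff_shiftDown]
  have hA : (if n - 1 - (j : ℕ) ≤ n - 1 - i then
      (vietePoly q).coeff (n - 1 - i - (n - 1 - j) + (n - k)) else 0)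
      = if i ≤ j then qExt q ((i : ℤ) - j + k) else 0 := by
    have : (n - 1 - (j : ℕ) ≤ n - 1 - i) ↔ i ≤ j := by rw [Fin.le_def]; omega
    simp only [this]
    split_ifs with h
    · rw [Fin.le_def] at h
      rw [coeff_vietePoly]
      congr 1
      omega
    · rfl
  have hB : (vietePoly q * if j < k then X ^ ((k : ℕ) - 1 - j) else 0).coeff (n - 1 - i)
      = if j < k then qExt q ((i : ℤ) - j + k) else 0 := by
    split_ifs with h
    · rw [Fin.lt_def] at h
      rw [coeff_mul_X_pow']
      split_ifs with h'
      · rw [coeff_vietePoly]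
        congr 1
        omega
      · rw [qExt, if_neg (by omega), Finset.sum_eq_zero]
        intro l _
        rw [if_neg (by omega)]
    · rw [mul_zero, coeff_zero]
  rw [hA, hB, killing, Matrix.of_apply, show ((i : ℤ) + 1) - ((j : ℤ) + 1) + ((k : ℤ) + 1) - 1
    = (i : ℤ) - j + k by ring]
  simp only [Fin.le_def, Fin.lt_def]
  split_ifs <;> first | omega | ring

theorem dvd_vecPoly_metric (hn : 1 ≤ n) (m : ℕ) (p : Fin n → ℝ) : vietePoly q ∣
    2 * X ^ m * momentPoly (vietePoly q) p - vecPoly (Matrix.mulVec (metric m q) p) := by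
  have := dvd_vecPoly_matR_pow q hn m (Matrix.mulVec (metricZero q) p)
  rw [Matrix.mulVec_mulVec, vecPoly_metricZero] at this
  rw [metric]
  convert this using 2
  ring

theorem isUnit_det_matR {m : ℕ} (h : (metric m q).det ≠ 0) : IsUnit (matR q).det ∨ m = 0 := by
  by_cases hm : m = 0
  · exact Or.inr hm
  · left
    rw [metric, Matrix.det_mul, Matrix.det_pow] at h
    refine isUnit_iff_ne_zero.2 fun h0 => h ?_
    rw [h0, zero_pow hm, zero_mul]

theorem vecPoly_last (hn : 1 ≤ n) (a : ℝ) :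
    vecPoly (fun i : Fin n => if (i : ℕ) + 1 = n then a else 0) = C a := by
  rw [vecPoly, Finset.sum_eq_single (⟨n - 1, by omega⟩ : Fin n), if_pos, Nat.sub_self, pow_zero,
    mul_one]
  · simp only
    omega
  · intro j _ hj
    rw [if_neg, C_0, zero_mul]
    intro h
    apply hj
    ext
    simp only
    omega
  · simp

/-- If `R` is invertible, applying `R⁻¹` to the constant `1` gives an inverse of `X` modulo `Q`; for
`m = 0` there is nothing to invert. This is the only form in which nondegeneracy of the metric is
used in the divisibility arguments that cancel `X ^ m`. -/
theorem isCoprime_X_pow (hn : 1 ≤ n) {m : ℕ} (h : (metric m q).det ≠ 0) :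
    IsCoprime (X ^ m) (vietePoly q) := by
  rcases isUnit_det_matR q h with hu | rfl
  · refine IsCoprime.pow_left ?_
    have h1 := vecPoly_matR q hn (Matrix.mulVec (matR q)⁻¹
      fun i => if (i : ℕ) + 1 = n then 1 else 0)
    rw [Matrix.mulVec_mulVec, Matrix.mul_nonsing_inv _ hu, Matrix.one_mulVec, vecPoly_last hn] at h1
    refine ⟨vecPoly (Matrix.mulVec (matR q)⁻¹ fun i => if (i : ℕ) + 1 = n then 1 else 0),
      -C ((Matrix.mulVec (matR q)⁻¹ fun i => if (i : ℕ) + 1 = n then 1 else 0) ⟨0, hn⟩), ?_⟩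
    rw [← C_1, h1, mul_comm _ X, sub_eq_add_neg, neg_mul]
  · rw [pow_zero]
    exact isCoprime_one_left

/-- The potential represents `-X ^ e` modulo `Q`. The factor `X ^ m` clears the negative exponents.
-/
theorem dvd_vecPoly_elemPotential (hn : 1 ≤ n) {m : ℕ} (h : (metric m q).det ≠ 0) {e : ℤ} {d : ℕ}
    (hd : (m : ℤ) + e = d) : vietePoly q ∣ X ^ m * vecPoly (elemPotential q e) + X ^ d := by
  have h1 : Matrix.mulVec (matR q ^ m) (elemPotential q e)
      = Matrix.mulVec (matR q ^ d) fun i => if (i : ℕ) + 1 = n then -1 else 0 := by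
    rw [elemPotential, Matrix.mulVec_mulVec]
    congr 1
    rcases isUnit_det_matR q h with hu | rfl
    · rw [← zpow_natCast, ← Matrix.zpow_add hu, hd, zpow_natCast]
    · rw [Nat.cast_zero, zero_add] at hd
      rw [hd, zpow_natCast, pow_zero, one_mul]
  have h2 := dvd_vecPoly_matR_pow q hn m (elemPotential q e)
  have h3 := dvd_vecPoly_matR_pow q hn d fun i => if (i : ℕ) + 1 = n then -1 else 0
  rw [h1] at h2
  rw [vecPoly_last hn] at h3
  have := dvd_sub h2 h3
  convert this using 1
  simp only [C_neg, C_1]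
  ring

variable {N : ℕ}

/-- The polynomial `X ^ m σ(X)`. -/
def sigmaPoly (n m : ℕ) (c : Fin N → ℝ) : ℝ[X] :=
  X ^ (2 * n + N) + ∑ i : Fin N, C (c i) * X ^ (if (i : ℕ) < m then (i : ℕ) else n + i)

/-- The polynomial `∑ H_k X ^ (n-k)`. -/
def hamPoly (m : ℕ) (z : Phase N n) : ℝ[X] := vecPoly fun k => hamiltonian m k z

/-- Contraction with `p` is the pairing with `Π`, and modulo `Q` the vector `A_k G_m p` is `Q₊`
times `2 X ^ m Π`. Pairing with the dual basis element `Q₊` extracts a coefficient. -/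
theorem kinetic_eq (hn : 1 ≤ n) (m : ℕ) (k : Fin n) (p : Fin n → ℝ) :
    (1 / 2) * (p ⬝ᵥ Matrix.mulVec (killing q k * metric m q) p)
      = ((X ^ m * momentPoly (vietePoly q) p ^ 2) %ₘ vietePoly q).coeff (n - 1 - k) := by
  have hQ := vietePoly_sub_mem q
  have h1 : p ⬝ᵥ Matrix.mulVec (killing q k * metric m q) p = residue n (vietePoly q)
      (momentPoly (vietePoly q) p * vecPoly (Matrix.mulVec (killing q k * metric m q) p)) := by
    rw [residue_momentPoly_mul hQ _ (vecPoly_mem _)]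
    simp only [coeff_vecPoly]
    rfl
  have h2 : residue n (vietePoly q)
      (momentPoly (vietePoly q) p * vecPoly (Matrix.mulVec (killing q k * metric m q) p))
      = residue n (vietePoly q) (C 2 * (shiftDown (n - 1 - k + 1) (vietePoly q)
        * (X ^ m * momentPoly (vietePoly q) p ^ 2))) := by
    refine residue_congr hQ ?_
    rw [← Matrix.mulVec_mulVec, vecPoly_killing, shiftWr,
      show n - 1 - (k : ℕ) + 1 = n - k by omega, map_ofNat]
    obtain ⟨g, hg⟩ := dvd_vecPoly_metric q hn m p
    refine ⟨-momentPoly (vietePoly q) p * (shiftDown (n - k) (vecPoly (Matrix.mulVec (metric m q) p))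
      + shiftDown (n - k) (vietePoly q) * g), ?_⟩
    linear_combination (-momentPoly (vietePoly q) p * shiftDown (n - k) (vietePoly q)) * hg
  rw [h1, h2, residue_C_mul, residue_shiftDown_mul' hQ (by omega)]
  ring

/-- One congruence that encodes all the Hamiltonians: it is the separation curve times `X ^ m`, with
`Π` in place of `-μ`. The results on the curve and on the flows derive from it. -/
theorem dvd_hamPoly (hn : 1 ≤ n) (m : ℕ) (z : Phase N n)
    (h : (metric m z.1).det ≠ 0) : vietePoly z.1 ∣
      X ^ (2 * m) * momentPoly (vietePoly z.1) z.2.1 ^ 2 - sigmaPoly n m z.2.2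
        - X ^ m * hamPoly m z := by
  have hH : hamPoly m z = (X ^ m * momentPoly (vietePoly z.1) z.2.1 ^ 2) %ₘ vietePoly z.1
      + (vecPoly (elemPotential z.1 (2 * (n : ℤ) + N - m))
        + ∑ i : Fin N, C (z.2.2 i) * vecPoly (elemPotential z.1 (cExponent n m i))) := by
    have hmem := modByMonic_mem (vietePoly_sub_mem z.1)
      (X ^ m * momentPoly (vietePoly z.1) z.2.1 ^ 2)
    refine ext_of_mem (n := n) (vecPoly_mem _) (add_mem hmem (add_mem (vecPoly_mem _)
      (sum_mem fun i _ => C_mul_mem_degreeLT _ (vecPoly_mem _)))) fun k => ?_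
    rw [hamPoly, coeff_vecPoly, hamiltonian, kinetic_eq _ hn, potential, coeff_add, coeff_add,
      coeff_vecPoly, finsetSum_coeff]
    simp only [coeff_C_mul, coeff_vecPoly]
  have h0 := modByMonic_add_div (X ^ m * momentPoly (vietePoly z.1) z.2.1 ^ 2) (vietePoly z.1)
  have h1 := dvd_vecPoly_elemPotential z.1 hn h (e := 2 * (n : ℤ) + N - m) (d := 2 * n + N)
    (by push_cast; ring)
  have h2 : ∀ i : Fin N, vietePoly z.1 ∣ X ^ m * vecPoly (elemPotential z.1 (cExponent n m i))
      + X ^ (if (i : ℕ) < m then (i : ℕ) else n + i) := by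
    intro i
    refine dvd_vecPoly_elemPotential z.1 hn h ?_
    rw [cExponent]
    split_ifs <;> push_cast <;> ring
  have h3 : vietePoly z.1 ∣ ∑ i : Fin N, C (z.2.2 i) *
      (X ^ m * vecPoly (elemPotential z.1 (cExponent n m i))
      + X ^ (if (i : ℕ) < m then (i : ℕ) else n + i)) :=
    Finset.dvd_sum fun i _ => (h2 i).mul_left _
  have h4 := (dvd_mul_right (vietePoly z.1) (X ^ m * ((X ^ m * momentPoly (vietePoly z.1) z.2.1 ^ 2)
    /ₘ vietePoly z.1)))
  convert dvd_sub h4 (dvd_add h1 h3) using 1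
  rw [hH, sigmaPoly]
  simp only [mul_add, Finset.sum_add_distrib, Finset.mul_sum]
  simp only [mul_left_comm (X ^ m : ℝ[X]) (C _)]
  linear_combination (-X ^ m) * h0

end Matrices

/-! ### The separation curve at the roots of `Q`. -/

section SeparationCurve

variable {N n : ℕ}

theorem vietePoly_eq_prod {lam mu : Fin n → ℂ} {q p : Fin n → ℝ} (h : IsViete lam mu q p) :
    (vietePoly q).map (algebraMap ℝ ℂ) = ∏ j : Fin n, (X - C (lam j)) := by
  have hcard : Multiset.card (Finset.univ.val.map lam) = n := by simp
  have hprod : ∏ j : Fin n, (X - C (lam j))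
      = ((Finset.univ.val.map lam).map fun t => X - C t).prod := by
    rw [Multiset.map_map]
    rfl
  ext k
  by_cases hk : k < n
  · rw [hprod, Multiset.prod_X_sub_C_coeff _ (by omega), hcard, Finset.esymm_map_val, coeff_map]
    have h1 := h.1 ⟨n - 1 - k, by omega⟩
    have h2 := coeff_vecPoly q ⟨n - 1 - k, by omega⟩
    simp only at h1 h2
    rw [show n - 1 - (n - 1 - k) = k by omega] at h2
    rw [show n - 1 - k + 1 = n - k by omega] at h1
    rw [vietePoly, coeff_add, coeff_X_pow, if_neg (by omega), zero_add, h2, ← h1]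
    rfl
  · have hm : (∏ j : Fin n, (X - C (lam j))).Monic := monic_prod_of_monic _ _ fun i _ =>
      monic_X_sub_C _
    have hd : (∏ j : Fin n, (X - C (lam j))).natDegree = n := by
      rw [natDegree_finsetProd_X_sub_C_eq_card]
      simp
    have h3 := sub_mem_map (algebraMap ℝ ℂ) (vietePoly_sub_mem q)
    rw [Polynomial.map_sub, Polynomial.map_pow, map_X] at h3
    by_cases hkn : k = n
    · rw [hkn, coeff_of_sub_mem h3]
      have := hm.coeff_natDegree
      rw [hd] at this
      exact this.symm
    · rw [mem_degreeLT_iff_coeff.1 (mem_degreeLT_of_sub h3) k (by omega),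
        coeff_eq_zero_of_natDegree_lt (by omega)]

/-- The formula for `p` is Lagrange interpolation: it makes `Π` the polynomial of degree `< n` with
the value `-μ_k` at `λ_k`. -/
theorem eval_momentPoly {lam mu : Fin n → ℂ} {q p : Fin n → ℝ} (hinj : Function.Injective lam)
    (h : IsViete lam mu q p) (l : Fin n) :
    ((momentPoly (vietePoly q) p).map (algebraMap ℝ ℂ)).eval (lam l) = -mu l := by
  have hprod := vietePoly_eq_prod h
  have hQ := sub_mem_map (algebraMap ℝ ℂ) (vietePoly_sub_mem q)
  rw [Polynomial.map_sub, Polynomial.map_pow, map_X] at hQ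
  have hroot : ∀ k, ((vietePoly q).map (algebraMap ℝ ℂ)).eval (lam k) = 0 := by
    intro k
    rw [hprod, eval_prod]
    exact Finset.prod_eq_zero (Finset.mem_univ k) (by simp)
  have hS : ∀ k, ∑ i : Fin n, C (lam k ^ (n - 1 - (i : ℕ)))
      * shiftDown (n - 1 - i + 1) ((vietePoly q).map (algebraMap ℝ ℂ))
      = ∏ j ∈ Finset.univ.erase k, (X - C (lam j)) := by
    intro k
    have h1 := mul_sum_shiftDown_root hQ (hroot k)
    refine mul_left_cancel₀ (X_sub_C_ne_zero (lam k)) (h1.trans ?_)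
    rw [hprod]
    exact (Finset.mul_prod_erase Finset.univ (fun j => X - C (lam j)) (Finset.mem_univ k)).symm
  have hM : (momentPoly (vietePoly q) p).map (algebraMap ℝ ℂ) = ∑ k : Fin n,
      C (-(mu k / ∏ j ∈ Finset.univ.erase k, (lam k - lam j)))
        * ∏ j ∈ Finset.univ.erase k, (X - C (lam j)) := by
    simp only [← hS, Finset.mul_sum]
    rw [Finset.sum_comm, momentPoly, Polynomial.map_sum]
    refine Finset.sum_congr rfl fun i _ => ?_
    rw [Polynomial.map_mul, map_C, shiftDown_map]
    simp only [← mul_assoc, ← C_mul]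
    rw [← Finset.sum_mul, ← map_sum]
    congr 2
    refine (h.2 i).trans ?_
    rw [← Finset.sum_neg_distrib]
    refine Finset.sum_congr rfl fun k _ => ?_
    ring
  rw [hM, eval_finsetSum, Finset.sum_eq_single l]
  · have hne : ∏ j ∈ Finset.univ.erase l, (lam l - lam j) ≠ 0 := by
      refine Finset.prod_ne_zero_iff.2 fun j hj => sub_ne_zero.2 fun h => ?_
      exact (Finset.ne_of_mem_erase hj) (hinj h.symm)
    simp only [eval_mul, eval_C, eval_prod, eval_sub, eval_X]
    field_simp
  · intro k _ hk
    have h0 : ∏ j ∈ Finset.univ.erase k, (X - C (lam j)).eval (lam l) = 0 :=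
      Finset.prod_eq_zero (Finset.mem_erase.2 ⟨hk.symm, Finset.mem_univ l⟩) (by simp)
    rw [eval_mul, eval_prod, h0, mul_zero]
  · simp

theorem separation_curve {m : ℕ} (hn : 1 ≤ n) {z : Phase N n}
    (hz : z ∈ phaseDomain N n m) {lam mu : Fin n → ℂ} (hinj : Function.Injective lam)
    (h : IsViete lam mu z.1 z.2.1) (i : Fin n) :
    sigma n m z.2.2 (lam i) + ∑ k : Fin n, (hamiltonian m k z : ℂ) * lam i ^ (n - 1 - (k : ℕ))
      = lam i ^ m * mu i ^ 2 := by
  have hroot : ((vietePoly z.1).map (algebraMap ℝ ℂ)).eval (lam i) = 0 := by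
    rw [vietePoly_eq_prod h, eval_prod]
    exact Finset.prod_eq_zero (Finset.mem_univ i) (by simp)
  -- A zero root would contradict the coprimality of `X ^ m` and `Q` when `m ≥ 1`; this allows the
  -- final division by `λ ^ m`.
  have hne : lam i ≠ 0 ∨ m = 0 := by
    by_contra! hcon
    obtain ⟨a, b, hab⟩ := isCoprime_X_pow z.1 hn hz
    have := congrArg (fun f => (f.map (algebraMap ℝ ℂ)).eval (lam i)) hab
    rw [Polynomial.map_add, Polynomial.map_mul, Polynomial.map_mul, eval_add, eval_mul, eval_mul,
      hroot, hcon.1] at this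
    simp [hcon.2] at this
  have hpow : lam i ^ m ≠ 0 := by
    rcases hne with h | h
    · exact pow_ne_zero _ h
    · rw [h, pow_zero]
      exact one_ne_zero
  have hz1 : ∀ (e : ℤ) (d : ℕ), (m : ℤ) + e = d → lam i ^ m * lam i ^ e = lam i ^ d := by
    intro e d hd
    rcases hne with h | h
    · rw [← zpow_natCast, ← zpow_add₀ h, hd, zpow_natCast]
    · rw [h, Nat.cast_zero, zero_add] at hd
      rw [h, hd, pow_zero, one_mul, zpow_natCast]
  have hsig : ((sigmaPoly n m z.2.2).map (algebraMap ℝ ℂ)).eval (lam i)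
      = lam i ^ m * sigma n m z.2.2 (lam i) := by
    rw [sigma, mul_add, hz1 _ (2 * n + N) (by push_cast; ring), sigmaPoly, Finset.mul_sum]
    simp only [Polynomial.map_add, Polynomial.map_pow, map_X, Polynomial.map_sum,
      Polynomial.map_mul, map_C, eval_add, eval_pow, eval_X, eval_finsetSum, eval_mul, eval_C]
    congr 1
    refine Finset.sum_congr rfl fun j _ => ?_
    rw [mul_left_comm, hz1 _ (if (j : ℕ) < m then (j : ℕ) else n + j)]
    · rfl
    · rw [cExponent]
      split_ifs <;> push_cast <;> ring
  have hham : ((hamPoly m z).map (algebraMap ℝ ℂ)).eval (lam i)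
      = ∑ k : Fin n, (hamiltonian m k z : ℂ) * lam i ^ (n - 1 - (k : ℕ)) := by
    rw [hamPoly, vecPoly_map, vecPoly, eval_finsetSum]
    simp
  obtain ⟨T, hT⟩ := dvd_hamPoly hn m z hz
  have hev := congrArg (fun f => (f.map (algebraMap ℝ ℂ)).eval (lam i)) hT
  simp only [Polynomial.map_sub, Polynomial.map_mul, Polynomial.map_pow, map_X, eval_sub,
    eval_mul, eval_pow, eval_X, hsig, hham, hroot, zero_mul, eval_momentPoly hinj h] at hev
  refine mul_left_cancel₀ hpow ?_
  linear_combination -hev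

end SeparationCurve

end CKdV

end

noncomputable section

namespace CKdV

open Polynomial

/-! ### Smoothness of matrix functions and of the Hamiltonians. -/

section SmoothMatrices

variable {E : Type*} [NormedAddCommGroup E] [NormedSpace ℝ E] {n : ℕ} {s : Set E}

theorem contDiffOn_matrix_mul {A B : E → Matrix (Fin n) (Fin n) ℝ}
    (hA : ∀ i j, ContDiffOn ℝ ∞ (fun z => A z i j) s)
    (hB : ∀ i j, ContDiffOn ℝ ∞ (fun z => B z i j) s) (i j : Fin n) :
    ContDiffOn ℝ ∞ (fun z => (A z * B z) i j) s := by
  simp only [Matrix.mul_apply]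
  exact ContDiffOn.sum fun k _ => (hA i k).mul (hB k j)

theorem contDiffOn_matrix_pow {A : E → Matrix (Fin n) (Fin n) ℝ}
    (hA : ∀ i j, ContDiffOn ℝ ∞ (fun z => A z i j) s) (k : ℕ) (i j : Fin n) :
    ContDiffOn ℝ ∞ (fun z => (A z ^ k) i j) s := by
  induction k generalizing i j with
  | zero =>
    simp only [pow_zero]
    exact contDiffOn_const
  | succ k ih =>
    simp only [pow_succ]
    exact contDiffOn_matrix_mul ih hA i j

theorem contDiffOn_matrix_det {A : E → Matrix (Fin n) (Fin n) ℝ}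
    (hA : ∀ i j, ContDiffOn ℝ ∞ (fun z => A z i j) s) : ContDiffOn ℝ ∞ (fun z => (A z).det) s := by
  simp only [Matrix.det_apply']
  exact ContDiffOn.sum fun σ _ => contDiffOn_const.mul (contDiffOn_prod fun i _ => hA _ _)

theorem contDiffOn_matrix_inv {A : E → Matrix (Fin n) (Fin n) ℝ}
    (hA : ∀ i j, ContDiffOn ℝ ∞ (fun z => A z i j) s) (hdet : ∀ z ∈ s, (A z).det ≠ 0)
    (i j : Fin n) : ContDiffOn ℝ ∞ (fun z => (A z)⁻¹ i j) s := by
  simp only [Matrix.inv_def, Ring.inverse_eq_inv', Matrix.smul_apply, smul_eq_mul,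
    Matrix.adjugate_apply]
  refine ((contDiffOn_matrix_det hA).inv hdet).mul (contDiffOn_matrix_det fun k l => ?_)
  simp only [Matrix.updateRow_apply]
  split_ifs
  · exact contDiffOn_const
  · exact hA k l

theorem contDiffOn_mulVec {A : E → Matrix (Fin n) (Fin n) ℝ} {v : E → Fin n → ℝ}
    (hA : ∀ i j, ContDiffOn ℝ ∞ (fun z => A z i j) s)
    (hv : ∀ i, ContDiffOn ℝ ∞ (fun z => v z i) s) (i : Fin n) :
    ContDiffOn ℝ ∞ (fun z => Matrix.mulVec (A z) (v z) i) s := by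
  simp only [Matrix.mulVec, dotProduct]
  exact ContDiffOn.sum fun j _ => (hA i j).mul (hv j)

end SmoothMatrices

section SmoothHamiltonians

variable {N n m : ℕ} {s : Set (Phase N n)}

theorem contDiff_q (i : Fin n) : ContDiff ℝ ∞ fun z : Phase N n => z.1 i :=
  (contDiff_apply ℝ ℝ i).comp contDiff_fst

theorem contDiff_p (i : Fin n) : ContDiff ℝ ∞ fun z : Phase N n => z.2.1 i :=
  (contDiff_apply ℝ ℝ i).comp (contDiff_fst.comp contDiff_snd)

theorem contDiff_c (i : Fin N) : ContDiff ℝ ∞ fun z : Phase N n => z.2.2 i :=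
  (contDiff_apply ℝ ℝ i).comp (contDiff_snd.comp contDiff_snd)

theorem contDiff_qExt (i : ℤ) : ContDiff ℝ ∞ fun z : Phase N n => qExt z.1 i := by
  unfold qExt
  split_ifs
  · exact contDiff_const
  · refine ContDiff.sum fun j _ => ?_
    split_ifs
    · exact contDiff_q j
    · exact contDiff_const

theorem contDiff_matR (i j : Fin n) : ContDiff ℝ ∞ fun z : Phase N n => matR z.1 i j := by
  simp only [matR, Matrix.of_apply]
  refine ContDiff.add ?_ contDiff_const
  split_ifs
  · exact (contDiff_q i).neg
  · exact contDiff_const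

theorem contDiff_metric (i j : Fin n) : ContDiffOn ℝ ∞ (fun z : Phase N n => metric m z.1 i j) s :=
  contDiffOn_matrix_mul
    (contDiffOn_matrix_pow (fun i j => (contDiff_matR i j).contDiffOn) m)
    (fun i j => by
      simp only [metricZero, Matrix.of_apply]
      exact (contDiff_const.mul (contDiff_qExt _)).contDiffOn) i j

theorem contDiffOn_killing (k i j : Fin n) :
    ContDiffOn ℝ ∞ (fun z : Phase N n => killing z.1 k i j) s := by
  simp only [killing, Matrix.of_apply]
  split_ifs
  · exact (contDiff_qExt _).contDiffOn
  · exact (contDiff_qExt _).neg.contDiffOn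
  · exact contDiffOn_const

/-- A negative exponent `e ≥ -m` forces `m ≥ 1`, and then `R` is invertible on the domain. -/
theorem contDiffOn_elemPotential {e : ℤ} (he : 0 ≤ (m : ℤ) + e) (k : Fin n) :
    ContDiffOn ℝ ∞ (fun z : Phase N n => elemPotential z.1 e k) (phaseDomain N n m) := by
  refine contDiffOn_mulVec (A := fun z : Phase N n => matR z.1 ^ e)
    (v := fun _ i => if (i : ℕ) + 1 = n then -1 else 0) (fun i j => ?_)
    (fun i => contDiffOn_const) k
  obtain ⟨l, rfl | rfl⟩ := e.eq_nat_or_neg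
  · simp only [zpow_natCast]
    exact contDiffOn_matrix_pow (fun i j => (contDiff_matR i j).contDiffOn) l i j
  · rcases Nat.eq_zero_or_pos l with rfl | hl
    · simp only [Nat.cast_zero, neg_zero, zpow_zero]
      exact contDiffOn_const
    · simp only [Matrix.zpow_neg_natCast]
      refine contDiffOn_matrix_inv
        (contDiffOn_matrix_pow (fun i j => (contDiff_matR i j).contDiffOn) l) (fun z hz => ?_) i j
      rcases isUnit_det_matR z.1 hz with hu | h0
      · rw [Matrix.det_pow]
        exact pow_ne_zero _ hu.ne_zero
      · omega

theorem contDiffOn_hamiltonian (hm : m ≤ N) (k : Fin n) :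
    ContDiffOn ℝ ∞ (hamiltonian m k) (phaseDomain N n m) := by
  refine ContDiffOn.add (contDiffOn_const.mul ?_) (ContDiffOn.add ?_ ?_)
  · simp only [dotProduct]
    exact ContDiffOn.sum fun i _ => (contDiff_p i).contDiffOn.mul (contDiffOn_mulVec
      (contDiffOn_matrix_mul (contDiffOn_killing k) contDiff_metric)
      (fun i => (contDiff_p i).contDiffOn) i)
  · exact contDiffOn_elemPotential (by omega) k
  · refine ContDiffOn.sum fun i _ => (contDiff_c i).contDiffOn.mul
      (contDiffOn_elemPotential ?_ k)
    rw [cExponent]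
    split_ifs <;> omega

theorem isOpen_phaseDomain : IsOpen (phaseDomain N n m) := by
  have h : ContDiff ℝ ∞ fun z : Phase N n => (metric m z.1).det :=
    contDiffOn_univ.1 (contDiffOn_matrix_det contDiff_metric)
  exact h.continuous.isOpen_preimage _ isOpen_ne

end SmoothHamiltonians

/-! ### Polynomials with smooth coefficients. -/

section SmoothPolynomials

variable {E : Type*} [NormedAddCommGroup E] [NormedSpace ℝ E] {s : Set E} {F G : E → ℝ[X]}

/-- Polynomial-valued functions of bounded degree with smooth coefficients. -/
def SmoothPoly (s : Set E) (F : E → ℝ[X]) : Prop :=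
  (∃ d, ∀ z, F z ∈ degreeLT ℝ d) ∧ ∀ k, ContDiffOn ℝ ∞ (fun z => (F z).coeff k) s

theorem SmoothPoly.add (hF : SmoothPoly s F) (hG : SmoothPoly s G) :
    SmoothPoly s fun z => F z + G z := by
  obtain ⟨⟨d, hd⟩, hF⟩ := hF
  obtain ⟨⟨e, he⟩, hG⟩ := hG
  refine ⟨⟨d + e, fun z => add_mem (mem_degreeLT_mono (hd z) (by omega))
    (mem_degreeLT_mono (he z) (by omega))⟩, fun k => ?_⟩
  simp only [coeff_add]
  exact (hF k).add (hG k)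

theorem SmoothPoly.mul (hF : SmoothPoly s F) (hG : SmoothPoly s G) :
    SmoothPoly s fun z => F z * G z := by
  obtain ⟨⟨d, hd⟩, hF⟩ := hF
  obtain ⟨⟨e, he⟩, hG⟩ := hG
  refine ⟨⟨d + e, fun z => mul_mem_degreeLT (hd z) (he z) (by omega)⟩, fun k => ?_⟩
  simp only [coeff_mul]
  exact ContDiffOn.sum fun x _ => (hF _).mul (hG _)

theorem smoothPoly_const (f : ℝ[X]) : SmoothPoly s fun _ => f := by
  refine ⟨⟨f.natDegree + 1, fun z => mem_degreeLT_iff_coeff.2 fun k hk => ?_⟩,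
    fun k => contDiffOn_const⟩
  exact coeff_eq_zero_of_natDegree_lt (Nat.lt_of_succ_le hk)

theorem SmoothPoly.sub (hF : SmoothPoly s F) (hG : SmoothPoly s G) :
    SmoothPoly s fun z => F z - G z := by
  have := hF.add ((smoothPoly_const (-1)).mul hG)
  convert this using 2
  ring

theorem smoothPoly_C {f : E → ℝ} (hf : ContDiffOn ℝ ∞ f s) : SmoothPoly s fun z => C (f z) := by
  refine ⟨⟨1, fun z => ?_⟩, fun k => ?_⟩
  · rw [mem_degreeLT_iff_coeff]
    intro k hk
    rw [coeff_C, if_neg (by omega)]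
  · simp only [coeff_C]
    split_ifs
    · exact hf
    · exact contDiffOn_const

theorem smoothPoly_sum {ι : Type*} (t : Finset ι) {F : ι → E → ℝ[X]}
    (hF : ∀ i ∈ t, SmoothPoly s (F i)) : SmoothPoly s fun z => ∑ i ∈ t, F i z := by
  classical
  induction t using Finset.induction_on with
  | empty =>
    simp only [Finset.sum_empty]
    exact smoothPoly_const 0
  | insert a t ha ih =>
    simp only [Finset.sum_insert ha]
    exact (hF a (Finset.mem_insert_self a t)).add
      (ih fun i hi => hF i (Finset.mem_insert_of_mem hi))

theorem SmoothPoly.shiftDown (hF : SmoothPoly s F) (k : ℕ) :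
    SmoothPoly s fun z => shiftDown k (F z) := by
  obtain ⟨⟨d, hd⟩, hF⟩ := hF
  refine ⟨⟨d, fun z => shiftDown_mem (mem_degreeLT_mono (hd z) (by omega))⟩, fun j => ?_⟩
  simp only [coeff_shiftDown]
  exact hF _

/-- The algebra of functions that are smooth on a set. -/
def smoothFunctions (s : Set E) : Subalgebra ℝ (E → ℝ) where
  carrier := {f | ContDiffOn ℝ ∞ f s}
  mul_mem' := fun hf hg => ContDiffOn.mul hf hg
  add_mem' := fun hf hg => ContDiffOn.add hf hg
  algebraMap_mem' := fun _ => contDiffOn_const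

/-- Evaluation of a smooth function at a point. -/
def evalSmooth (s : Set E) (z : E) : smoothFunctions s →+* ℝ :=
  (Pi.evalRingHom (fun _ => ℝ) z).comp (smoothFunctions s).val.toRingHom

theorem SmoothPoly.exists_lift (hF : SmoothPoly s F) :
    ∃ f : (smoothFunctions s)[X], ∀ z, f.map (evalSmooth s z) = F z := by
  obtain ⟨⟨d, hd⟩, hF⟩ := hF
  refine ⟨∑ k ∈ Finset.range d, C ⟨fun z => (F z).coeff k, hF k⟩ * X ^ k, fun z => ?_⟩
  rw [Polynomial.map_sum]
  simp only [Polynomial.map_mul, map_C, Polynomial.map_pow, map_X]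
  ext j
  simp only [finsetSum_coeff, coeff_C_mul_X_pow]
  rw [Finset.sum_ite_eq]
  split_ifs with h
  · rfl
  · rw [mem_degreeLT_iff_coeff.1 (hd z) j (by simpa using h)]

/-- Division by a monic polynomial can be done over the ring of smooth functions and commutes with
evaluation at a point, so the quotient again has smooth coefficients. -/
theorem SmoothPoly.divByMonic {n : ℕ} {q : E → Fin n → ℝ}
    (hq : ∀ i, ContDiffOn ℝ ∞ (fun z => q z i) s)
    (hF : SmoothPoly s F) : SmoothPoly s fun z => F z /ₘ vietePoly (q z) := by
  obtain ⟨f, hf⟩ := hF.exists_lift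
  let qs : Fin n → smoothFunctions s := fun i => ⟨fun z => q z i, hq i⟩
  have hqs : ∀ z, (vietePoly qs).map (evalSmooth s z) = vietePoly (q z) := by
    intro z
    rw [vietePoly_map]
    rfl
  have hdiv : ∀ z, (f /ₘ vietePoly qs).map (evalSmooth s z) = F z /ₘ vietePoly (q z) := by
    intro z
    rw [map_divByMonic _ (vietePoly_monic qs), hf, hqs]
  refine ⟨⟨(f /ₘ vietePoly qs).natDegree + 1, fun z => ?_⟩, fun k => ?_⟩
  · simp only [← hdiv]
    refine sub_mem_map _ (mem_degreeLT_iff_coeff.2 fun k hk => ?_)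
    exact coeff_eq_zero_of_natDegree_lt (by omega)
  · simp only [← hdiv, coeff_map]
    exact ((f /ₘ vietePoly qs).coeff k).2

end SmoothPolynomials

/-! ### Line derivatives of polynomial-valued functions. -/

section LineDerivatives

variable {E : Type*} [NormedAddCommGroup E] [NormedSpace ℝ E] {s : Set E} {F G : E → ℝ[X]}
  {F' G' : ℝ[X]} {z v : E}

/-- The coefficients of `F` have line derivatives given by `F'`. -/
def HasPolyLineDeriv (F : E → ℝ[X]) (F' : ℝ[X]) (z v : E) : Prop :=
  ∀ k, HasLineDerivAt ℝ (fun y => (F y).coeff k) (F'.coeff k) z v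

theorem HasPolyLineDeriv.unique {F₁ : ℝ[X]} (h : HasPolyLineDeriv F F' z v)
    (h₁ : HasPolyLineDeriv F F₁ z v) : F' = F₁ :=
  Polynomial.ext fun k => (h k).unique (h₁ k)

theorem HasPolyLineDeriv.congr (hs : IsOpen s) (hz : z ∈ s) (h : HasPolyLineDeriv F F' z v)
    (hFG : ∀ y ∈ s, G y = F y) : HasPolyLineDeriv G F' z v := fun k =>
  (h k).congr_of_eventuallyEq (Filter.eventuallyEq_of_mem (hs.mem_nhds hz) fun y hy => by
    simp only [hFG y hy])

theorem SmoothPoly.exists_lineDeriv (hF : SmoothPoly s F) (hs : IsOpen s) (hz : z ∈ s) (v : E) :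
    ∃ F', HasPolyLineDeriv F F' z v := by
  obtain ⟨⟨d, hd⟩, hF⟩ := hF
  have h : ∀ k, HasLineDerivAt ℝ (fun y => (F y).coeff k)
      (lineDeriv ℝ (fun y => (F y).coeff k) z v) z v := fun k =>
    ((((hF k).contDiffAt (hs.mem_nhds hz)).differentiableAt
      (by simp)).lineDifferentiableAt).hasLineDerivAt
  refine ⟨∑ k ∈ Finset.range d, C (lineDeriv ℝ (fun y => (F y).coeff k) z v) * X ^ k,
    fun k => ?_⟩
  simp only [finsetSum_coeff, coeff_C_mul_X_pow]
  rw [Finset.sum_ite_eq]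
  split_ifs with hk
  · exact h k
  · have h0 : (fun y => (F y).coeff k) = fun _ => 0 := by
      funext y
      exact mem_degreeLT_iff_coeff.1 (hd y) k (by simpa using hk)
    rw [h0]
    exact hasDerivAt_const _ _

theorem HasPolyLineDeriv.add (hF : HasPolyLineDeriv F F' z v) (hG : HasPolyLineDeriv G G' z v) :
    HasPolyLineDeriv (fun y => F y + G y) (F' + G') z v := by
  intro k
  simp only [coeff_add]
  exact HasDerivAt.add (hF k) (hG k)

theorem HasPolyLineDeriv.sub (hF : HasPolyLineDeriv F F' z v) (hG : HasPolyLineDeriv G G' z v) :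
    HasPolyLineDeriv (fun y => F y - G y) (F' - G') z v := by
  intro k
  simp only [coeff_sub]
  exact HasDerivAt.sub (hF k) (hG k)

theorem HasPolyLineDeriv.mul (hF : HasPolyLineDeriv F F' z v) (hG : HasPolyLineDeriv G G' z v) :
    HasPolyLineDeriv (fun y => F y * G y) (F' * G z + F z * G') z v := by
  intro k
  have h0 : z + (0 : ℝ) • v = z := by rw [zero_smul, add_zero]
  simp only [coeff_mul, coeff_add, ← Finset.sum_add_distrib]
  refine HasDerivAt.fun_sum fun x _ => ?_
  have := HasDerivAt.mul (hF x.1) (hG x.2)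
  simp only [h0] at this
  exact this

theorem hasPolyLineDeriv_const (f : ℝ[X]) : HasPolyLineDeriv (fun _ => f) 0 z v := fun _ =>
  hasDerivAt_const _ _

theorem HasPolyLineDeriv.const_mul (f : ℝ[X]) (hF : HasPolyLineDeriv F F' z v) :
    HasPolyLineDeriv (fun y => f * F y) (f * F') z v := by
  have := (hasPolyLineDeriv_const (z := z) (v := v) f).mul hF
  rwa [zero_mul, zero_add] at this

theorem HasPolyLineDeriv.sum {ι : Type*} (t : Finset ι) {F : ι → E → ℝ[X]} {F' : ι → ℝ[X]}
    (hF : ∀ i ∈ t, HasPolyLineDeriv (F i) (F' i) z v) :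
    HasPolyLineDeriv (fun y => ∑ i ∈ t, F i y) (∑ i ∈ t, F' i) z v := by
  intro k
  simp only [finsetSum_coeff]
  exact HasDerivAt.fun_sum fun i hi => hF i hi k

theorem hasPolyLineDeriv_C {f : E → ℝ} {f' : ℝ} (hf : HasLineDerivAt ℝ f f' z v) :
    HasPolyLineDeriv (fun y => C (f y)) (C f') z v := by
  intro k
  simp only [coeff_C]
  split_ifs
  · exact hf
  · exact hasDerivAt_const _ _

theorem HasPolyLineDeriv.shiftDown (hF : HasPolyLineDeriv F F' z v) (k : ℕ) :
    HasPolyLineDeriv (fun y => CKdV.shiftDown k (F y)) (CKdV.shiftDown k F') z v := by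
  intro j
  simp only [coeff_shiftDown]
  exact hF _

theorem HasPolyLineDeriv.mem {d : ℕ} (hF : HasPolyLineDeriv F F' z v)
    (hd : ∀ y, F y ∈ degreeLT ℝ d) : F' ∈ degreeLT ℝ d := by
  rw [mem_degreeLT_iff_coeff]
  intro k hk
  have h := hF k
  simp only [fun y => mem_degreeLT_iff_coeff.1 (hd y) k hk] at h
  exact h.unique (hasDerivAt_const _ _)

end LineDerivatives

end CKdV

end

noncomputable section

namespace CKdV

open Polynomial

/-! ### The Mumford triple of a point of the phase space. -/

section PhasePolynomials

variable {N n m : ℕ}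

/-- The polynomial `∑ p_j (λ^(j-1) + … + q_(j-1))`. -/
def phasePi (z : Phase N n) : ℝ[X] := momentPoly (vietePoly z.1) z.2.1

/-- The polynomial with coefficients `G_m p`. -/
def phaseV (m : ℕ) (z : Phase N n) : ℝ[X] := vecPoly (Matrix.mulVec (metric m z.1) z.2.1)

/-- The spectral polynomial of a point of the phase space. -/
def phaseS (m : ℕ) (z : Phase N n) : ℝ[X] := sigmaPoly n m z.2.2 + X ^ m * hamPoly m z

/-- The third entry of the Mumford triple of a point of the phase space. -/
def phaseW (m : ℕ) (z : Phase N n) : ℝ[X] :=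
  (quarter * phaseV m z ^ 2 - phaseS m z) /ₘ vietePoly z.1

/-- The quotient in the congruence that defines the Hamiltonians. -/
def phaseT (m : ℕ) (z : Phase N n) : ℝ[X] :=
  (X ^ (2 * m) * phasePi z ^ 2 - sigmaPoly n m z.2.2 - X ^ m * hamPoly m z) /ₘ vietePoly z.1

/-- The quotient in the congruence between `phaseV` and `2 X ^ m phasePi`. -/
def phaseZ (m : ℕ) (z : Phase N n) : ℝ[X] :=
  (2 * X ^ m * phasePi z - phaseV m z) /ₘ vietePoly z.1

theorem mul_divByMonic_of_dvd {A : Type*} [CommRing A] {f g : A[X]} (hg : g.Monic) (h : g ∣ f) :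
    g * (f /ₘ g) = f := by
  obtain ⟨k, rfl⟩ := h
  rw [mul_divByMonic_cancel_left _ hg]

theorem mul_phaseZ (hn : 1 ≤ n) (z : Phase N n) :
    vietePoly z.1 * phaseZ m z = 2 * X ^ m * phasePi z - phaseV m z :=
  mul_divByMonic_of_dvd (vietePoly_monic _) (dvd_vecPoly_metric z.1 hn m z.2.1)

theorem mul_phaseT (hn : 1 ≤ n) {z : Phase N n} (hz : z ∈ phaseDomain N n m) :
    vietePoly z.1 * phaseT m z
      = X ^ (2 * m) * phasePi z ^ 2 - sigmaPoly n m z.2.2 - X ^ m * hamPoly m z :=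
  mul_divByMonic_of_dvd (vietePoly_monic _) (dvd_hamPoly hn m z hz)

/-- Substitute `V = 2 X ^ m Π - Q Z` into `V² / 4`: the square `X ^ (2m) Π²` is `S + Q T` by the
congruence for the Hamiltonians, and all other terms contain `Q`. -/
theorem phaseW_aux (hn : 1 ≤ n) {z : Phase N n} (hz : z ∈ phaseDomain N n m) :
    quarter * phaseV m z ^ 2 - phaseS m z = vietePoly z.1 *
      (phaseT m z - X ^ m * phasePi z * phaseZ m z + quarter * vietePoly z.1 * phaseZ m z ^ 2) := by
  have hT := mul_phaseT hn hz
  have hZ := mul_phaseZ (m := m) hn z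
  have hq := four_mul_quarter (A := ℝ)
  have hV : phaseV m z = 2 * X ^ m * phasePi z - vietePoly z.1 * phaseZ m z := by
    linear_combination hZ
  rw [hV, phaseS]
  linear_combination -hT + (X ^ m * phasePi z * (X ^ m * phasePi z - vietePoly z.1 * phaseZ m z)) * hq

theorem phaseW_eq (hn : 1 ≤ n) {z : Phase N n} (hz : z ∈ phaseDomain N n m) :
    phaseW m z = phaseT m z - X ^ m * phasePi z * phaseZ m z
      + quarter * vietePoly z.1 * phaseZ m z ^ 2 := by
  rw [phaseW, phaseW_aux hn hz, mul_divByMonic_cancel_left _ (vietePoly_monic _)]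

theorem mul_phaseW (hn : 1 ≤ n) {z : Phase N n} (hz : z ∈ phaseDomain N n m) :
    vietePoly z.1 * phaseW m z = quarter * phaseV m z ^ 2 - phaseS m z := by
  rw [phaseW_eq hn hz, phaseW_aux hn hz]

theorem phaseV_mem (z : Phase N n) : phaseV m z ∈ degreeLT ℝ n := vecPoly_mem _

theorem hamPoly_mem (z : Phase N n) : hamPoly m z ∈ degreeLT ℝ n := vecPoly_mem _

theorem sigmaPoly_mem (c : Fin N → ℝ) :
    sigmaPoly n m c - X ^ (2 * n + N) ∈ degreeLT ℝ (n + N) := by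
  rw [sigmaPoly, add_sub_cancel_left]
  refine sum_mem fun i _ => C_mul_mem_degreeLT _ (X_pow_mem_degreeLT ?_)
  split_ifs <;> omega

theorem phaseS_mem (hm : m ≤ N) (z : Phase N n) :
    phaseS m z - X ^ (2 * n + N) ∈ degreeLT ℝ (n + N) := by
  have h1 := mul_mem_degreeLT (c := n + N) (X_pow_mem_degreeLT (A := ℝ) m.lt_succ_self)
    (hamPoly_mem (m := m) z) (by omega)
  convert add_mem (sigmaPoly_mem (n := n) (m := m) z.2.2) h1 using 1
  rw [phaseS]
  ring

section Smooth

variable {s : Set (Phase N n)}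

theorem smoothPoly_vecPoly {v : Phase N n → Fin n → ℝ}
    (hv : ∀ i, ContDiffOn ℝ ∞ (fun z => v z i) s) : SmoothPoly s fun z => vecPoly (v z) :=
  smoothPoly_sum _ fun i _ => (smoothPoly_C (hv i)).mul (smoothPoly_const _)

theorem smoothPoly_vietePoly : SmoothPoly s fun z : Phase N n => vietePoly z.1 :=
  (smoothPoly_const _).add (smoothPoly_vecPoly fun i => (contDiff_q i).contDiffOn)

theorem smoothPoly_phasePi : SmoothPoly s (phasePi : Phase N n → ℝ[X]) := by
  unfold phasePi momentPoly
  exact smoothPoly_sum _ fun i _ =>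
    (smoothPoly_C (contDiff_p i).contDiffOn).mul (smoothPoly_vietePoly.shiftDown _)

theorem smoothPoly_phaseV : SmoothPoly s (phaseV m : Phase N n → ℝ[X]) :=
  smoothPoly_vecPoly (contDiffOn_mulVec contDiff_metric fun i => (contDiff_p i).contDiffOn)

theorem smoothPoly_hamPoly (hm : m ≤ N) :
    SmoothPoly (phaseDomain N n m) (hamPoly m : Phase N n → ℝ[X]) :=
  smoothPoly_vecPoly fun k => contDiffOn_hamiltonian hm k

theorem smoothPoly_sigmaPoly : SmoothPoly s fun z : Phase N n => sigmaPoly n m z.2.2 :=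
  (smoothPoly_const _).add (smoothPoly_sum _ fun i _ =>
    (smoothPoly_C (contDiff_c i).contDiffOn).mul (smoothPoly_const _))

theorem smoothPoly_phaseW (hm : m ≤ N) :
    SmoothPoly (phaseDomain N n m) (phaseW m : Phase N n → ℝ[X]) := by
  refine SmoothPoly.divByMonic (fun i => (contDiff_q i).contDiffOn) (SmoothPoly.sub
    ((smoothPoly_const _).mul ?_) (smoothPoly_sigmaPoly.add ((smoothPoly_const _).mul
    (smoothPoly_hamPoly hm))))
  simp only [pow_two]
  exact smoothPoly_phaseV.mul smoothPoly_phaseV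

theorem smoothPoly_phaseT (hm : m ≤ N) :
    SmoothPoly (phaseDomain N n m) (phaseT m : Phase N n → ℝ[X]) := by
  refine SmoothPoly.divByMonic (fun i => (contDiff_q i).contDiffOn) (SmoothPoly.sub (SmoothPoly.sub
    ((smoothPoly_const _).mul ?_) smoothPoly_sigmaPoly) ((smoothPoly_const _).mul
    (smoothPoly_hamPoly hm)))
  simp only [pow_two]
  exact smoothPoly_phasePi.mul smoothPoly_phasePi

theorem smoothPoly_phaseZ : SmoothPoly s (phaseZ m : Phase N n → ℝ[X]) :=
  SmoothPoly.divByMonic (fun i => (contDiff_q i).contDiffOn)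
    (((smoothPoly_const _).mul smoothPoly_phasePi).sub smoothPoly_phaseV)

end Smooth

end PhasePolynomials

/-! ### Hamilton's equations in polynomial form. -/

section Directional

variable {N n m : ℕ} {z : Phase N n} {a b : Fin n → ℝ}

theorem hasPolyLineDeriv_vietePoly :
    HasPolyLineDeriv (fun y : Phase N n => vietePoly y.1) (vecPoly a) z (a, b, 0) := by
  have h : HasPolyLineDeriv (fun y : Phase N n => vietePoly y.1)
      (0 + ∑ i : Fin n, (C (a i) * X ^ (n - 1 - (i : ℕ)) + C (z.1 i) * 0)) z (a, b, 0) := by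
    refine (hasPolyLineDeriv_const _).add (HasPolyLineDeriv.sum _ fun i _ =>
      (hasPolyLineDeriv_C ?_).mul (hasPolyLineDeriv_const _))
    have := ((hasDerivAt_id (0 : ℝ)).mul_const (a i)).const_add (z.1 i)
    rw [one_mul] at this
    exact this
  simpa [vecPoly] using h

theorem hasPolyLineDeriv_phasePi : HasPolyLineDeriv (phasePi : Phase N n → ℝ[X])
    (momentPoly (vietePoly z.1) b + momentPoly (vecPoly a) z.2.1) z (a, b, 0) := by
  have h : HasPolyLineDeriv (phasePi : Phase N n → ℝ[X])
      (∑ j : Fin n, (C (b j) * shiftDown (n - 1 - j + 1) (vietePoly z.1)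
        + C (z.2.1 j) * shiftDown (n - 1 - j + 1) (vecPoly a))) z (a, b, 0) := by
    unfold phasePi momentPoly
    refine HasPolyLineDeriv.sum _ fun i _ =>
      (hasPolyLineDeriv_C ?_).mul (hasPolyLineDeriv_vietePoly.shiftDown _)
    have := ((hasDerivAt_id (0 : ℝ)).mul_const (b i)).const_add (z.2.1 i)
    rw [one_mul] at this
    exact this
  rwa [Finset.sum_add_distrib] at h

theorem hasPolyLineDeriv_sigmaPoly :
    HasPolyLineDeriv (fun y : Phase N n => sigmaPoly n m y.2.2) 0 z (a, b, 0) := by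
  intro k
  have : (fun t : ℝ => (sigmaPoly n m (z + t • ((a, b, 0) : Phase N n)).2.2).coeff k)
      = fun _ => (sigmaPoly n m z.2.2).coeff k := by
    funext t
    simp
  change HasDerivAt _ _ _
  rw [this]
  exact hasDerivAt_const _ _

/-- The derivative of the congruence that defines the Hamiltonians. -/
theorem exists_hamPoly_deriv (hn : 1 ≤ n) (hm : m ≤ N) (hz : z ∈ phaseDomain N n m)
    (a b : Fin n → ℝ) : ∃ H' ∈ degreeLT ℝ n,
      HasPolyLineDeriv (hamPoly m : Phase N n → ℝ[X]) H' z (a, b, 0) ∧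
      vietePoly z.1 ∣ X ^ m * H' - (2 * X ^ (2 * m) * phasePi z *
        (momentPoly (vietePoly z.1) b + momentPoly (vecPoly a) z.2.1) - vecPoly a * phaseT m z) := by
  obtain ⟨H', hH⟩ := (smoothPoly_hamPoly hm).exists_lineDeriv isOpen_phaseDomain hz (a, b, 0)
  obtain ⟨T', hT⟩ := (smoothPoly_phaseT hm).exists_lineDeriv isOpen_phaseDomain hz (a, b, 0)
  refine ⟨H', hH.mem hamPoly_mem, hH, ?_⟩
  have h1 := (hasPolyLineDeriv_vietePoly (b := b)).mul hT
  have h2 := ((((hasPolyLineDeriv_phasePi (z := z) (a := a) (b := b)).mul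
    hasPolyLineDeriv_phasePi).const_mul (X ^ (2 * m))).sub
    (hasPolyLineDeriv_sigmaPoly (m := m))).sub (hH.const_mul (X ^ m))
  have h3 := h1.unique (h2.congr isOpen_phaseDomain hz fun y hy => by
    rw [mul_phaseT hn hy]
    ring)
  refine ⟨-T', ?_⟩
  linear_combination h3

/-- The derivative of a Hamiltonian in a direction of the phase space, as a residue. -/
theorem hamiltonian_deriv (hn : 1 ≤ n) (hm : m ≤ N) (hz : z ∈ phaseDomain N n m)
    (a b : Fin n → ℝ) (r : Fin n) {f : ℝ[X]} (hf : vietePoly z.1 ∣ X ^ m * f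
      - (2 * X ^ (2 * m) * phasePi z * (momentPoly (vietePoly z.1) b
        + momentPoly (vecPoly a) z.2.1) - vecPoly a * phaseT m z)) :
    HasLineDerivAt ℝ (hamiltonian m r)
      (residue n (vietePoly z.1) (shiftDown (n - 1 - r + 1) (vietePoly z.1) * f)) z (a, b, 0) := by
  obtain ⟨H', hmem, hH, hdvd⟩ := exists_hamPoly_deriv hn hm hz a b
  have h1 := hH (n - 1 - r)
  simp only [hamPoly, coeff_vecPoly] at h1
  suffices h : residue n (vietePoly z.1) (shiftDown (n - 1 - r + 1) (vietePoly z.1) * f)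
      = H'.coeff (n - 1 - r) by
    rw [h]
    exact h1
  rw [← residue_shiftDown_mul (vietePoly_sub_mem z.1) (by omega) hmem]
  refine residue_congr (vietePoly_sub_mem z.1) ?_
  rw [← mul_sub]
  refine Dvd.dvd.mul_left ?_ _
  -- Both `f` and `H'` are known modulo `Q` only after multiplication by `X ^ m`, which can be
  -- cancelled.
  refine (isCoprime_X_pow z.1 hn hz).symm.dvd_of_dvd_mul_left ?_
  rw [mul_sub]
  convert dvd_sub hf hdvd using 1
  ring

/-- Partial derivatives in one block of variables are line derivatives in the whole phase space,
where the polynomial identities are differentiated. -/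
theorem fderiv_single_eq {E F : Type*} [NormedAddCommGroup E] [NormedSpace ℝ E]
    [NormedAddCommGroup F] [NormedSpace ℝ F] {s : Set F} (hs : IsOpen s) {h : F → ℝ}
    (hh : ContDiffOn ℝ ∞ h s) {g : E → F} (hg : ContDiff ℝ ∞ g) {x v : E} {w : F} (hx : g x ∈ s)
    (hv : ∀ t : ℝ, g (x + t • v) = g x + t • w) {d : ℝ} (hd : HasLineDerivAt ℝ h d (g x) w) :
    fderiv ℝ (fun y => h (g y)) x v = d := by
  have h1 : DifferentiableAt ℝ (fun y => h (g y)) x :=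
    (((hh.contDiffAt (hs.mem_nhds hx)).differentiableAt (by simp))).comp x
      (hg.differentiable (by simp) x)
  have h2 := h1.hasFDerivAt.hasLineDerivAt v
  refine h2.unique ?_
  change HasDerivAt (fun t : ℝ => h (g (x + t • v))) d 0
  simp only [hv]
  exact hd

theorem momentPoly_single {A : Type*} [CommRing A] (Q : A[X]) (i : Fin n) :
    momentPoly Q (Pi.single i 1) = shiftDown (n - 1 - i + 1) Q := by
  rw [momentPoly, Finset.sum_eq_single i]
  · simp
  · intro j _ hj
    rw [Pi.single_eq_of_ne hj, C_0, zero_mul]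
  · simp

theorem momentPoly_zero {A : Type*} [CommRing A] (Q : A[X]) :
    momentPoly Q (0 : Fin n → A) = 0 := by
  simp [momentPoly]

theorem vecPoly_zero {A : Type*} [CommRing A] : vecPoly (0 : Fin n → A) = 0 := by
  simp [vecPoly]

theorem vecPoly_single {A : Type*} [CommRing A] (i : Fin n) :
    vecPoly (Pi.single i (1 : A)) = X ^ (n - 1 - (i : ℕ)) := by
  rw [vecPoly, Finset.sum_eq_single i]
  · simp
  · intro j _ hj
    rw [Pi.single_eq_of_ne hj, C_0, zero_mul]
  · simp

theorem momentPoly_zero_left {A : Type*} [CommRing A] (p : Fin n → A) :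
    momentPoly (0 : A[X]) p = 0 := by
  rw [momentPoly]
  refine Finset.sum_eq_zero fun j _ => ?_
  rw [show shiftDown (n - 1 - (j : ℕ) + 1) (0 : A[X]) = 0 from shiftDown_eq_zero (zero_mem _),
    mul_zero]

variable {r : Fin n}

/-- Moving `p_i` changes `Π` by the dual basis element of its monomial, so `∂H_r/∂p_i` is a residue
that reads off a coefficient of `Q₊ V - Q V₊`. -/
theorem stackelFlow_fst (hn : 1 ≤ n) (hm : m ≤ N) (hz : z ∈ phaseDomain N n m) :
    vecPoly (stackelFlow m r z).1 = shiftWr (n - r) (vietePoly z.1) (phaseV m z) := by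
  have hQ := vietePoly_sub_mem z.1
  have hwr : shiftWr (n - r) (vietePoly z.1) (phaseV m z) ∈ degreeLT ℝ n :=
    shiftWr_mem (by omega) (mem_degreeLT_of_sub hQ) (phaseV_mem z)
  refine ext_of_mem (vecPoly_mem _) hwr fun i => ?_
  rw [coeff_vecPoly]
  have hd := hamiltonian_deriv hn hm hz 0 (Pi.single i 1) r
    (f := 2 * X ^ m * phasePi z * shiftDown (n - 1 - i + 1) (vietePoly z.1))
    ⟨0, by rw [momentPoly_single, vecPoly_zero, momentPoly_zero_left]; ring⟩
  have h1 := fderiv_single_eq isOpen_phaseDomain (contDiffOn_hamiltonian hm r)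
    (g := fun p : Fin n → ℝ => ((z.1, p, z.2.2) : Phase N n)) (x := z.2.1) (v := Pi.single i 1)
    (w := (0, Pi.single i 1, 0))
    (contDiff_const.prodMk (contDiff_id.prodMk contDiff_const)) hz
    (fun t => Prod.ext (by simp) (Prod.ext (by simp) (by simp))) hd
  refine h1.trans ?_
  rw [← residue_shiftDown_mul hQ (by omega) hwr]
  refine residue_congr hQ ?_
  have hZ := mul_phaseZ (m := m) hn z
  rw [show n - 1 - (r : ℕ) + 1 = n - r by omega, shiftWr]
  refine ⟨shiftDown (n - r) (vietePoly z.1) * shiftDown (n - 1 - i + 1) (vietePoly z.1)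
    * phaseZ m z + shiftDown (n - 1 - i + 1) (vietePoly z.1) * shiftDown (n - r) (phaseV m z), ?_⟩
  linear_combination (-shiftDown (n - r) (vietePoly z.1)
    * shiftDown (n - 1 - i + 1) (vietePoly z.1)) * hZ

/-- The polynomial `u` plays the role of `X ^ (-m)` modulo `Q`. Moving `q_i` changes `Q` by a
monomial, and `residue_shiftDown_symm` moves the truncation from this monomial onto `Q'`, so that
the whole expression becomes a pairing with the monomial. -/
theorem stackelFlow_snd (hn : 1 ≤ n) (hm : m ≤ N) (hz : z ∈ phaseDomain N n m) {u : ℝ[X]}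
    (hu : vietePoly z.1 ∣ u * X ^ m - 1) (i : Fin n) :
    (stackelFlow m r z).2.1 i = residue n (vietePoly z.1)
      ((shiftDown (n - r) (vietePoly z.1) * u * phaseT m z
        - momentPoly (vecPoly (stackelFlow m r z).1) z.2.1) * X ^ (n - 1 - (i : ℕ))) := by
  have hQ := vietePoly_sub_mem z.1
  have hX : (X ^ (n - 1 - (i : ℕ)) : ℝ[X]) ∈ degreeLT ℝ n := X_pow_mem_degreeLT (by omega)
  obtain ⟨g, hg⟩ := hu
  have hd := hamiltonian_deriv hn hm hz (Pi.single i 1) 0 r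
    (f := 2 * X ^ m * phasePi z * momentPoly (X ^ (n - 1 - (i : ℕ))) z.2.1
      - u * X ^ (n - 1 - (i : ℕ)) * phaseT m z)
    ⟨-g * X ^ (n - 1 - (i : ℕ)) * phaseT m z, by
      rw [momentPoly_zero, vecPoly_single]
      linear_combination (-X ^ (n - 1 - (i : ℕ)) * phaseT m z) * hg⟩
  have h1 := fderiv_single_eq isOpen_phaseDomain (contDiffOn_hamiltonian hm r)
    (g := fun q : Fin n → ℝ => ((q, z.2.1, z.2.2) : Phase N n)) (x := z.1) (v := Pi.single i 1)
    (w := (Pi.single i 1, 0, 0))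
    (contDiff_id.prodMk contDiff_const) hz
    (fun t => Prod.ext (by simp) (Prod.ext (by simp) (by simp))) hd
  refine (congrArg Neg.neg h1).trans ?_
  have hF := stackelFlow_fst (r := r) hn hm hz
  have hwr : vecPoly (stackelFlow m r z).1 ∈ degreeLT ℝ n := vecPoly_mem _
  have hsym : residue n (vietePoly z.1)
      (vecPoly (stackelFlow m r z).1 * momentPoly (X ^ (n - 1 - (i : ℕ))) z.2.1)
      = residue n (vietePoly z.1)
        (momentPoly (vecPoly (stackelFlow m r z).1) z.2.1 * X ^ (n - 1 - (i : ℕ))) := by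
    rw [momentPoly, momentPoly, Finset.mul_sum, Finset.sum_mul, residue_sum, residue_sum]
    refine Finset.sum_congr rfl fun j _ => ?_
    rw [mul_left_comm, mul_assoc, residue_C_mul, residue_C_mul,
      residue_shiftDown_symm hQ hn (by omega) hwr hX]
  have hZ := mul_phaseZ (m := m) hn z
  have h2 : residue n (vietePoly z.1) (shiftDown (n - 1 - r + 1) (vietePoly z.1) *
      (2 * X ^ m * phasePi z * momentPoly (X ^ (n - 1 - (i : ℕ))) z.2.1
      - u * X ^ (n - 1 - (i : ℕ)) * phaseT m z))
      = residue n (vietePoly z.1)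
        (vecPoly (stackelFlow m r z).1 * momentPoly (X ^ (n - 1 - (i : ℕ))) z.2.1
        - shiftDown (n - r) (vietePoly z.1) * u * phaseT m z * X ^ (n - 1 - (i : ℕ))) := by
    refine residue_congr hQ ?_
    rw [show n - 1 - (r : ℕ) + 1 = n - r by omega, hF, shiftWr]
    refine ⟨shiftDown (n - r) (vietePoly z.1) * momentPoly (X ^ (n - 1 - (i : ℕ))) z.2.1
      * phaseZ m z + momentPoly (X ^ (n - 1 - (i : ℕ))) z.2.1
        * shiftDown (n - r) (phaseV m z), ?_⟩
    linear_combination (-shiftDown (n - r) (vietePoly z.1)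
      * momentPoly (X ^ (n - 1 - (i : ℕ))) z.2.1) * hZ
  rw [h2, residue_sub, hsym, sub_mul, residue_sub]
  ring

/-- The derivative of `phasePi` along a Stäckel flow. -/
theorem exists_phasePi_deriv (hn : 1 ≤ n) (hm : m ≤ N) (hz : z ∈ phaseDomain N n m) :
    ∃ M' : ℝ[X], HasPolyLineDeriv (phasePi : Phase N n → ℝ[X]) M' z (stackelFlow m r z) ∧
      vietePoly z.1 ∣ X ^ m * M' - shiftDown (n - r) (vietePoly z.1) * phaseT m z := by
  have hQ := vietePoly_sub_mem z.1
  obtain ⟨u, w, huw⟩ := isCoprime_X_pow z.1 hn hz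
  have hu : vietePoly z.1 ∣ u * X ^ m - 1 := ⟨-w, by linear_combination huw⟩
  refine ⟨momentPoly (vietePoly z.1) (stackelFlow m r z).2.1
    + momentPoly (vecPoly (stackelFlow m r z).1) z.2.1, hasPolyLineDeriv_phasePi, ?_⟩
  generalize hG : shiftDown (n - r) (vietePoly z.1) * u * phaseT m z
    - momentPoly (vecPoly (stackelFlow m r z).1) z.2.1 = G
  -- The numbers `p'_i` are the pairings of `G` with the monomials, and these determine `G` modulo
  -- `Q`.
  have hp : momentPoly (vietePoly z.1) (stackelFlow m r z).2.1 = G %ₘ vietePoly z.1 := by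
    rw [← momentPoly_residue hQ (modByMonic_mem hQ G)]
    congr 1
    funext i
    rw [stackelFlow_snd hn hm hz hu, hG]
    refine residue_congr hQ ⟨G /ₘ vietePoly z.1 * X ^ (n - 1 - (i : ℕ)), ?_⟩
    linear_combination (-X ^ (n - 1 - (i : ℕ))) * modByMonic_add_div G (vietePoly z.1)
  obtain ⟨g, hg⟩ := hu
  refine ⟨g * shiftDown (n - r) (vietePoly z.1) * phaseT m z
    - X ^ m * (G /ₘ vietePoly z.1), ?_⟩
  rw [hp]
  linear_combination (X ^ m) * modByMonic_add_div G (vietePoly z.1) - X ^ m * hG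
    + shiftDown (n - r) (vietePoly z.1) * phaseT m z * hg

theorem hasPolyLineDeriv_flow_Q (hn : 1 ≤ n) (hm : m ≤ N) (hz : z ∈ phaseDomain N n m) :
    HasPolyLineDeriv (fun y : Phase N n => vietePoly y.1)
      (shiftWr (n - r) (vietePoly z.1) (phaseV m z)) z (stackelFlow m r z) := by
  rw [← stackelFlow_fst hn hm hz]
  exact hasPolyLineDeriv_vietePoly

/-- Differentiating `Q Z = 2 X ^ m Π - V` gives `V' ≡ 2 Q₊ T - Q₊ V Z` modulo `Q`. This is `2 Q₊ W`,
since `W ≡ T - X ^ m Π Z` and `2 X ^ m Π ≡ V`. Two polynomials of degree `< n` that agree modulo `Q`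
are equal. -/
theorem hasPolyLineDeriv_flow_V (hn : 1 ≤ n) (hm : m ≤ N) (hz : z ∈ phaseDomain N n m) :
    HasPolyLineDeriv (phaseV m : Phase N n → ℝ[X])
      (2 * shiftWr (n - r) (vietePoly z.1) (phaseW m z %ₘ vietePoly z.1)) z
      (stackelFlow m r z) := by
  have hQ := vietePoly_sub_mem z.1
  obtain ⟨V', hV⟩ := (smoothPoly_phaseV (m := m) (s := phaseDomain N n m)).exists_lineDeriv
    isOpen_phaseDomain hz (stackelFlow m r z)
  obtain ⟨Z', hZ'⟩ := (smoothPoly_phaseZ (m := m) (s := phaseDomain N n m)).exists_lineDeriv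
    isOpen_phaseDomain hz (stackelFlow m r z)
  obtain ⟨M', hM, g, hg⟩ := exists_phasePi_deriv (r := r) hn hm hz
  have hwr := shiftWr_mem (k := n - r) (by omega) (mem_degreeLT_of_sub hQ)
    (modByMonic_mem hQ (phaseW m z))
  have hmem : V' - 2 * shiftWr (n - r) (vietePoly z.1) (phaseW m z %ₘ vietePoly z.1)
      ∈ degreeLT ℝ n := by
    rw [two_mul]
    exact sub_mem (hV.mem phaseV_mem) (add_mem hwr hwr)
  have h1 := (hasPolyLineDeriv_flow_Q (r := r) hn hm hz).mul hZ'
  have h2 := (hM.const_mul (2 * X ^ m)).sub hV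
  have h3 := h1.unique (h2.congr isOpen_phaseDomain hz fun y _ => mul_phaseZ hn y)
  have hZ := mul_phaseZ (m := m) hn z
  have hW := phaseW_eq hn hz
  have hdiv := modByMonic_add_div (phaseW m z) (vietePoly z.1)
  have h0 := eq_zero_of_dvd_of_mem hQ hmem (by
    rw [shiftWr] at h3 ⊢
    refine ⟨2 * g - Z' + shiftDown (n - r) (phaseV m z) * phaseZ m z
      + 2 * shiftDown (n - r) (vietePoly z.1) * (phaseW m z /ₘ vietePoly z.1)
      + 2 * shiftDown (n - r) (phaseW m z %ₘ vietePoly z.1)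
      + shiftDown (n - r) (vietePoly z.1) * phaseZ m z ^ 2
      - 2 * quarter * shiftDown (n - r) (vietePoly z.1) * phaseZ m z ^ 2, ?_⟩
    linear_combination h3 + 2 * hg
      - 2 * shiftDown (n - r) (vietePoly z.1) * (hdiv + hW)
      - shiftDown (n - r) (vietePoly z.1) * phaseZ m z * hZ)
  rw [sub_eq_zero] at h0
  rwa [h0] at hV

/-- Differentiating `Q W = V² / 4 - S` gives `X ^ m H' = Q (flowW - W')`. Since `H'` has degree `<
n` and `X ^ m` is coprime to `Q`, it vanishes: conservation of all Hamiltonians and the evolution of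
`W` come out together. -/
theorem hasPolyLineDeriv_flow_W (hn : 1 ≤ n) (hm : m ≤ N) (hz : z ∈ phaseDomain N n m) :
    HasPolyLineDeriv (phaseW m : Phase N n → ℝ[X])
      (flowW (n - r) (vietePoly z.1) (phaseV m z) (phaseW m z)) z (stackelFlow m r z) := by
  have hQ := vietePoly_sub_mem z.1
  have hDQ := hasPolyLineDeriv_flow_Q (r := r) hn hm hz
  have hDV := hasPolyLineDeriv_flow_V (r := r) hn hm hz
  obtain ⟨W', hDW⟩ := (smoothPoly_phaseW hm).exists_lineDeriv
    isOpen_phaseDomain hz (stackelFlow m r z)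
  obtain ⟨H', hDH⟩ := (smoothPoly_hamPoly hm).exists_lineDeriv
    isOpen_phaseDomain hz (stackelFlow m r z)
  have h1 := hDQ.mul hDW
  have h2 := ((hDV.mul hDV).const_mul quarter).sub
    ((hasPolyLineDeriv_sigmaPoly (m := m)).add (hDH.const_mul (X ^ m)))
  have h3 := h1.unique (h2.congr isOpen_phaseDomain hz fun y hy => by
    rw [mul_phaseW hn hy, phaseS]
    ring)
  have hfl := mul_flowW (n - r) (vietePoly z.1) (phaseV m z) (phaseW m z)
  have hq := four_mul_quarter (A := ℝ)
  have h4 : X ^ m * H' = vietePoly z.1 *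
      (flowW (n - r) (vietePoly z.1) (phaseV m z) (phaseW m z) - W') := by
    linear_combination -hfl + h3 + (phaseV m z
      * shiftWr (n - r) (vietePoly z.1) (phaseW m z %ₘ vietePoly z.1)) * hq
  have hH0 : H' = 0 := eq_zero_of_dvd_of_mem hQ (hDH.mem hamPoly_mem)
    ((isCoprime_X_pow z.1 hn hz).symm.dvd_of_dvd_mul_left ⟨_, h4⟩)
  rw [hH0, mul_zero] at h4
  have h5 := eq_zero_of_mul_mem hQ (f := flowW (n - r) (vietePoly z.1) (phaseV m z) (phaseW m z)
    - W') (by rw [← h4]; exact zero_mem _)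
  rw [sub_eq_zero] at h5
  rwa [h5]

end Directional

end CKdV

end

noncomputable section

namespace CKdV

open Polynomial

/-! ### The jet of a phase point, and the correspondence of the two systems. -/

variable {N n m : ℕ}

/-- The coordinates of the Mumford triple of a point of the phase space. -/
def tripleCoords (m : ℕ) (z : Phase N n) : Fin n ⊕ Fin n ⊕ Fin N → ℝ :=
  Sum.elim z.1 (Sum.elim (Matrix.mulVec (metric m z.1) z.2.1) fun j => (phaseW m z).coeff j)

/-- Evaluation of functions of Mumford triples at a point of the phase space. -/
def evalTriple (m : ℕ) (z : Phase N n) : TripleRing n N →ₐ[ℝ] ℝ :=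
  MvPolynomial.aeval (tripleCoords m z)

/-- The jet of a point of the phase space. -/
def jetOf (m : ℕ) (z : Phase N n) : Jet N :=
  fun a => evalTriple m z (toTriple N n (MvPolynomial.X a))

theorem val_jetOf (z : Phase N n) (f : DiffPoly N) :
    val (jetOf m z) f = evalTriple m z (toTriple N n f) := by
  have h : MvPolynomial.aeval (jetOf m z) = (evalTriple m z).comp (toTriple N n) :=
    MvPolynomial.algHom_ext fun a => by
      rw [MvPolynomial.aeval_X]
      rfl
  have := DFunLike.congr_fun h f
  rwa [MvPolynomial.aeval_eq_eval] at this

theorem evalTriple_X (z : Phase N n) (s : Fin n ⊕ Fin n ⊕ Fin N) :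
    evalTriple m z (MvPolynomial.X s) = tripleCoords m z s := MvPolynomial.aeval_X _ _

theorem evalTriple_genQ (z : Phase N n) :
    (genQ n N).map (evalTriple m z : TripleRing n N →+* ℝ) = vietePoly z.1 := by
  rw [genQ, vietePoly_map]
  congr 1
  funext i
  exact evalTriple_X _ _

theorem evalTriple_genV (z : Phase N n) :
    (genV n N).map (evalTriple m z : TripleRing n N →+* ℝ) = phaseV m z := by
  rw [genV, vecPoly_map, phaseV]
  congr 1
  funext i
  exact evalTriple_X _ _

theorem spectral_phase (hn : 1 ≤ n) {z : Phase N n} (hz : z ∈ phaseDomain N n m) :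
    spectral (vietePoly z.1) (phaseV m z) (phaseW m z) = phaseS m z := by
  rw [spectral, mul_phaseW hn hz]
  ring

theorem evalTriple_genW (hn : 1 ≤ n) (hm : m ≤ N) {z : Phase N n} (hz : z ∈ phaseDomain N n m) :
    (genW n N).map (evalTriple m z : TripleRing n N →+* ℝ) = phaseW m z := by
  rw [genW, tripleW_map _ genQ_mem, evalTriple_genQ, evalTriple_genV, lowPoly_map]
  symm
  refine eq_tripleW (vietePoly_sub_mem _) (lowPoly_mem _) ?_ ?_
  · rw [spectral_phase hn hz]
    exact phaseS_mem hm z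
  · intro j hj
    have := coeff_lowPoly (fun i : Fin N => (evalTriple m z : TripleRing n N →+* ℝ)
      (MvPolynomial.X (.inr (.inr i)))) ⟨j, hj⟩
    simp only at this
    rw [this]
    exact (evalTriple_X z (.inr (.inr ⟨j, hj⟩))).symm

/-- The polynomial `X ^ m H` occupies the degrees `m, …, m + n - 1`; the `c_i` fill the remaining
degrees below `n + N`. -/
theorem coeff_phaseS (z : Phase N n) (i : Fin N) :
    (phaseS m z).coeff (if (i : ℕ) < m then (i : ℕ) else n + i) = z.2.2 i := by
  rw [phaseS, sigmaPoly, coeff_add, coeff_add, coeff_X_pow, if_neg (by split_ifs <;> omega),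
    zero_add, finsetSum_coeff, Finset.sum_eq_single i, coeff_C_mul_X_pow, if_pos rfl,
    coeff_X_pow_mul']
  · split_ifs with h1 h2
    · omega
    · rw [add_zero]
    · rw [mem_degreeLT_iff_coeff.1 (hamPoly_mem z) _ (by omega), add_zero]
    · rw [add_zero]
  · intro j _ hj
    rw [coeff_C_mul_X_pow, if_neg]
    intro h
    apply hj
    ext
    split_ifs at h <;> omega
  · simp

theorem evalTriple_coeff (z : Phase N n) (f : (TripleRing n N)[X]) (k : ℕ) :
    evalTriple m z (f.coeff k) = (f.map (evalTriple m z : TripleRing n N →+* ℝ)).coeff k :=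
  (coeff_map _ _).symm

/-! ### From the phase space to jets and back. -/

section RightInverse

variable {z : Phase N n}

theorem mapQ_jetOf (hN : 1 ≤ N) (z : Phase N n) : mapQ N n (jetOf m z) = z.1 := by
  funext i
  rw [mapQ, val_jetOf, toTriple_coeffP hN, map_mul, map_ofNat, evalTriple_X]
  simp [tripleCoords]

theorem val_jetOf_dx (hN : 1 ≤ N) (z : Phase N n) (i : Fin n) :
    val (jetOf m z) (dx (coeffP N (i + 1))) = 2 * Matrix.mulVec (metric m z.1) z.2.1 i := by
  have h2 : tripleDx n N (2 * MvPolynomial.X (.inl i)) = 2 * MvPolynomial.X (.inr (.inl i)) := by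
    rw [two_mul, map_add, ← coeff_genQ, ← coeff_coeffDer, tripleDx_genQ, coeff_genV, two_mul]
  rw [val_jetOf, toTriple_dx, toTriple_coeffP hN, h2, map_mul, map_ofNat, evalTriple_X]
  rfl

theorem mapP_jetOf (hN : 1 ≤ N) (hz : z ∈ phaseDomain N n m) : mapP N n m (jetOf m z) = z.2.1 := by
  funext i
  rw [mapP, mapQ_jetOf hN]
  simp only [val_jetOf_dx hN]
  have hu : IsUnit (metric m z.1).det := isUnit_iff_ne_zero.2 hz
  have h : Matrix.mulVec (metric m z.1)⁻¹ (Matrix.mulVec (metric m z.1) z.2.1) i = z.2.1 i := by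
    rw [Matrix.mulVec_mulVec, Matrix.nonsing_inv_mul _ hu, Matrix.one_mulVec]
  rw [← h, Matrix.mulVec, dotProduct, Finset.mul_sum]
  refine Finset.sum_congr rfl fun j _ => ?_
  ring

theorem mapC_jetOf (hN : 1 ≤ N) (hn : 1 ≤ n) (hm : m ≤ N) (hz : z ∈ phaseDomain N n m) :
    mapC N n m (jetOf m z) = z.2.2 := by
  funext i
  rw [mapC, val_jetOf, toTriple_coeffH hN, evalTriple_coeff, spectral, Polynomial.map_sub,
    Polynomial.map_mul, Polynomial.map_mul, Polynomial.map_pow, evalTriple_genQ, evalTriple_genV,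
    evalTriple_genW hn hm hz, quarter_map, ← coeff_phaseS (m := m) z i, ← spectral_phase hn hz,
    spectral]

theorem vieteMap_jetOf (hN : 1 ≤ N) (hn : 1 ≤ n) (hm : m ≤ N) (hz : z ∈ phaseDomain N n m) :
    vieteMap N n m (jetOf m z) = z := by
  rw [vieteMap, mapQ_jetOf hN, mapP_jetOf hN hz, mapC_jetOf hN hn hm hz]

theorem jetOf_mem (hN : 1 ≤ N) (hz : z ∈ phaseDomain N n m) : jetOf m z ∈ jetDomain N n m := by
  refine ⟨fun i k => ?_, ?_⟩
  · rw [val_jetOf, toTriple_stationary hN, map_zero]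
  · rw [mapQ_jetOf hN]
    exact hz

end RightInverse

/-! ### From stationary jets to the phase space and back. -/

section LeftInverse

variable {ξ : Jet N}

/-- Evaluation of differential polynomials at a jet as an algebra homomorphism. -/
def valHom (ξ : Jet N) : DiffPoly N →ₐ[ℝ] ℝ := MvPolynomial.aeval ξ

theorem valHom_apply (ξ : Jet N) (f : DiffPoly N) : valHom ξ f = val ξ f := by
  rw [valHom, MvPolynomial.aeval_eq_eval]
  rfl

theorem val_smul (ξ : Jet N) (r : ℝ) (f : DiffPoly N) : val ξ (r • f) = r * val ξ f := by
  rw [← valHom_apply, map_smul, valHom_apply, smul_eq_mul]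

theorem valHom_diffQ (ξ : Jet N) :
    (diffQ N n).map (valHom ξ : DiffPoly N →+* ℝ) = vietePoly (mapQ N n ξ) := by
  rw [diffQ, vietePoly_map]
  congr 1
  funext i
  exact (valHom_apply _ _).trans (val_smul _ _ _)

theorem metric_mulVec_mapP (hξ : ξ ∈ jetDomain N n m) (i : Fin n) :
    Matrix.mulVec (metric m (mapQ N n ξ)) (mapP N n m ξ) i
      = 1 / 2 * val ξ (dx (coeffP N (i + 1))) := by
  have hu : IsUnit (metric m (mapQ N n ξ)).det := isUnit_iff_ne_zero.2 hξ.2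
  have h : mapP N n m ξ = Matrix.mulVec (metric m (mapQ N n ξ))⁻¹
      fun j => 1 / 2 * val ξ (dx (coeffP N (j + 1))) := by
    funext k
    rw [mapP, Matrix.mulVec, dotProduct, Finset.mul_sum]
    refine Finset.sum_congr rfl fun j _ => ?_
    ring
  rw [h, Matrix.mulVec_mulVec, Matrix.mul_nonsing_inv _ hu, Matrix.one_mulVec]

theorem coeff_diffV (i : Fin n) :
    (diffV N n).coeff (n - 1 - i) = (1 / 2 : ℝ) • dx (coeffP N (i + 1)) := by
  have h := coeff_vecPoly (fun i : Fin n => (1 / 2 : ℝ) • coeffP N (i + 1)) i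
  rw [diffV, coeff_coeffDer, diffQ, vietePoly, coeff_add, coeff_X_pow, if_neg (by omega), zero_add,
    h, Derivation.map_smul]

theorem valHom_diffV (hξ : ξ ∈ jetDomain N n m) :
    (diffV N n).map (valHom ξ : DiffPoly N →+* ℝ) = phaseV m (vieteMap N n m ξ) := by
  refine ext_of_mem (sub_mem_map _ diffV_mem) (phaseV_mem _) fun i => ?_
  rw [phaseV, coeff_vecPoly, coeff_map, coeff_diffV]
  refine (valHom_apply _ _).trans ((val_smul _ _ _).trans ?_)
  exact (metric_mulVec_mapP hξ i).symm

/-- The map records only the coefficients `c` of the spectral polynomial of the jet. The missing `n`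
coefficients are forced: both polynomials are congruent to `V² / 4` modulo `Q`, and their difference
is `X ^ m` times a polynomial of degree `< n`. -/
theorem valHom_spectral (hN : 1 ≤ N) (hn : 1 ≤ n) (hm : m ≤ N) (hξ : ξ ∈ jetDomain N n m) :
    (spectral (diffQ N n) (diffV N n) (diffW N n)).map (valHom ξ : DiffPoly N →+* ℝ)
      = phaseS m (vieteMap N n m ξ) := by
  have hz : vieteMap N n m ξ ∈ phaseDomain N n m := hξ.2
  generalize hS : (spectral (diffQ N n) (diffV N n) (diffW N n)).map
    (valHom ξ : DiffPoly N →+* ℝ) = S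
  have hSm : S - X ^ (2 * n + N) ∈ degreeLT ℝ (n + N) := by
    have := sub_mem_map (valHom ξ : DiffPoly N →+* ℝ) (bilPoly_diffQ_mem N n hN)
    rw [← spectral_diff, Polynomial.map_sub, hS] at this
    simpa using this
  have hc : ∀ i : Fin N, S.coeff (if (i : ℕ) < m then (i : ℕ) else n + i)
      = (phaseS m (vieteMap N n m ξ)).coeff (if (i : ℕ) < m then (i : ℕ) else n + i) := by
    intro i
    rw [coeff_phaseS, ← hS, spectral_diff, coeff_map, ← coeffH_eq]
    exact valHom_apply _ _
  have hlow : ∀ k < m, (S - phaseS m (vieteMap N n m ξ)).coeff k = 0 := by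
    intro k hk
    have := hc ⟨k, by omega⟩
    simp only [hk, if_true] at this
    rw [coeff_sub, this, sub_self]
  -- Degrees from `n + m` to `n + N - 1` are covered by the `c_i` with `i > m`; above them both
  -- polynomials equal `X ^ (2n+N)`.
  have hhigh : S - phaseS m (vieteMap N n m ξ) ∈ degreeLT ℝ (n + m) := by
    rw [mem_degreeLT_iff_coeff]
    intro k hk
    by_cases hkN : k < n + N
    · have := hc ⟨k - n, by omega⟩
      simp only [show ¬ k - n < m by omega, if_false, show n + (k - n) = k by omega] at this
      rw [coeff_sub, this, sub_self]
    · have h := sub_mem hSm (phaseS_mem hm (vieteMap N n m ξ))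
      rw [sub_sub_sub_cancel_right] at h
      exact mem_degreeLT_iff_coeff.1 h k (by omega)
  have hX : S - phaseS m (vieteMap N n m ξ)
      = X ^ m * shiftDown m (S - phaseS m (vieteMap N n m ξ)) := by
    ext k
    rw [coeff_X_pow_mul']
    split_ifs with h
    · rw [coeff_shiftDown, Nat.sub_add_cancel h]
    · exact hlow k (by omega)
  have hdvd : vietePoly (vieteMap N n m ξ).1 ∣ S - phaseS m (vieteMap N n m ξ) := by
    refine ⟨phaseW m (vieteMap N n m ξ) - (diffW N n).map (valHom ξ : DiffPoly N →+* ℝ), ?_⟩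
    have h1 := mul_phaseW hn hz
    have h2 := hS
    rw [spectral, Polynomial.map_sub, Polynomial.map_mul, Polynomial.map_mul, Polynomial.map_pow,
      valHom_diffQ, valHom_diffV hξ, quarter_map] at h2
    have h3 : (vieteMap N n m ξ).1 = mapQ N n ξ := rfl
    rw [h3] at h1 ⊢
    linear_combination -h1 - h2
  have h0 : shiftDown m (S - phaseS m (vieteMap N n m ξ)) = 0 := by
    refine eq_zero_of_dvd_of_mem (vietePoly_sub_mem (vieteMap N n m ξ).1) (shiftDown_mem hhigh) ?_
    rw [hX] at hdvd
    exact (isCoprime_X_pow (vieteMap N n m ξ).1 hn hz).symm.dvd_of_dvd_mul_left hdvd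
  rw [h0, mul_zero] at hX
  exact sub_eq_zero.1 hX

theorem valHom_diffW (hN : 1 ≤ N) (hn : 1 ≤ n) (hm : m ≤ N) (hξ : ξ ∈ jetDomain N n m) :
    (diffW N n).map (valHom ξ : DiffPoly N →+* ℝ) = phaseW m (vieteMap N n m ξ) := by
  have h := valHom_spectral hN hn hm hξ
  have hz : vieteMap N n m ξ ∈ phaseDomain N n m := hξ.2
  rw [← spectral_phase hn hz, spectral, spectral, Polynomial.map_sub, Polynomial.map_mul,
    Polynomial.map_mul, Polynomial.map_pow, valHom_diffQ, valHom_diffV hξ, quarter_map,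
    sub_right_inj] at h
  exact mul_left_cancel₀ (vietePoly_monic (mapQ N n ξ)).ne_zero h

/-- The triple built from the phase point has the same coordinates as the triple of differential
polynomials evaluated at `ξ`. On the stationary manifold the latter returns the jet. -/
theorem jetOf_vieteMap (hN : 1 ≤ N) (hn : 1 ≤ n) (hm : m ≤ N) (hξ : ξ ∈ jetDomain N n m) :
    jetOf m (vieteMap N n m ξ) = ξ := by
  have h : evalTriple m (vieteMap N n m ξ) = (valHom ξ).comp (ofTriple N n) := by
    refine MvPolynomial.algHom_ext fun s => ?_
    rw [evalTriple_X, AlgHom.comp_apply, ofTriple, MvPolynomial.aeval_X]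
    rcases s with i | i | j
    · exact ((valHom_apply _ _).trans (val_smul _ _ _)).symm
    · refine Eq.trans ?_ ((congrArg (valHom ξ) (coeff_diffV i)).symm)
      exact (metric_mulVec_mapP hξ i).trans ((valHom_apply _ _).trans (val_smul _ _ _)).symm
    · change (phaseW m (vieteMap N n m ξ)).coeff j = valHom ξ ((diffW N n).coeff j)
      rw [← valHom_diffW hN hn hm hξ, coeff_map]
      rfl
  funext a
  rw [jetOf, h, AlgHom.comp_apply, valHom_apply]
  exact val_ofTriple_toTriple hN hξ.1 a

end LeftInverse

/-! ### Correspondence of the flows. -/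

section Flows

variable {z : Phase N n} {r : Fin n}

theorem contDiffOn_evalTriple (hm : m ≤ N) (f : TripleRing n N) :
    ContDiffOn ℝ ∞ (fun z : Phase N n => evalTriple m z f) (phaseDomain N n m) := by
  induction f using MvPolynomial.induction_on with
  | C a =>
    have : (fun z : Phase N n => evalTriple m z (MvPolynomial.C a)) = fun _ => a := by
      funext z
      exact MvPolynomial.aeval_C _ _
    rw [this]
    exact contDiffOn_const
  | add f g hf hg =>
    simp only [map_add]
    exact hf.add hg
  | mul_X f s hf =>
    simp only [map_mul, evalTriple_X]
    refine hf.mul ?_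
    rcases s with i | i | j
    · exact (contDiff_q i).contDiffOn
    · exact contDiffOn_mulVec contDiff_metric (fun i => (contDiff_p i).contDiffOn) i
    · exact (smoothPoly_phaseW hm).2 j

/-- By the product rule the coordinates suffice, and there it is the evolution of `Q`, `V`, `W`
under Hamilton's equations. -/
theorem evalTriple_flow (hn : 1 ≤ n) (hm : m ≤ N) (hz : z ∈ phaseDomain N n m)
    (f : TripleRing n N) : HasLineDerivAt ℝ (fun y : Phase N n => evalTriple m y f)
      (evalTriple m z (tripleFlow n N (n - r) f)) z (stackelFlow m r z) := by
  have hk : n - (r : ℕ) ≤ n := by omega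
  have hz0 : z + (0 : ℝ) • stackelFlow m r z = z := by rw [zero_smul, add_zero]
  have hX : ∀ s, HasLineDerivAt ℝ (fun y : Phase N n => tripleCoords m y s)
      (evalTriple m z (tripleFlow n N (n - r) (MvPolynomial.X s))) z (stackelFlow m r z) := by
    intro s
    rcases s with i | i | j
    · have h := hasPolyLineDeriv_flow_Q (r := r) hn hm hz (n - 1 - i)
      rw [← coeff_genQ, ← coeff_coeffDer, tripleFlow_genQ hk, evalTriple_coeff, shiftWr,
        Polynomial.map_sub, Polynomial.map_mul, Polynomial.map_mul, shiftDown_map, shiftDown_map,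
        evalTriple_genQ, evalTriple_genV, ← shiftWr]
      have hc : ∀ y : Phase N n, (vietePoly y.1).coeff (n - 1 - i) = y.1 i := by
        intro y
        rw [vietePoly, coeff_add, coeff_vecPoly, coeff_X_pow, if_neg (by omega), zero_add]
      simp only [hc] at h
      exact h
    · have h := hasPolyLineDeriv_flow_V (r := r) hn hm hz (n - 1 - i)
      rw [← coeff_genV, ← coeff_coeffDer, tripleFlow_genV hk, evalTriple_coeff, shiftWr,
        Polynomial.map_mul, Polynomial.map_sub, Polynomial.map_mul, Polynomial.map_mul,
        shiftDown_map, shiftDown_map, map_modByMonic _ (monic_of_sub_mem genQ_mem),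
        evalTriple_genQ, evalTriple_genW hn hm hz, Polynomial.map_ofNat, ← shiftWr]
      simp only [phaseV, coeff_vecPoly] at h
      exact h
    · have h := hasPolyLineDeriv_flow_W (r := r) hn hm hz j
      rw [← coeff_genW, ← coeff_coeffDer, tripleFlow_genW hk, evalTriple_coeff, flowW,
        Polynomial.map_sub, Polynomial.map_sub, Polynomial.map_mul, Polynomial.map_mul,
        Polynomial.map_mul, Polynomial.map_mul, shiftDown_map, shiftDown_map, shiftDown_map,
        map_modByMonic _ (monic_of_sub_mem genQ_mem), map_divByMonic _ (monic_of_sub_mem genQ_mem),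
        evalTriple_genQ, evalTriple_genV, evalTriple_genW hn hm hz, ← flowW]
      exact h
  induction f using MvPolynomial.induction_on with
  | C a =>
    have : (fun z : Phase N n => evalTriple m z (MvPolynomial.C a)) = fun _ => a := by
      funext z
      exact MvPolynomial.aeval_C _ _
    rw [this, ← MvPolynomial.algebraMap_eq, Derivation.map_algebraMap, map_zero]
    exact hasDerivAt_const _ _
  | add f g hf hg =>
    simp only [map_add]
    exact HasDerivAt.add hf hg
  | mul_X f s hf =>
    have h := HasDerivAt.mul hf (hX s)
    simp only [hz0] at h
    rw [Derivation.leibniz]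
    simp only [map_mul, map_add, smul_eq_mul, evalTriple_X]
    refine HasDerivAt.congr_deriv h ?_
    ring

theorem jetFlow_eq (r : ℕ) (ξ : Jet N) (a : Fin N × ℕ) :
    jetFlow N r ξ a = val ξ (flowDer N r (MvPolynomial.X a)) := by
  rw [flowDer, MvPolynomial.mkDerivation_X, jetFlow]

theorem val_jetOf_flow (hN : 1 ≤ N) (hn : 1 ≤ n) (hm : m ≤ N) (hz : z ∈ phaseDomain N n m)
    (f : DiffPoly N) : HasLineDerivAt ℝ (fun y : Phase N n => val (jetOf m y) f)
      (val (jetOf m z) (flowDer N (r + 1) f)) z (stackelFlow m r z) := by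
  simp only [val_jetOf]
  rw [toTriple_flowDer hN (by omega)]
  exact evalTriple_flow hn hm hz _

/-- The straight line through `ξ` need not stay in the stationary manifold, but a differential
polynomial is a polynomial in the jet variables on all of jet space, so the product rule gives its
derivative. -/
theorem hasDerivAt_val (r : ℕ) (ξ : Jet N) (f : DiffPoly N) :
    HasDerivAt (fun t : ℝ => val (ξ + t • jetFlow N r ξ) f) (val ξ (flowDer N r f)) 0 := by
  simp only [← valHom_apply]
  induction f using MvPolynomial.induction_on with
  | C a =>
    have : (fun t : ℝ => valHom (ξ + t • jetFlow N r ξ) (MvPolynomial.C a)) = fun _ => a := by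
      funext t
      exact MvPolynomial.aeval_C _ _
    rw [this, ← MvPolynomial.algebraMap_eq, Derivation.map_algebraMap, map_zero]
    exact hasDerivAt_const _ _
  | add f g hf hg =>
    simp only [map_add]
    exact HasDerivAt.add hf hg
  | mul_X f a hf =>
    have hX : HasDerivAt (fun t : ℝ => valHom (ξ + t • jetFlow N r ξ) (MvPolynomial.X a))
        (valHom ξ (flowDer N r (MvPolynomial.X a))) 0 := by
      rw [valHom_apply, ← jetFlow_eq]
      have h := ((hasDerivAt_id (0 : ℝ)).mul_const (jetFlow N r ξ a)).const_add (ξ a)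
      rw [one_mul] at h
      refine h.congr_of_eventuallyEq (Filter.Eventually.of_forall fun t => ?_)
      exact MvPolynomial.aeval_X _ _
    have h := HasDerivAt.mul hf hX
    rw [zero_smul, add_zero] at h
    rw [Derivation.leibniz]
    simp only [map_mul, map_add, smul_eq_mul]
    refine HasDerivAt.congr_deriv h ?_
    ring

/-- A differential polynomial with a known expression `g` in phase coordinates can be differentiated
there; this transports the evolution of `q` and `c` to jets. -/
theorem val_flowDer_eq (hN : 1 ≤ N) (hn : 1 ≤ n) (hm : m ≤ N) (hz : z ∈ phaseDomain N n m)
    {f : DiffPoly N} {g : Phase N n → ℝ} {d : ℝ}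
    (hg : ∀ y ∈ phaseDomain N n m, g y = val (jetOf m y) f)
    (hd : HasLineDerivAt ℝ g d z (stackelFlow m r z)) :
    val (jetOf m z) (flowDer N (r + 1) f) = d := by
  have h := (val_jetOf_flow (r := r) hN hn hm hz f).congr_of_eventuallyEq
    (Filter.eventuallyEq_of_mem (isOpen_phaseDomain.mem_nhds hz) hg)
  exact h.unique hd

theorem hasLineDerivAt_q (z v : Phase N n) (i : Fin n) :
    HasLineDerivAt ℝ (fun y : Phase N n => y.1 i) (v.1 i) z v := by
  have h := ((hasDerivAt_id (0 : ℝ)).mul_const (v.1 i)).const_add (z.1 i)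
  rw [one_mul] at h
  exact h

theorem hasLineDerivAt_p (z v : Phase N n) (i : Fin n) :
    HasLineDerivAt ℝ (fun y : Phase N n => y.2.1 i) (v.2.1 i) z v := by
  have h := ((hasDerivAt_id (0 : ℝ)).mul_const (v.2.1 i)).const_add (z.2.1 i)
  rw [one_mul] at h
  exact h

theorem hasLineDerivAt_c (z v : Phase N n) (i : Fin N) :
    HasLineDerivAt ℝ (fun y : Phase N n => y.2.2 i) (v.2.2 i) z v := by
  have h := ((hasDerivAt_id (0 : ℝ)).mul_const (v.2.2 i)).const_add (z.2.2 i)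
  rw [one_mul] at h
  exact h

theorem hasDerivAt_mapQ (hN : 1 ≤ N) (hn : 1 ≤ n) (hm : m ≤ N) (hz : z ∈ phaseDomain N n m) :
    HasDerivAt (fun t : ℝ => mapQ N n (jetOf m z + t • jetFlow N (r + 1) (jetOf m z)))
      (stackelFlow m r z).1 0 := by
  refine hasDerivAt_pi.2 fun i => ?_
  have h := (hasDerivAt_val (r + 1) (jetOf m z) (coeffP N ((i : ℕ) + 1))).const_mul (1 / 2)
  rw [val_flowDer_eq (g := fun y => 2 * y.1 i) (d := 2 * (stackelFlow m r z).1 i) hN hn hm hz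
    (fun y hy => by
      have := congrFun (mapQ_jetOf (m := m) hN y) i
      rw [mapQ] at this
      linarith) (HasDerivAt.const_mul 2 (hasLineDerivAt_q z _ i))] at h
  exact h.congr_deriv (by ring)

theorem hasDerivAt_mapC (hN : 1 ≤ N) (hn : 1 ≤ n) (hm : m ≤ N) (hz : z ∈ phaseDomain N n m) :
    HasDerivAt (fun t : ℝ => mapC N n m (jetOf m z + t • jetFlow N (r + 1) (jetOf m z)))
      (stackelFlow m r z).2.2 0 := by
  refine hasDerivAt_pi.2 fun i => ?_
  have h := hasDerivAt_val (r + 1) (jetOf m z)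
    (coeffH N n (if (i : ℕ) < m then (i : ℕ) else n + i))
  rwa [val_flowDer_eq (g := fun y => y.2.2 i) hN hn hm hz
    (fun y hy => (congrFun (mapC_jetOf hN hn hm hy) i).symm) (hasLineDerivAt_c z _ i)] at h

/-- The momenta as functions of `q` and of the derivatives of the `P_j`, which are stored in
the second component. -/
def momentum (m : ℕ) (i : Fin n) (y : Phase N n) : ℝ :=
  1 / 2 * ∑ j : Fin n, (metric m y.1)⁻¹ i j * y.2.1 j

/-- The momenta are not differential polynomials but smooth functions of the `P_j` and `(P_j)_x`.
These have the same values and velocities along the line in jet space and along the image of the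
line in phase space. The chain rule gives equal derivatives, and along the second curve the function
is `p_i` itself. -/
theorem hasDerivAt_mapP (hN : 1 ≤ N) (hn : 1 ≤ n) (hm : m ≤ N) (hz : z ∈ phaseDomain N n m) :
    HasDerivAt (fun t : ℝ => mapP N n m (jetOf m z + t • jetFlow N (r + 1) (jetOf m z)))
      (stackelFlow m r z).2.1 0 := by
  refine hasDerivAt_pi.2 fun i => ?_
  have hsm : ContDiffOn ℝ ∞ (momentum m i : Phase N n → ℝ) (phaseDomain N n m) :=
    contDiffOn_const.mul (ContDiffOn.sum fun j _ =>
      (contDiffOn_matrix_inv contDiff_metric (fun _ hy => hy) i j).mul (contDiff_p j).contDiffOn)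
  let w : Jet N → Phase N n := fun ξ =>
    (mapQ N n ξ, fun j => val ξ (dx (coeffP N ((j : ℕ) + 1))), 0)
  have hw0 : w (jetOf m z) ∈ phaseDomain N n m := by
    change (metric m (mapQ N n (jetOf m z))).det ≠ 0
    rw [mapQ_jetOf hN]
    exact hz
  have hdiff : DifferentiableAt ℝ (momentum m i : Phase N n → ℝ) (w (jetOf m z)) :=
    (hsm.contDiffAt (isOpen_phaseDomain.mem_nhds hw0)).differentiableAt (by simp)
  have hα : HasDerivAt (fun t : ℝ => w (jetOf m z + t • jetFlow N (r + 1) (jetOf m z)))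
      ((stackelFlow m r z).1, fun j => val (jetOf m z) (flowDer N (r + 1)
        (dx (coeffP N ((j : ℕ) + 1)))), 0) 0 :=
    (hasDerivAt_mapQ hN hn hm hz).prodMk
      ((hasDerivAt_pi.2 fun j => hasDerivAt_val _ _ _).prodMk (hasDerivAt_const _ _))
  have hβ : HasDerivAt (fun t : ℝ => w (jetOf m (z + t • stackelFlow m r z)))
      ((stackelFlow m r z).1, fun j => val (jetOf m z) (flowDer N (r + 1)
        (dx (coeffP N ((j : ℕ) + 1)))), 0) 0 := by
    refine HasDerivAt.prodMk ?_ ((hasDerivAt_pi.2 fun j : Fin n =>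
      val_jetOf_flow (r := r) hN hn hm hz (dx (coeffP N ((j : ℕ) + 1)))).prodMk (hasDerivAt_const _ _))
    simp only [mapQ_jetOf hN]
    exact hasDerivAt_pi.2 fun j => hasLineDerivAt_q z _ j
  have h1 := HasFDerivAt.comp_hasDerivAt_of_eq (0 : ℝ) hdiff.hasFDerivAt hα
    (by rw [zero_smul, add_zero])
  have h2 := HasFDerivAt.comp_hasDerivAt_of_eq (0 : ℝ) hdiff.hasFDerivAt hβ
    (by rw [zero_smul, add_zero])
  have h3 : HasLineDerivAt ℝ (fun y : Phase N n => momentum m i (w (jetOf m y)))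
      ((stackelFlow m r z).2.1 i) z (stackelFlow m r z) :=
    (hasLineDerivAt_p z _ i).congr_of_eventuallyEq (Filter.eventuallyEq_of_mem
      (isOpen_phaseDomain.mem_nhds hz) fun y hy => congrFun (mapP_jetOf hN hy) i)
  rw [← HasDerivAt.unique h2 h3]
  exact h1

end Flows

end CKdV

end

open CKdV
theorem theorem5p2 (N n m : ℕ) (hN : 1 ≤ N) (hn : 1 ≤ n) (hm : m ≤ N) :
    -- the Hamiltonians are smooth where `G_m` is non-degenerate, and they are the Stäckel
    -- Hamiltonians of the separation curve `σ(λ) + ∑_k H_k λ^{n-k} = λ^m μ²`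
    (∀ k : Fin n, ContDiffOn ℝ ∞ (hamiltonian m k) (phaseDomain N n m)) ∧
    (∀ z ∈ phaseDomain N n m, ∀ lam mu : Fin n → ℂ, Function.Injective lam →
      IsViete lam mu z.1 z.2.1 → ∀ i : Fin n,
        sigma n m z.2.2 (lam i)
            + ∑ k : Fin n, (hamiltonian m k z : ℂ) * lam i ^ (n - 1 - (k : ℕ))
          = lam i ^ m * mu i ^ 2) ∧
    -- the first flow of the hierarchy is the translation in `x`
    (∀ (ξ : Jet N) (a : Fin N × ℕ), jetFlow N 1 ξ a = ξ (a.1, a.2 + 1)) ∧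
    -- `(q, p, c)` are coordinates on `M_n` (where defined), with smooth inverse `Ψ`,
    -- and the flows correspond to each other under the change of coordinates
    ∃ Ψ : Phase N n → Jet N,
      Set.MapsTo (vieteMap N n m) (jetDomain N n m) (phaseDomain N n m) ∧
      Set.MapsTo Ψ (phaseDomain N n m) (jetDomain N n m) ∧
      Set.InvOn Ψ (vieteMap N n m) (jetDomain N n m) (phaseDomain N n m) ∧
      (∀ a : Fin N × ℕ, ContDiffOn ℝ ∞ (fun z => Ψ z a) (phaseDomain N n m)) ∧
      (∀ r : Fin n, ∀ ξ ∈ jetDomain N n m,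
        HasLineDerivAt ℝ (vieteMap N n m) (stackelFlow m r (vieteMap N n m ξ)) ξ
          (jetFlow N ((r : ℕ) + 1) ξ)) ∧
      (∀ r : Fin n, ∀ z ∈ phaseDomain N n m, ∀ a : Fin N × ℕ,
        HasLineDerivAt ℝ (fun z => Ψ z a) (jetFlow N ((r : ℕ) + 1) (Ψ z) a) z
          (stackelFlow m r z)) := by
  refine ⟨fun k => contDiffOn_hamiltonian hm k,
    fun z hz lam mu hinj h i => separation_curve hn hz hinj h i, jetFlow_one, jetOf m,
    fun ξ hξ => hξ.2, fun z hz => jetOf_mem hN hz,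
    ⟨fun ξ hξ => jetOf_vieteMap hN hn hm hξ, fun z hz => vieteMap_jetOf hN hn hm hz⟩,
    fun a => contDiffOn_evalTriple hm _, fun r ξ hξ => ?_, fun r z hz a => ?_⟩
  -- The derivatives were computed at jets of phase points; every jet of the domain is the jet of
  -- its own image.
  · have hz : vieteMap N n m ξ ∈ phaseDomain N n m := hξ.2
    have h := (hasDerivAt_mapQ (r := r) hN hn hm hz).prodMk
      ((hasDerivAt_mapP (r := r) hN hn hm hz).prodMk (hasDerivAt_mapC (r := r) hN hn hm hz))
    rw [jetOf_vieteMap hN hn hm hξ] at h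
    exact h
  · have h := val_jetOf_flow (r := r) hN hn hm hz (MvPolynomial.X a)
    rw [← jetFlow_eq] at h
    have hX : ∀ y : Phase N n, val (jetOf m y) (MvPolynomial.X a) = jetOf m y a :=
      fun y => MvPolynomial.eval_X a
    simp only [hX] at h
    exact h
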